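/- **Theorem.** Let $(G,E,D)$ be a private-key encryption scheme with probabilistic polynomial-time algorithms, where $G(1^n)$ is uniform on $\{0,1\}^n$, messages are strings of arbitrary length, $D$ may reject, and $D_k(E_k(x))=x$ always. Assume that it has indistinguishable encryptions under chosen plaintext attacks (CPA) by nonuniform probabilistic polynomial-time adversaries, and that its range is elusive: for every probabilistic polynomial-time $A$ and a random key $k\leftarrow G(1^n)$, the probability that $D_k$ accepts the string $A(1^n)$ is negligible in $n$. Let OT be a two-party protocol with polynomial-time parties which is a secure oblivious transfer protocol in the presence of semi-honest adversaries: on inputs $(x_0,x_1)\in(\{0,1\}^n)^2$ and $\beta\in\{0,1\}$ the receiver outputs $x_\beta$ except with negligible probability, and there are probabilistic polynomial-time simulators whose outputs on $(x_0,x_1)$ and on $(\beta,x_\beta)$ are computationally indistinguishable from the view of the sender and of the receiver, respectively. Let $\ell$ be a polynomial; $\ell(n)$ is the number of rounds. Computational indistinguishability is against nonuniform probabilistic polynomial-time distinguishers, with a negligible bound that is uniform over all inputs. Let $\mathcal C$ be a circuit of NAND gates with $m+s$ input bits ($m$ for the Monitor's state $\mu$, $s$ for the System's observation $\sigma$) and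 $m+1$ output gates, whose outputs do not feed any gate, computing $\mu[r+1]=\mathsf{nextstate}(\sigma[r],\mu[r])$ and the flag bit $\tau[r]=\mathsf{flag}(\sigma[r],\mu[r])$. Both parties know $\mathcal C$; the Monitor holds $\mu[1]\in\{0,1\}^m$, and in round $r$ the System holds $\sigma[r]\in\{0,1\}^s$. In the *Open Specification Protocol* the System does the following in round $r$. It chooses two uniform labels $w^0,w^1\in\{0,1\}^n$, independently, for every circuit input wire and every gate output wire; but for $r>1$ the labels of the $i$-th state input wire are those of the $i$-th state output wire of round $r-1$. For every gate with labels $L^0,L^1$ and $R^0,R^1$ on its left and right input wires and $S^0,S^1$ on its output wire, it sends in random order the four ciphertexts $E_{L^\alpha}(E_{R^\beta}(S^{\neg(\alpha\wedge\beta)}))$, $\alpha,\beta\in\{0,1\}$. It also sends the labels of the observation input wires that correspond to the bits of $\sigma[r]$, and both labels (for $0$ and for $1$) of the flag output wire. In round $1$ the Monitor moreover obtains, by one execution of OT for each $i\le m$, the label of the $i$-th state input wire that corresponds to $\mu_i[1]$. The Monitor opens the gates one after the other with the labels that it holds (a gate can be opened if exactly one of its four ciphertexts is decrypted without rejection), keeps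 the labels of the state output wires for the next round, and outputs the bit to which the label of the flag wire corresponds. Then, for every such circuit $\mathcal C$: 1. (Correctness) For every $d\in\mathbb N$ there is $n_0$ such that for all $n\ge n_0$, all $\mu[1]$ and all $\sigma=(\sigma[1],\dots,\sigma[\ell(n)])$, with probability greater than $1-\frac1{n^d}$ the Monitor's outputs are exactly $\tau[1],\dots,\tau[\ell(n)]$. 2. (Security without specification hiding, semi-honest parties) The view of a party consists of its input, its random choices and the messages that it receives. There are probabilistic polynomial-time simulators $\mathcal S_{\mathsf{Mon}}$ and $\mathcal S_{\mathsf{Sys}}$ such that, uniformly over all $\mu[1]$ and all $\sigma$ of length $\ell(n)$, $$\mathcal S_{\mathsf{Mon}}(1^n,\mu[1],\tau[1],\dots,\tau[\ell(n)])\ \text{ and }\ \mathcal S_{\mathsf{Sys}}(1^n,\sigma)$$ are computationally indistinguishable from the view of the Monitor and from the view of the System, respectively, in the execution of the protocol on $\mu[1]$, $\sigma$ and $1^n$. -/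

import Mathlib

open Filter

noncomputable section

namespace PPM

/-! ### Machine model: while-programs over binary trees, with a step count -/

/-- Binary trees, the data on which programs work. -/
inductive Data : Type
  | leaf : Data
  | node : Data → Data → Data

namespace Data

/-- Number of vertices of a tree. -/
def size : Data → ℕ
  | leaf => 1
  | node a b => a.size + b.size + 1

/-- Left subtree (a leaf for a leaf). -/
def fst : Data → Data
  | leaf => leaf
  | node a _ => a

/-- Right subtree (a leaf for a leaf). -/
def snd : Data → Data
  | leaf => leaf
  | node _ b => b

end Data

/-- While-programs over binary trees. A program transforms an input tree into an output tree. -/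
inductive Prog : Type
  | id : Prog
  | leaf : Prog
  | fst : Prog
  | snd : Prog
  | pair : Prog → Prog → Prog
  | comp : Prog → Prog → Prog
  | cond : Prog → Prog → Prog → Prog
  | loop : Prog → Prog

/-- `Runs p x y t`: on input `x` the program `p` halts with output `y` after `t` steps. Every basic
operation and every test is charged the size of the tree that it reads or copies, so that a step
corresponds to polynomially many steps of a Turing machine, and conversely.
`comp f g` runs `g` first; `cond c f g` runs `f` if `c` returns a leaf, and `g` otherwise;
`loop f` repeats `f` as long as the left subtree of the current tree is not a leaf. -/
inductive Runs : Prog → Data → Data → ℕ → Prop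
  | id (x : Data) : Runs .id x x x.size
  | leaf (x : Data) : Runs .leaf x .leaf x.size
  | fst (x : Data) : Runs .fst x x.fst x.size
  | snd (x : Data) : Runs .snd x x.snd x.size
  | pair {f g : Prog} {x y z : Data} {t u : ℕ} :
      Runs f x y t → Runs g x z u → Runs (.pair f g) x (.node y z) (t + u + x.size)
  | comp {f g : Prog} {x y z : Data} {t u : ℕ} :
      Runs g x y t → Runs f y z u → Runs (.comp f g) x z (t + u)
  | condLeaf {c f g : Prog} {x z : Data} {t u : ℕ} :
      Runs c x .leaf t → Runs f x z u → Runs (.cond c f g) x z (t + u + x.size)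
  | condNode {c f g : Prog} {x a b z : Data} {t u : ℕ} :
      Runs c x (.node a b) t → Runs g x z u → Runs (.cond c f g) x z (t + u + x.size)
  | loopDone {f : Prog} {x : Data} : x.fst = .leaf → Runs (.loop f) x x x.size
  | loopStep {f : Prog} {x y z : Data} {t u : ℕ} :
      x.fst ≠ .leaf → Runs f x y t → Runs (.loop f) y z u → Runs (.loop f) x z (t + u + x.size)

/-- Encoding of objects as trees. -/
class Code (α : Type) where
  code : α → Data

open Code (code)

instance : Code Data := ⟨fun x => x⟩

instance : Code Unit := ⟨fun _ => .leaf⟩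

instance : Code Bool := ⟨fun b => if b then .node .leaf .leaf else .leaf⟩

/-- Natural numbers are encoded in unary. -/
def codeNat : ℕ → Data
  | 0 => .leaf
  | n + 1 => .node .leaf (codeNat n)

instance : Code ℕ := ⟨codeNat⟩

instance {k : ℕ} : Code (Fin k) := ⟨fun i => codeNat i⟩

instance {α β : Type} [Code α] [Code β] : Code (α × β) := ⟨fun x => .node (code x.1) (code x.2)⟩

/-- Encoding of a list, entry by entry. -/
def codeList {α : Type} [Code α] : List α → Data
  | [] => .leaf
  | a :: l => .node (code a) (codeList l)

instance {α : Type} [Code α] : Code (List α) := ⟨codeList⟩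

instance {α : Type} [Code α] : Code (Option α) :=
  ⟨fun x => match x with
    | none => .leaf
    | some a => .node .leaf (code a)⟩

instance {α : Type} [Code α] {k : ℕ} : Code (List.Vector α k) := ⟨fun v => code v.toList⟩

instance {α : Type} [Code α] {k : ℕ} : Code (Fin k → α) := ⟨fun f => code (List.ofFn f)⟩

/-- A pair of objects indexed by a bit. -/
instance {α : Type} [Code α] : Code (Bool → α) := ⟨fun f => code (f false, f true)⟩

/-- `f` is computed by a program whose running time is polynomial in the size of the input. -/
def PolyTime {α β : Type} [Code α] [Code β] (f : α → β) : Prop :=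
  ∃ (p : Prog) (P : Polynomial ℕ), ∀ a : α,
    ∃ t : ℕ, t ≤ P.eval (code a).size ∧ Runs p (code a) (code (f a)) t

/-! ### Probabilistic polynomial time, negligible functions, indistinguishability -/

/-- A uniformly random bit string of length `k`. -/
def bits (k : ℕ) : PMF (List.Vector Bool k) := PMF.uniformOfFintype _

/-- Independent samples from finitely many distributions. -/
def indep {α : Type} : {k : ℕ} → (Fin k → PMF α) → PMF (Fin k → α)
  | 0, _ => pure Fin.elim0
  | _ + 1, p => do
      let a ← p 0
      let f ← indep fun i => p i.succ
      pure (Fin.cons a f)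

/-- A (uniform) probabilistic polynomial-time machine: on security parameter `n` (in unary) and
input `a` it tosses polynomially many coins and computes its output from `n`, `a` and the coins. -/
structure PPT (α β : Type) [Code α] [Code β] where
  run : ℕ × α × List Bool → β
  polyTime : PolyTime run
  coins : Polynomial ℕ

/-- Output distribution of a probabilistic polynomial-time machine. -/
def PPT.dist {α β : Type} [Code α] [Code β] (A : PPT α β) (n : ℕ) (a : α) : PMF β :=
  (bits (A.coins.eval n)).map fun r => A.run (n, a, r.toList)

/-- A nonuniform advice of polynomial size. -/
structure Advice where
  val : ℕ → Data
  polySize : ∃ P : Polynomial ℕ, ∀ n, (val n).size ≤ P.eval n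

/-- Negligible functions of the security parameter. -/
def Negligible (f : ℕ → ℝ) : Prop :=
  Asymptotics.SuperpolynomialDecay atTop (fun n : ℕ => (n : ℝ)) f

/-- Probability that a random bit is `true`. -/
def prTrue (p : PMF Bool) : ℝ := (p true).toReal

/-- Computational indistinguishability, against nonuniform probabilistic polynomial-time
distinguishers, of two ensembles indexed by the security parameter `n` and an input `i : ι n`. -/
def Indist {ι : ℕ → Type} (X Y : (n : ℕ) → ι n → PMF Data) : Prop :=
  ∀ (D : PPT (Data × Data) Bool) (z : Advice), ∃ ε : ℕ → ℝ, Negligible ε ∧ ∀ n i,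
    |prTrue ((X n i).bind fun v => D.dist n (z.val n, v)) -
      prTrue ((Y n i).bind fun v => D.dist n (z.val n, v))| ≤ ε n

/-! ### Symmetric encryption -/

/-- A private-key encryption scheme for messages of arbitrary length. The key generator outputs a
uniformly random string of length `n`, the security parameter. Encryption is probabilistic: its
last argument are its coins. Decryption may reject (`none`). -/
structure EncScheme where
  coins : Polynomial ℕ
  enc : ℕ → (key msg coin : List Bool) → List Bool
  dec : ℕ → (key ciphertext : List Bool) → Option (List Bool)
  enc_polyTime : PolyTime fun x : ℕ × List Bool × List Bool × List Bool =>
    enc x.1 x.2.1 x.2.2.1 x.2.2.2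
  dec_polyTime : PolyTime fun x : ℕ × List Bool × List Bool => dec x.1 x.2.1 x.2.2
  dec_enc : ∀ (n : ℕ) (k m r : List Bool), k.length = n → r.length = coins.eval (n + m.length) →
    dec n k (enc n k m r) = some m

namespace EncScheme

/-- Encryption with fresh coins; returns the ciphertext and the coins. -/
def encrypt (S : EncScheme) (n : ℕ) (k m : List Bool) : PMF (List Bool × List Bool) :=
  (bits (S.coins.eval (n + m.length))).map fun r => (S.enc n k m r.toList, r.toList)

/-- A nonuniform adversary in the chosen plaintext attack. From the security parameter, its advice,
its coins and the ciphertexts received so far it computes its next query, and in the end a guess.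
It makes `pre n` encryption queries (the first component of `ask`), then submits the challenge pair
(both components of `ask`), then makes `post n` further encryption queries. Its messages have
length at most `msgLen n`. -/
structure CPAAdversary where
  advice : Advice
  coins : Polynomial ℕ
  pre : Polynomial ℕ
  post : Polynomial ℕ
  msgLen : Polynomial ℕ
  ask : ℕ × Data × List Bool × List (List Bool) → List Bool × List Bool
  ask_polyTime : PolyTime ask
  guess : ℕ × Data × List Bool × List (List Bool) → Bool
  guess_polyTime : PolyTime guess

/-- The message that is encrypted in reply to the next query of the adversary; `b` selects the
message of the challenge pair, which must consist of messages of equal length. -/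
def CPAAdversary.message (A : CPAAdversary) (b : Bool) (n : ℕ) (r : List Bool)
    (replies : List (List Bool)) : List Bool :=
  let q := A.ask (n, A.advice.val n, r, replies)
  let m₀ := q.1.take (A.msgLen.eval n)
  let m₁ := q.2.take (A.msgLen.eval n)
  if replies.length = A.pre.eval n then
    if m₀.length = m₁.length then (if b then m₁ else m₀) else []
  else m₀

/-- The ciphertexts received by the adversary as replies to its first `i` queries. -/
def cpaReplies (S : EncScheme) (A : CPAAdversary) (b : Bool) (n : ℕ) (k r : List Bool) :
    ℕ → PMF (List (List Bool))
  | 0 => pure []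
  | i + 1 => do
      let h ← cpaReplies S A b n k r i
      let c ← S.encrypt n k (A.message b n r h)
      pure (h ++ [c.1])

/-- The guess of the adversary in the experiment in which message `b` of the pair is encrypted. -/
def cpaGame (S : EncScheme) (A : CPAAdversary) (b : Bool) (n : ℕ) : PMF Bool := do
  let k ← bits n
  let r ← bits (A.coins.eval n)
  let h ← cpaReplies S A b n k.toList r.toList (A.pre.eval n + 1 + A.post.eval n)
  pure (A.guess (n, A.advice.val n, r.toList, h))

/-- Indistinguishable encryptions under chosen plaintext attacks. -/
def CPASecure (S : EncScheme) : Prop :=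
  ∀ A : CPAAdversary,
    Negligible fun n => |prTrue (S.cpaGame A true n) - prTrue (S.cpaGame A false n)|

/-- Elusive range: a probabilistic polynomial-time machine that does not see the key produces a
string which decryption accepts only with negligible probability. -/
def ElusiveRange (S : EncScheme) : Prop :=
  ∀ A : PPT Unit (List Bool), Negligible fun n => prTrue (do
    let k ← bits n
    let c ← A.dist n ()
    pure (S.dec n k.toList c).isSome)

end EncScheme

/-! ### Oblivious transfer -/

/-- A two-party protocol in which the sender holds two strings and the receiver holds a bit. In
each of `rounds n` exchanges the sender and then the receiver send a (possibly empty) message of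
length at most `msgLen n`, computed in polynomial time from the security parameter, the own input,
the own coins and the messages received so far. At the end the receiver computes an output. -/
structure OTProtocol where
  rounds : Polynomial ℕ
  msgLen : Polynomial ℕ
  sndCoins : Polynomial ℕ
  rcvCoins : Polynomial ℕ
  snd : ℕ × (List Bool × List Bool) × List Bool × List (List Bool) → List Bool
  rcv : ℕ × Bool × List Bool × List (List Bool) → List Bool
  out : ℕ × Bool × List Bool × List (List Bool) → List Bool
  snd_polyTime : PolyTime snd
  rcv_polyTime : PolyTime rcv
  out_polyTime : PolyTime out

/-- Result of an execution of an oblivious transfer protocol: the two views (input, coins, received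
messages) and the output of the receiver. -/
structure OTExecution where
  sndView : (List Bool × List Bool) × List Bool × List (List Bool)
  rcvView : Bool × List Bool × List (List Bool)
  output : List Bool

namespace OTProtocol

/-- The messages received by the sender and those received by the receiver in the first `i`
exchanges, for given inputs and coins. -/
def messages (OT : OTProtocol) (n : ℕ) (x : List Bool × List Bool) (β : Bool) (rS rR : List Bool) :
    ℕ → List (List Bool) × List (List Bool)
  | 0 => ([], [])
  | i + 1 =>
      let h := OT.messages n x β rS rR i
      let a := (OT.snd (n, x, rS, h.1)).take (OT.msgLen.eval n)
      let b := (OT.rcv (n, β, rR, h.2 ++ [a])).take (OT.msgLen.eval n)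
      (h.1 ++ [b], h.2 ++ [a])

/-- An execution of the protocol on inputs `x` and `β`. -/
def exec (OT : OTProtocol) (n : ℕ) (x : List Bool × List Bool) (β : Bool) : PMF OTExecution := do
  let rS ← bits (OT.sndCoins.eval n)
  let rR ← bits (OT.rcvCoins.eval n)
  let h := OT.messages n x β rS.toList rR.toList (OT.rounds.eval n)
  pure ⟨(x, rS.toList, h.1), (β, rR.toList, h.2), OT.out (n, β, rR.toList, h.2)⟩

/-- The protocol securely computes oblivious transfer of strings of length `n` in the presence of
semi-honest adversaries: the receiver obtains the string that it selected, except with negligible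
probability, and each view can be simulated from the input and the ideal output of that party. -/
def Secure (OT : OTProtocol) : Prop :=
  (∃ ε : ℕ → ℝ, Negligible ε ∧ ∀ (n : ℕ) (x₀ x₁ : List.Vector Bool n) (β : Bool),
    prTrue ((OT.exec n (x₀.toList, x₁.toList) β).map fun e =>
      decide (e.output ≠ if β then x₁.toList else x₀.toList)) ≤ ε n) ∧
  (∃ simS : PPT (List Bool × List Bool) Data,
    Indist (ι := fun n => List.Vector Bool n × List.Vector Bool n × Bool)
      (fun n i => simS.dist n (i.1.toList, i.2.1.toList))
      (fun n i => (OT.exec n (i.1.toList, i.2.1.toList) i.2.2).map fun e => code e.sndView)) ∧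
  (∃ simR : PPT (Bool × List Bool) Data,
    Indist (ι := fun n => List.Vector Bool n × List.Vector Bool n × Bool)
      (fun n i => simR.dist n (i.2.2, if i.2.2 then i.2.1.toList else i.1.toList))
      (fun n i => (OT.exec n (i.1.toList, i.2.1.toList) i.2.2).map fun e => code e.rcvView))

end OTProtocol

/-! ### Specifications as circuits of NAND gates -/

/-- The wires that can be connected to a feed-in wire of a gate: the inputs for the state of the
monitor, the inputs for the observation of the system, and the outputs of the first `g` gates. -/
inductive Src (m s g : ℕ) : Type
  | mon : Fin m → Src m s g
  | sys : Fin s → Src m s g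
  | gate : Fin g → Src m s g

/-- Lookup of a value attached to a wire. -/
def Src.val {m s g : ℕ} {α : Type} (mon : Fin m → α) (sys : Fin s → α) (gate : Fin g → α) :
    Src m s g → α
  | .mon i => mon i
  | .sys i => sys i
  | .gate k => gate k

/-- A circuit of NAND gates that computes the next state (`m` bits) and the flag of a specification
from the current state (`m` bits) and the current observation (`s` bits). There are `g + m + 1`
gates in topological order; the outputs of the last `m + 1` gates are the output wires of the
circuit (`m` bits of state, then the flag) and are not connected to any gate. -/
structure Circuit (m s : ℕ) where
  g : ℕ
  left : Fin (g + m + 1) → Src m s g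
  right : Fin (g + m + 1) → Src m s g
  left_lt : ∀ j k, left j = .gate k → k.val < j.val
  right_lt : ∀ j k, right j = .gate k → k.val < j.val

namespace Circuit

variable {m s : ℕ}

/-- A non-output gate, as a gate. -/
def inner (C : Circuit m s) (k : Fin C.g) : Fin (C.g + m + 1) := ⟨k.val, by omega⟩

/-- The gate whose output is the `i`-th bit of the next state. -/
def stateGate (C : Circuit m s) (i : Fin m) : Fin (C.g + m + 1) := ⟨C.g + i.val, by omega⟩

/-- The gate whose output is the flag. -/
def flagGate (C : Circuit m s) : Fin (C.g + m + 1) := Fin.last _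

/-- Evaluation of the circuit from the inputs upwards: `op j` computes the value on the output
wire of gate `j` from the values on its left and right feed-in wires. -/
def run (C : Circuit m s) {α : Type} (mon : Fin m → α) (sys : Fin s → α)
    (op : Fin (C.g + m + 1) → α → α → α) (j : Fin (C.g + m + 1)) : α :=
  op j
    (match h : C.left j with
      | .mon i => mon i
      | .sys i => sys i
      | .gate k => have := C.left_lt j k h; C.run mon sys op (C.inner k))
    (match h : C.right j with
      | .mon i => mon i
      | .sys i => sys i
      | .gate k => have := C.right_lt j k h; C.run mon sys op (C.inner k))
termination_by j.val
decreasing_by all_goals simpa [inner] using this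

theorem run_eq (C : Circuit m s) {α : Type} (mon : Fin m → α) (sys : Fin s → α)
    (op : Fin (C.g + m + 1) → α → α → α) (j : Fin (C.g + m + 1)) :
    C.run mon sys op j =
      op j ((C.left j).val mon sys fun k => C.run mon sys op (C.inner k))
        ((C.right j).val mon sys fun k => C.run mon sys op (C.inner k)) := by
  rw [run]
  congr 1 <;> split <;> simp_all [Src.val]

/-- The bits on the output wires of the gates. -/
def eval (C : Circuit m s) (μ : Fin m → Bool) (σ : Fin s → Bool) : Fin (C.g + m + 1) → Bool :=
  C.run μ σ fun _ a b => !(a && b)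

def nextState (C : Circuit m s) (μ : Fin m → Bool) (σ : Fin s → Bool) : Fin m → Bool :=
  fun i => C.eval μ σ (C.stateGate i)

def flag (C : Circuit m s) (μ : Fin m → Bool) (σ : Fin s → Bool) : Bool :=
  C.eval μ σ C.flagGate

/-- The flags that the trusted third party returns in the ideal setting. -/
def flags (C : Circuit m s) : (Fin m → Bool) → List (Fin s → Bool) → List Bool
  | _, [] => []
  | μ, x :: σ => C.flag μ x :: C.flags (C.nextState μ x) σ

end Circuit

/-! ### Monitoring protocols -/

/-- Result of an execution of a monitoring protocol: the view of each party (input, coins, received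
messages) and the output of the monitor, one entry per round (`none` if it fails). -/
structure Execution where
  monView : Data
  sysView : Data
  output : List (Option Bool)

/-- The behaviour of a monitoring protocol for a fixed circuit: the distribution of its execution,
given the security parameter, the initial state and the sequence of observations. -/
abbrev MonitoringProtocol (m s : ℕ) : Type :=
  ℕ → (Fin m → Bool) → List (Fin s → Bool) → PMF Execution

/-- Correctness, for `ℓ n` rounds: the monitor outputs the ideal flags, with a probability that
eventually exceeds `1 - 1 / n ^ d`, for every `d`. -/
def MonitoringProtocol.Correct {m s : ℕ} (π : MonitoringProtocol m s) (C : Circuit m s)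
    (ℓ : Polynomial ℕ) : Prop :=
  ∀ d : ℕ, ∀ᶠ n : ℕ in atTop, ∀ (μ : Fin m → Bool) (σ : List (Fin s → Bool)),
    σ.length = ℓ.eval n →
      prTrue ((π n μ σ).map fun e => decide (e.output = (C.flags μ σ).map some)) >
        1 - 1 / (n : ℝ) ^ d

/-- Security without specification hiding, for `ℓ n` rounds. The simulator of the monitor is given
the initial state and the flags, the simulator of the system is given the observations. -/
def MonitoringProtocol.Secure {m s : ℕ} (π : MonitoringProtocol m s) (C : Circuit m s)
    (ℓ : Polynomial ℕ) : Prop :=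
  ∃ (simMon : PPT ((Fin m → Bool) × List Bool) Data) (simSys : PPT (List (Fin s → Bool)) Data),
    Indist (ι := fun n => (Fin m → Bool) × List.Vector (Fin s → Bool) (ℓ.eval n))
      (fun n i => simMon.dist n (i.1, C.flags i.1 i.2.toList))
      (fun n i => (π n i.1 i.2.toList).map Execution.monView) ∧
    Indist (ι := fun n => (Fin m → Bool) × List.Vector (Fin s → Bool) (ℓ.eval n))
      (fun n i => simSys.dist n i.2.toList)
      (fun n i => (π n i.1 i.2.toList).map Execution.sysView)

/-! ### The Open Specification Protocol -/

namespace OpenSpec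

variable {m s : ℕ}

/-- Labels are keys of the encryption scheme. A wire has one label for each of its two values. -/
abbrev Label (n : ℕ) : Type := List.Vector Bool n

/-- Double encryption of `x` under the keys `l`, `r`; returns the ciphertext and the coins. -/
def encrypt₂ (S : EncScheme) (n : ℕ) (l r x : List Bool) :
    PMF (List Bool × (List Bool × List Bool)) := do
  let c₁ ← S.encrypt n r x
  let c₂ ← S.encrypt n l c₁.1
  pure (c₂.1, (c₁.2, c₂.2))

/-- A garbled NAND gate for the labels `L`, `R` of its feed-in wires and the labels `W` of its
feed-out wire: the four ciphertexts in uniformly random order. Also returns the random choices. -/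
def garbleGate (S : EncScheme) (n : ℕ) (L R W : Bool → Label n) :
    PMF ((Fin 4 → List Bool) × Data) := do
  let row := fun α β : Bool => encrypt₂ S n (L α).toList (R β).toList (W (!(α && β))).toList
  let e₀₀ ← row false false
  let e₀₁ ← row false true
  let e₁₀ ← row true false
  let e₁₁ ← row true true
  let p ← PMF.uniformOfFintype (Equiv.Perm (Fin 4))
  let e := ![e₀₀, e₀₁, e₁₀, e₁₁]
  pure (fun i => (e (p i)).1, code ((fun i => (e i).2), (fun i => p i)))

/-- The message from the system to the monitor in one round: the garbled gates, the labels for the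
bits of the observation, and the labels for the values 0 and 1 of the flag. -/
abbrev Msg (C : Circuit m s) : Type :=
  (Fin (C.g + m + 1) → Fin 4 → List Bool) × (Fin s → List Bool) × (List Bool × List Bool)

/-- One round of the system on observation `x`, where `cur` are the labels of the state input
wires. Returns the labels of the state output wires (which are the labels of the state input wires
in the next round), the message, and the random choices. -/
def sysRound (S : EncScheme) (C : Circuit m s) (n : ℕ) (cur : Fin m → Bool → Label n)
    (x : Fin s → Bool) : PMF ((Fin m → Bool → Label n) × Msg C × Data) := do
  let sysL ← PMF.uniformOfFintype (Fin s → Bool → Label n)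
  let gateL ← PMF.uniformOfFintype (Fin (C.g + m + 1) → Bool → Label n)
  let label := Src.val cur sysL fun k => gateL (C.inner k)
  let G ← indep fun j => garbleGate S n (label (C.left j)) (label (C.right j)) (gateL j)
  pure (fun i => gateL (C.stateGate i),
    ((fun j => (G j).1), (fun i => (sysL i (x i)).toList),
      ((gateL C.flagGate false).toList, (gateL C.flagGate true).toList)),
    code (sysL, gateL, fun j => (G j).2))

/-- Opening a garbled gate with the two labels `l`, `r`: it succeeds if exactly one of the four
ciphertexts can be decrypted. -/
def openGate (S : EncScheme) (n : ℕ) (e : Fin 4 → List Bool) (l r : List Bool) :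
    Option (List Bool) :=
  match (List.ofFn e).filterMap (fun c => (S.dec n l c).bind (S.dec n r)) with
  | [x] => some x
  | _ => none

/-- One round of the monitor, which holds a label `st i` for each state input wire: it opens the
garbled circuit and returns the labels of the state output wires and the value of the flag. -/
def monRound (S : EncScheme) (C : Circuit m s) (n : ℕ) (st : Fin m → Option (List Bool))
    (msg : Msg C) : (Fin m → Option (List Bool)) × Option Bool :=
  let w := C.run st (fun i => some (msg.2.1 i)) fun j l r =>
    l.bind fun l => r.bind fun r => openGate S n (msg.1 j) l r
  (fun i => w (C.stateGate i),
    if w C.flagGate = some msg.2.2.1 then some false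
    else if w C.flagGate = some msg.2.2.2 then some true
    else none)

/-- The rounds of the protocol on the given observations; returns the messages received by the
monitor, the random choices of the system and the output of the monitor. -/
def rounds (S : EncScheme) (C : Circuit m s) (n : ℕ) :
    (Fin m → Bool → Label n) → (Fin m → Option (List Bool)) → List (Fin s → Bool) →
      PMF (List (Msg C) × List Data × List (Option Bool))
  | _, _, [] => pure ([], [], [])
  | cur, st, x :: σ => do
      let a ← sysRound S C n cur x
      let b := monRound S C n st a.2.1
      let z ← rounds S C n a.1 b.1 σ
      pure (a.2.1 :: z.1, a.2.2 :: z.2.1, b.2 :: z.2.2)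

/-- The protocol: the system chooses the labels of the state input wires of the first round, the
monitor obtains those for its initial state by oblivious transfers, and the rounds follow. -/
def protocol (S : EncScheme) (OT : OTProtocol) (C : Circuit m s) : MonitoringProtocol m s :=
  fun n μ σ => do
    let init ← PMF.uniformOfFintype (Fin m → Bool → Label n)
    let t ← indep fun i => OT.exec n ((init i false).toList, (init i true).toList) (μ i)
    let z ← rounds S C n init (fun i => some (t i).output) σ
    pure
      { monView := code (μ, (fun i => (t i).rcvView), z.1)
        sysView := code (σ, init, (fun i => (t i).sndView), z.2.1)
        output := z.2.2 }

end OpenSpec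

end PPM

end

/-! Call the label of a wire for the value that it carries active, and the other label inactive.

Correctness is a union bound. The right row of a garbled gate always decrypts, so a gate fails to
open only if one of the three other rows is accepted as well (`exists_acc₂_le`). Such a row contains
a ciphertext under one random key that is accepted by another. If the plaintext does not depend on
the accepting key, the elusive range forbids this. If it does, CPA security first replaces the
plaintext by zeros of the same length, and the length is then guessed at a polynomial loss
(`exists_acc_le`). Whatever the input labels of a round are, its state output labels are uniform, so
the failure bounds of the rounds add up (`rounds_fail_le`).

The System receives messages only in the oblivious transfers. Replacing the sender views one by one
by simulated ones is therefore enough (`exists_close_sysView`).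

For the Monitor, the labels of each wire are first renamed so that the active one has index `false`.
The labels are uniform and the rows are shuffled, so this does not change the distribution of the
messages; the private data survive only in the truth tables of the gates and in the order of the
flag labels (`rounds_eq_messages`). Next the receiver views of the transfers are simulated from the
active state labels alone, which frees the inactive ones to act as secret keys. Then all truth
tables are made constant `false`, entry by entry, gate by gate in topological order, and round by
round (`exists_close_clearEntry`, `exists_close_zeroTables`, `exists_close_messages`). An entry
other than `(false, false)` is encrypted under an inactive label; since earlier gates already
encrypt active labels only, this inactive label occurs in the round only as a key, and CPA security
applies. What remains depends on the initial state and the flags, and can be sampled.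

One difficulty comes from double encryption. If the secret key is the outer one, the challenge
messages are ciphertexts under a known inner key, and these may differ in length. CPA security still
controls this: by `exists_lenGap_le` the length distributions of the ciphertexts of two messages are
close for an average key, since otherwise the lengths of two ciphertexts would collide with
different probabilities depending on which messages are encrypted.

Two technical layers support the argument. Reductions receive everything outside the attacked
ciphertext as advice, which requires bounds that are uniform over polynomial-size advice
(`exists_uniform_negligible`, `close_scriptGame`). Machines are programs on trees, so closure
properties of `PolyTime` and of efficient sampling (`Samp`) produce adversaries and simulators. -/

namespace PPM

open scoped ENNReal

/-! ### Expectations -/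

/-- Expectation of a nonnegative function. -/
noncomputable def ex {α : Type} (p : PMF α) (f : α → ℝ≥0∞) : ℝ≥0∞ := ∑' a, p a * f a

section ex

variable {α β γ : Type}

@[simp] theorem ex_pure (a : α) (f : α → ℝ≥0∞) : ex (pure a) f = f a := by
  classical
  show ∑' b, (PMF.pure a) b * f b = f a
  rw [tsum_eq_single a]
  · simp
  · intro b hb
    simp [hb]

@[simp] theorem ex_pmf_pure (a : α) (f : α → ℝ≥0∞) : ex (PMF.pure a) f = f a := ex_pure a f

/-- Experiments are analysed as iterated expectations; this identity unfolds a program into that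
form. -/
theorem ex_bind (p : PMF α) (q : α → PMF β) (f : β → ℝ≥0∞) :
    ex (p.bind q) f = ex p fun a => ex (q a) f := by
  simp only [ex, PMF.bind_apply, ← ENNReal.tsum_mul_right, ← ENNReal.tsum_mul_left]
  rw [ENNReal.tsum_comm]
  simp only [mul_assoc]

@[simp] theorem ex_bind' (p : PMF α) (q : α → PMF β) (f : β → ℝ≥0∞) :
    ex (p >>= q) f = ex p fun a => ex (q a) f := ex_bind p q f

@[simp] theorem ex_map (p : PMF α) (g : α → β) (f : β → ℝ≥0∞) :
    ex (p.map g) f = ex p fun a => f (g a) := by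
  rw [PMF.map, ex_bind]
  simp

theorem monad_bind_eq (p : PMF α) (q : α → PMF β) : p >>= q = p.bind q := rfl

theorem monad_pure_eq (a : α) : (pure a : PMF α) = PMF.pure a := rfl

/-- Tonelli for nonnegative sums. It allows independent random choices to be drawn in any order, in
particular a secret key after all that does not depend on it. -/
theorem ex_comm (p : PMF α) (q : PMF β) (f : α → β → ℝ≥0∞) :
    (ex p fun a => ex q fun b => f a b) = ex q fun b => ex p fun a => f a b := by
  simp only [ex, ← ENNReal.tsum_mul_left]
  rw [ENNReal.tsum_comm]
  simp only [mul_left_comm]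

@[simp] theorem ex_const (p : PMF α) (c : ℝ≥0∞) : (ex p fun _ => c) = c := by
  simp [ex, ENNReal.tsum_mul_right, p.tsum_coe]

theorem ex_add (p : PMF α) (f g : α → ℝ≥0∞) : (ex p fun a => f a + g a) = ex p f + ex p g := by
  simp only [ex, mul_add]
  exact ENNReal.tsum_add

theorem ex_mul_left (p : PMF α) (c : ℝ≥0∞) (f : α → ℝ≥0∞) :
    (ex p fun a => c * f a) = c * ex p f := by
  simp only [ex, mul_left_comm, ENNReal.tsum_mul_left]

theorem ex_mul_right (p : PMF α) (c : ℝ≥0∞) (f : α → ℝ≥0∞) :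
    (ex p fun a => f a * c) = ex p f * c := by
  simp only [mul_comm _ c, ex_mul_left]

theorem ex_finset_sum {ι : Type} (p : PMF α) (s : Finset ι) (f : ι → α → ℝ≥0∞) :
    (ex p fun a => ∑ i ∈ s, f i a) = ∑ i ∈ s, ex p (f i) := by
  classical
  induction s using Finset.induction_on with
  | empty => simp
  | insert i s hi ih => simp [Finset.sum_insert hi, ex_add, ih]

theorem ex_mono_support (p : PMF α) {f g : α → ℝ≥0∞} (h : ∀ a ∈ p.support, f a ≤ g a) :
    ex p f ≤ ex p g := by
  refine ENNReal.tsum_le_tsum fun a => ?_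
  by_cases ha : a ∈ p.support
  · gcongr
    exact h a ha
  · rw [PMF.mem_support_iff, not_not] at ha
    simp [ha]

theorem ex_mono (p : PMF α) {f g : α → ℝ≥0∞} (h : ∀ a, f a ≤ g a) : ex p f ≤ ex p g :=
  ex_mono_support p fun a _ => h a

theorem ex_congr_support (p : PMF α) {f g : α → ℝ≥0∞} (h : ∀ a ∈ p.support, f a = g a) :
    ex p f = ex p g :=
  le_antisymm (ex_mono_support p fun a ha => (h a ha).le)
    (ex_mono_support p fun a ha => (h a ha).ge)

theorem ex_congr (p : PMF α) {f g : α → ℝ≥0∞} (h : ∀ a, f a = g a) : ex p f = ex p g :=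
  ex_congr_support p fun a _ => h a

theorem ex_le_one (p : PMF α) {f : α → ℝ≥0∞} (h : ∀ a, f a ≤ 1) : ex p f ≤ 1 :=
  (ex_mono p h).trans (by simp)

theorem ex_le_of_support (p : PMF α) {f : α → ℝ≥0∞} {c : ℝ≥0∞} (h : ∀ a ∈ p.support, f a ≤ c) :
    ex p f ≤ c :=
  (ex_mono_support p h).trans (by simp)

theorem apply_eq_ex [DecidableEq α] (p : PMF α) (a : α) :
    p a = ex p fun b => if b = a then 1 else 0 := by
  simp [ex]

/-- Indicator functions of points are among the test functions. -/
theorem pmf_ext_ex {p q : PMF α} (h : ∀ f, ex p f = ex q f) : p = q := by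
  classical
  ext a
  rw [apply_eq_ex, apply_eq_ex, h]

theorem bind_true (p : PMF α) (q : α → PMF Bool) :
    (p.bind q) true = ex p fun a => q a true := by
  rw [PMF.bind_apply]
  rfl

theorem ex_fintype [Fintype α] (p : PMF α) (f : α → ℝ≥0∞) : ex p f = ∑ a, p a * f a := by
  rw [ex, tsum_fintype]

/-- Uniform distribution. -/
noncomputable abbrev unif (α : Type) [Fintype α] [Nonempty α] : PMF α := PMF.uniformOfFintype α

theorem ex_unif [Fintype α] [Nonempty α] (f : α → ℝ≥0∞) :
    ex (unif α) f = ∑ a, (Fintype.card α : ℝ≥0∞)⁻¹ * f a := by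
  simp [ex_fintype]

theorem unif_map_equiv [Fintype α] [Nonempty α] [Fintype β] [Nonempty β] (e : α ≃ β) :
    (unif α).map e = unif β := by
  refine pmf_ext_ex fun f => ?_
  rw [ex_map, ex_unif, ex_unif, Fintype.card_congr e]
  exact Equiv.sum_comp e (fun b => (Fintype.card β : ℝ≥0∞)⁻¹ * f b)

theorem ex_unif_equiv [Fintype α] [Nonempty α] [Fintype β] [Nonempty β] (e : α ≃ β)
    (f : β → ℝ≥0∞) : ex (unif β) f = ex (unif α) fun a => f (e a) := by
  rw [← unif_map_equiv e, ex_map]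

theorem ex_unif_prod [Fintype α] [Nonempty α] [Fintype β] [Nonempty β] (f : α × β → ℝ≥0∞) :
    ex (unif (α × β)) f = ex (unif α) fun a => ex (unif β) fun b => f (a, b) := by
  simp only [ex_unif, Fintype.card_prod, Fintype.sum_prod_type, Finset.mul_sum]
  refine Finset.sum_congr rfl fun a _ => Finset.sum_congr rfl fun b _ => ?_
  rw [← mul_assoc]
  congr 1
  rw [Nat.cast_mul, ENNReal.mul_inv (by simp) (by simp)]

/-- Resampling one coordinate of a uniformly random function does not change its distribution. -/
theorem ex_unif_update {ι : Type} [Fintype ι] [DecidableEq ι] [Fintype α] [Nonempty α] (i : ι)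
    (f : (ι → α) → ℝ≥0∞) :
    ex (unif (ι → α)) f =
      ex (unif (ι → α)) fun g => ex (unif α) fun a => f (Function.update g i a) := by
  rw [ex_unif_equiv (Equiv.funSplitAt i α).symm, ex_unif_equiv (Equiv.funSplitAt i α).symm,
    ex_unif_prod, ex_unif_prod, ex_comm, ex_comm (unif α)]
  refine ex_congr _ fun h => ?_
  have key : ∀ a b, Function.update ((Equiv.funSplitAt i α).symm (a, h)) i b =
      (Equiv.funSplitAt i α).symm (b, h) := by
    intro a b
    ext j
    by_cases hj : j = i
    · subst hj; simp
    · simp [hj]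
  simp only [key, ex_const]

end ex

/-! ### Closeness -/

/-- Two numbers differ by at most `ε`. -/
def Close (ε x y : ℝ≥0∞) : Prop := x ≤ y + ε ∧ y ≤ x + ε

namespace Close

variable {ε ε' x y z : ℝ≥0∞}

theorem refl (x : ℝ≥0∞) : Close ε x x := ⟨le_self_add, le_self_add⟩

theorem of_eq (h : x = y) : Close ε x y := h ▸ refl x

theorem symm (h : Close ε x y) : Close ε y x := ⟨h.2, h.1⟩

theorem mono (h : Close ε x y) (hε : ε ≤ ε') : Close ε' x y :=
  ⟨h.1.trans (by gcongr), h.2.trans (by gcongr)⟩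

theorem trans (h : Close ε x y) (h' : Close ε' y z) : Close (ε + ε') x z := by
  constructor
  · calc x ≤ y + ε := h.1
      _ ≤ z + ε' + ε := by gcongr; exact h'.1
      _ = _ := by ring
  · calc z ≤ y + ε' := h'.2
      _ ≤ x + ε + ε' := by gcongr; exact h.2
      _ = _ := by ring

/-- The error may depend on the sample and is averaged with it. This matters for bounds that are
small only for an average key, such as those on ciphertext lengths. -/
theorem ex_fun {α : Type} (p : PMF α) {f g e : α → ℝ≥0∞}
    (h : ∀ a ∈ p.support, Close (e a) (f a) (g a)) : Close (ex p e) (ex p f) (ex p g) := by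
  constructor <;> rw [← ex_add]
  · exact ex_mono_support p fun a ha => (h a ha).1
  · exact ex_mono_support p fun a ha => (h a ha).2

theorem ex {α : Type} (p : PMF α) {f g : α → ℝ≥0∞}
    (h : ∀ a ∈ p.support, Close ε (f a) (g a)) : Close ε (ex p f) (ex p g) := by
  simpa using ex_fun p h

theorem abs_toReal {δ : ℝ} (hδ : 0 ≤ δ) (h : Close (ENNReal.ofReal δ) x y) (hx : x ≤ 1)
    (hy : y ≤ 1) : |x.toReal - y.toReal| ≤ δ := by
  have hx' : x ≠ ∞ := (hx.trans_lt ENNReal.one_lt_top).ne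
  have hy' : y ≠ ∞ := (hy.trans_lt ENNReal.one_lt_top).ne
  have h1 := ENNReal.toReal_mono (by simp [hy']) h.1
  have h2 := ENNReal.toReal_mono (by simp [hx']) h.2
  rw [ENNReal.toReal_add (by assumption) (by simp), ENNReal.toReal_ofReal hδ] at h1 h2
  rw [abs_le]
  constructor <;> linarith

theorem of_abs {δ : ℝ} (hx : x ≤ 1) (hy : y ≤ 1) (h : |x.toReal - y.toReal| ≤ δ) :
    Close (ENNReal.ofReal δ) x y := by
  have hx' : x ≠ ∞ := (hx.trans_lt ENNReal.one_lt_top).ne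
  have hy' : y ≠ ∞ := (hy.trans_lt ENNReal.one_lt_top).ne
  have hδ : 0 ≤ δ := (abs_nonneg _).trans h
  rw [abs_le] at h
  constructor
  · rw [← ENNReal.ofReal_toReal hx', ← ENNReal.ofReal_toReal hy', ← ENNReal.ofReal_add (by simp) hδ]
    exact ENNReal.ofReal_le_ofReal (by linarith)
  · rw [← ENNReal.ofReal_toReal hx', ← ENNReal.ofReal_toReal hy', ← ENNReal.ofReal_add (by simp) hδ]
    exact ENNReal.ofReal_le_ofReal (by linarith)

end Close

/-! ### Negligible functions -/

namespace Negligible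

variable {f g : ℕ → ℝ}

theorem add (hf : Negligible f) (hg : Negligible g) : Negligible fun n => f n + g n :=
  Asymptotics.SuperpolynomialDecay.add hf hg

theorem zero : Negligible fun _ => 0 :=
  Asymptotics.superpolynomialDecay_zero _ _

theorem const_mul (c : ℝ) (hf : Negligible f) : Negligible fun n => c * f n :=
  Asymptotics.SuperpolynomialDecay.const_mul hf c

theorem poly_mul (P : Polynomial ℕ) (hf : Negligible f) : Negligible fun n => (P.eval n : ℕ) * f n := by
  have := Asymptotics.SuperpolynomialDecay.polynomial_mul hf (P.map (Nat.castRingHom ℝ))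
  refine this.congr fun n => ?_
  simp [Polynomial.eval_natCast_map]

theorem mono (hf : Negligible f) (h0 : ∀ n, 0 ≤ g n) (h : ∀ n, g n ≤ f n) : Negligible g := by
  refine Asymptotics.SuperpolynomialDecay.trans_abs_le hf fun n => ?_
  simp only [abs_of_nonneg (h0 n), abs_of_nonneg ((h0 n).trans (h n)), h n]

/-- `n ^ k * √f` is the square root of `n ^ (2 * k) * f`, which still tends to zero. -/
theorem sqrt (hf : Negligible f) : Negligible fun n => Real.sqrt (f n) := by
  intro k
  have h := (hf (2 * k)).sqrt
  simp only [Real.sqrt_zero] at h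
  refine h.congr fun n => ?_
  rw [Real.sqrt_mul (by positivity), pow_mul', Real.sqrt_sq (by positivity)]

theorem two_pow : Negligible fun n => ((1 : ℝ) / 2) ^ n := by
  intro k
  exact tendsto_pow_const_mul_const_pow_of_abs_lt_one k (by norm_num [abs_of_pos])

theorem max_zero (hf : Negligible f) : Negligible fun n => |f n| := by
  refine Asymptotics.SuperpolynomialDecay.trans_abs_le hf fun n => ?_
  simp

end Negligible

/-- A sequence of extended nonnegative numbers with a negligible upper bound. -/
def ENegl (ε : ℕ → ℝ≥0∞) : Prop :=
  ∃ δ : ℕ → ℝ, Negligible δ ∧ (∀ n, 0 ≤ δ n) ∧ ∀ n, ε n ≤ ENNReal.ofReal (δ n)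

namespace ENegl

variable {ε ε' : ℕ → ℝ≥0∞}

theorem ofReal {δ : ℕ → ℝ} (h : Negligible δ) : ENegl fun n => ENNReal.ofReal (δ n) :=
  ⟨_, h.max_zero, fun _ => abs_nonneg _, fun _ => ENNReal.ofReal_le_ofReal (le_abs_self _)⟩

theorem mono (h : ENegl ε) (hle : ∀ n, ε' n ≤ ε n) : ENegl ε' := by
  obtain ⟨δ, h1, h2, h3⟩ := h
  exact ⟨δ, h1, h2, fun n => (hle n).trans (h3 n)⟩

theorem zero : ENegl fun _ => 0 := ⟨_, Negligible.zero, fun _ => le_rfl, by simp⟩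

theorem add (h : ENegl ε) (h' : ENegl ε') : ENegl fun n => ε n + ε' n := by
  obtain ⟨δ, h1, h2, h3⟩ := h
  obtain ⟨δ', h1', h2', h3'⟩ := h'
  refine ⟨_, h1.add h1', fun n => add_nonneg (h2 n) (h2' n), fun n => ?_⟩
  rw [ENNReal.ofReal_add (h2 n) (h2' n)]
  exact add_le_add (h3 n) (h3' n)

theorem poly_mul (P : Polynomial ℕ) (h : ENegl ε) : ENegl fun n => (P.eval n : ℕ) * ε n := by
  obtain ⟨δ, h1, h2, h3⟩ := h
  refine ⟨_, h1.poly_mul P, fun n => mul_nonneg (by positivity) (h2 n), fun n => ?_⟩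
  rw [ENNReal.ofReal_mul (by positivity), ENNReal.ofReal_natCast]
  exact mul_le_mul_right (h3 n) _

theorem const_mul (k : ℕ) (h : ENegl ε) : ENegl fun n => k * ε n := by
  simpa using h.poly_mul (Polynomial.C k)

theorem sum {ι : Type} (s : Finset ι) {ε : ι → ℕ → ℝ≥0∞} (h : ∀ i ∈ s, ENegl (ε i)) :
    ENegl fun n => ∑ i ∈ s, ε i n := by
  classical
  induction s using Finset.induction_on with
  | empty => simpa using zero
  | insert i s hi ih =>
    simp only [Finset.sum_insert hi]
    exact (h i (by simp)).add (ih fun j hj => h j (by simp [hj]))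

theorem two_pow : ENegl fun n => (2⁻¹ : ℝ≥0∞) ^ n := by
  refine (ofReal Negligible.two_pow).mono fun n => ?_
  rw [ENNReal.ofReal_pow (by norm_num)]
  rw [one_div, ENNReal.ofReal_inv_of_pos (by norm_num)]
  simp

end ENegl

/-! ### Independent samples -/

section indep

variable {α β : Type}

theorem indep_succ {k : ℕ} (p : Fin (k + 1) → PMF α) :
    indep p = (p 0).bind fun a => (indep fun i => p i.succ).bind fun f => pure (Fin.cons a f) := rfl

@[simp] theorem indep_zero (p : Fin 0 → PMF α) : indep p = pure Fin.elim0 := rfl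

theorem ex_indep_succ {k : ℕ} (p : Fin (k + 1) → PMF α) (f : (Fin (k + 1) → α) → ℝ≥0∞) :
    ex (indep p) f = ex (p 0) fun a => ex (indep fun i => p i.succ) fun g => f (Fin.cons a g) := by
  simp [indep_succ, ex_bind]

/-- The product formula makes the recursively defined `indep` symmetric in its indices, so that
families can be permuted and reindexed. -/
theorem indep_apply {k : ℕ} (p : Fin k → PMF α) (f : Fin k → α) : indep p f = ∏ i, p i (f i) := by
  classical
  induction k with
  | zero =>
    rw [Subsingleton.elim f Fin.elim0]
    simp [indep, pure]
  | succ k ih =>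
    rw [apply_eq_ex, ex_indep_succ, Fin.prod_univ_succ, ← ih (fun i => p i.succ) (fun i => f i.succ),
      apply_eq_ex (p 0), apply_eq_ex (indep _), ← ex_mul_right]
    refine ex_congr _ fun a => ?_
    rw [← ex_mul_left]
    refine ex_congr _ fun g => ?_
    have h : Fin.cons a g = f ↔ a = f 0 ∧ g = fun i => f i.succ := by
      conv_lhs => rw [← Fin.cons_self_tail f, Fin.cons_inj]
      rfl
    simp only [h]
    split_ifs <;> simp_all

theorem mem_support_indep {k : ℕ} (p : Fin k → PMF α) (f : Fin k → α) :
    f ∈ (indep p).support ↔ ∀ i, f i ∈ (p i).support := by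
  simp [PMF.mem_support_iff, indep_apply, Finset.prod_eq_zero_iff]

theorem indep_congr {k : ℕ} {p q : Fin k → PMF α} (h : ∀ i, p i = q i) : indep p = indep q := by
  rw [funext h]

theorem indep_map {k : ℕ} (p : Fin k → PMF α) (g : Fin k → α → β) :
    indep (fun i => (p i).map (g i)) = (indep p).map fun f i => g i (f i) := by
  induction k with
  | zero =>
    refine pmf_ext_ex fun f => ?_
    simp [Subsingleton.elim (fun i : Fin 0 => g i (Fin.elim0 i)) Fin.elim0]
  | succ k ih =>
    refine pmf_ext_ex fun f => ?_
    simp only [ex_indep_succ, ex_map, ih (fun i => p i.succ) fun i => g i.succ]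
    refine ex_congr _ fun a => ex_congr _ fun h => ?_
    congr 1
    ext i
    cases i using Fin.cases <;> simp

/-- Samples made in two stages: all first stages can be drawn before any second stage, because
different indices do not interact. -/
theorem ex_indep_bind {k : ℕ} (p : Fin k → PMF α) (q : Fin k → α → PMF β)
    (φ : (Fin k → β) → ℝ≥0∞) :
    ex (indep fun i => (p i).bind (q i)) φ =
      ex (indep p) fun f => ex (indep fun i => q i (f i)) φ := by
  induction k with
  | zero => simp
  | succ k ih =>
    simp only [ex_indep_succ, ex_bind, ih (fun i => p i.succ) fun i => q i.succ]
    refine ex_congr _ fun a => ?_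
    rw [ex_comm]
    simp

/-- A single sample out of a family of independent samples can be drawn last. -/
theorem ex_indep_update {k : ℕ} (p : Fin k → PMF α) (i : Fin k) (q : PMF α)
    (φ : (Fin k → α) → ℝ≥0∞) :
    ex (indep (Function.update p i q)) φ =
      ex (indep p) fun f => ex q fun a => φ (Function.update f i a) := by
  induction k with
  | zero => exact i.elim0
  | succ k ih =>
    cases i using Fin.cases with
    | zero =>
      simp only [ex_indep_succ, Function.update_self, Fin.update_cons_zero]
      rw [ex_const]
      rw [ex_comm]
      refine ex_congr _ fun g => ex_congr _ fun a => ?_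
      rfl
    | succ i =>
      have h1 : (fun j : Fin k => Function.update p i.succ q j.succ) =
          Function.update (fun j => p j.succ) i q := by
        ext j : 1
        by_cases h : j = i
        · subst h; simp
        · rw [Function.update_of_ne h, Function.update_of_ne (by simpa using h)]
      simp only [ex_indep_succ, h1, ih, ← Fin.cons_update]
      rw [Function.update_of_ne (Fin.succ_ne_zero i).symm]

theorem ex_indep_apply {k : ℕ} (p : Fin k → PMF α) (i : Fin k) (φ : α → ℝ≥0∞) :
    (ex (indep p) fun f => φ (f i)) = ex (p i) φ := by
  have h := ex_indep_update p i (p i) fun f => φ (f i)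
  rw [Function.update_eq_self] at h
  simpa using h

theorem indep_equiv {k : ℕ} (p : Fin k → PMF α) (e : Fin k ≃ Fin k) (φ : (Fin k → α) → ℝ≥0∞) :
    ex (indep fun i => p (e i)) φ = ex (indep p) fun f => φ fun i => f (e i) := by
  simp only [ex]
  rw [← Equiv.tsum_eq (Equiv.arrowCongr e.symm (Equiv.refl α))]
  refine tsum_congr fun f => ?_
  congr 1
  rw [indep_apply, indep_apply, ← Equiv.prod_comp e (fun i => p i (f i))]
  simp

theorem ex_indep_snoc {k : ℕ} (p : Fin (k + 1) → PMF α) (φ : (Fin (k + 1) → α) → ℝ≥0∞) :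
    ex (indep p) φ = ex (indep fun i => p i.castSucc) fun f => ex (p (Fin.last k)) fun a =>
      φ (Fin.snoc f a) := by
  induction k with
  | zero =>
    simp only [ex_indep_succ, indep_zero, ex_pure]
    refine ex_congr _ fun a => ?_
    congr 1
    ext i
    obtain rfl : i = 0 := Fin.fin_one_eq_zero i
    rfl
  | succ k ih =>
    rw [ex_indep_succ]
    simp only [ih (fun i => p i.succ)]
    rw [ex_indep_succ]
    simp only [Fin.cons_snoc_eq_snoc_cons]
    rfl

theorem unif_pi {k : ℕ} [Fintype α] [Nonempty α] (φ : (Fin k → α) → ℝ≥0∞) :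
    ex (unif (Fin k → α)) φ = ex (indep fun _ : Fin k => unif α) φ := by
  congr 1
  ext f
  simp [indep_apply, ENNReal.inv_pow]

end indep

end PPM

namespace PPM

open Code (code)

/-! ### Polynomial-time functions -/

theorem eval_mono (P : Polynomial ℕ) {a b : ℕ} (h : a ≤ b) : P.eval a ≤ P.eval b := by
  induction P using Polynomial.induction_on with
  | C c => simp
  | add p q hp hq => simpa using add_le_add hp hq
  | monomial n c _ => simpa using Nat.mul_le_mul_left _ (Nat.pow_le_pow_left h _)

theorem Data.size_pos (x : Data) : 1 ≤ x.size := by cases x <;> simp [Data.size]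

/-- Each operation is charged enough to pay for the tree that it produces. Closure of polynomial
time under composition rests on this. -/
theorem Runs.size_le {p : Prog} {x y : Data} {t : ℕ} (h : Runs p x y t) : y.size ≤ t := by
  induction h with
  | id x => exact le_rfl
  | leaf x => exact x.size_pos
  | fst x => cases x <;> simp [Data.fst, Data.size]; omega
  | snd x => cases x <;> simp [Data.snd, Data.size]; omega
  | @pair f g x y z t u _ _ h1 h2 => have := x.size_pos; simp only [Data.size]; omega
  | comp _ _ _ h => omega
  | condLeaf _ _ _ h => omega
  | condNode _ _ _ h => omega
  | loopDone => exact le_rfl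
  | loopStep _ _ _ _ h => omega

/-- Size of the code of an object. -/
def sz {α : Type} [Code α] (a : α) : ℕ := (code a).size

section PolyTime

variable {α β γ δ α' β' : Type} [Code α] [Code β] [Code γ] [Code δ] [Code α'] [Code β']

@[simp] theorem code_pair (a : α) (b : β) : code (a, b) = .node (code a) (code b) := rfl

@[simp] theorem sz_pair (a : α) (b : β) : sz (a, b) = sz a + sz b + 1 := rfl

@[simp] theorem code_nil : code ([] : List α) = .leaf := rfl

@[simp] theorem code_cons (a : α) (l : List α) : code (a :: l) = .node (code a) (code l) := rfl

@[simp] theorem code_true : code true = .node .leaf .leaf := rfl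

@[simp] theorem code_false : code false = .leaf := rfl

attribute [fun_prop] PolyTime

theorem PolyTime.sz_le {f : α → β} (hf : PolyTime f) :
    ∃ P : Polynomial ℕ, ∀ a, sz (f a) ≤ P.eval (sz a) := by
  obtain ⟨p, P, h⟩ := hf
  refine ⟨P, fun a => ?_⟩
  obtain ⟨t, ht, hr⟩ := h a
  exact hr.size_le.trans ht

/-- Polynomial time only depends on the codes of the arguments and of the values. -/
theorem PolyTime.congr_code {f : α → β} (g : α' → β') (e : α → α') (hf : PolyTime g)
    (he : ∀ a, code (e a) = code a) (h : ∀ a, code (f a) = code (g (e a))) : PolyTime f := by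
  obtain ⟨p, P, hp⟩ := hf
  refine ⟨p, P, fun a => ?_⟩
  obtain ⟨t, ht, hr⟩ := hp (e a)
  exact ⟨t, by rwa [he] at ht, by rwa [he, ← h] at hr⟩

@[fun_prop]
theorem PolyTime.id : PolyTime fun a : α => a :=
  ⟨.id, .X, fun a => ⟨_, by simp, .id _⟩⟩

@[fun_prop]
theorem PolyTime.comp {g : β → γ} {f : α → β} (hg : PolyTime g) (hf : PolyTime f) :
    PolyTime fun a => g (f a) := by
  obtain ⟨p, P, hp⟩ := hf
  obtain ⟨q, Q, hq⟩ := hg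
  refine ⟨.comp q p, P + Q.comp P, fun a => ?_⟩
  obtain ⟨t, ht, hr⟩ := hp a
  obtain ⟨u, hu, hs⟩ := hq (f a)
  refine ⟨t + u, ?_, .comp hr hs⟩
  rw [Polynomial.eval_add, Polynomial.eval_comp]
  exact add_le_add ht (hu.trans (eval_mono _ (hr.size_le.trans ht)))

@[fun_prop]
theorem PolyTime.prodMk {f : α → β} {g : α → γ} (hf : PolyTime f) (hg : PolyTime g) :
    PolyTime fun a => (f a, g a) := by
  obtain ⟨p, P, hp⟩ := hf
  obtain ⟨q, Q, hq⟩ := hg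
  refine ⟨.pair p q, P + Q + .X, fun a => ?_⟩
  obtain ⟨t, ht, hr⟩ := hp a
  obtain ⟨u, hu, hs⟩ := hq a
  refine ⟨_, ?_, .pair hr hs⟩
  simp only [Polynomial.eval_add, Polynomial.eval_X]
  omega

theorem polyTime_fst : PolyTime (Prod.fst : α × β → α) :=
  ⟨.fst, .X, fun a => ⟨_, by simp, .fst _⟩⟩

theorem polyTime_snd : PolyTime (Prod.snd : α × β → β) :=
  ⟨.snd, .X, fun a => ⟨_, by simp, .snd _⟩⟩

@[fun_prop]
theorem PolyTime.fst {f : α → β × γ} (hf : PolyTime f) : PolyTime fun a => (f a).1 :=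
  polyTime_fst.comp hf

@[fun_prop]
theorem PolyTime.snd {f : α → β × γ} (hf : PolyTime f) : PolyTime fun a => (f a).2 :=
  polyTime_snd.comp hf

theorem polyTime_dataFst : PolyTime Data.fst := ⟨.fst, .X, fun a => ⟨_, by simp, .fst _⟩⟩

theorem polyTime_dataSnd : PolyTime Data.snd := ⟨.snd, .X, fun a => ⟨_, by simp, .snd _⟩⟩

@[fun_prop]
theorem PolyTime.dataFst {f : α → Data} (hf : PolyTime f) : PolyTime fun a => (f a).fst :=
  polyTime_dataFst.comp hf

@[fun_prop]
theorem PolyTime.dataSnd {f : α → Data} (hf : PolyTime f) : PolyTime fun a => (f a).snd :=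
  polyTime_dataSnd.comp hf

@[fun_prop]
theorem PolyTime.dataNode {f g : α → Data} (hf : PolyTime f) (hg : PolyTime g) :
    PolyTime fun a => Data.node (f a) (g a) :=
  (hf.prodMk hg).congr_code _ (fun a => a) (fun _ => rfl) fun _ => rfl

@[fun_prop]
theorem PolyTime.const (b : β) : PolyTime fun _ : α => b := by
  suffices h : ∀ d : Data, PolyTime fun _ : α => d from
    (h (code b)).congr_code _ (fun a => a) (fun _ => rfl) fun _ => rfl
  intro d
  induction d with
  | leaf => exact ⟨.leaf, .X, fun a => ⟨_, by simp, .leaf _⟩⟩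
  | node a b ha hb => exact ha.dataNode hb

@[fun_prop]
theorem PolyTime.coded {f : α → β} (hf : PolyTime f) : PolyTime fun a => code (f a) :=
  hf.congr_code _ (fun a => a) (fun _ => rfl) fun _ => rfl

/-- An element of a subtype has the code of its underlying object, so a promise on the input can be
put into the domain. Branches of case distinctions and loop invariants are treated in this way. -/
instance {p : α → Prop} : Code (Subtype p) := ⟨fun a => code a.1⟩

@[fun_prop]
theorem PolyTime.subtypeVal {p : β → Prop} {f : α → Subtype p} (hf : PolyTime f) :
    PolyTime fun a => (f a).1 :=
  hf.congr_code _ (fun a => a) (fun _ => rfl) fun _ => rfl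

/-- Case distinction on whether a tree is a leaf. -/
theorem PolyTime.leafCases {c : α → Data} {f : α → β} (hc : PolyTime c)
    (h0 : PolyTime fun a : {a // c a = .leaf} => f a.1)
    (h1 : PolyTime fun a : {a // c a ≠ .leaf} => f a.1) : PolyTime f := by
  obtain ⟨p, P, hp⟩ := h0
  obtain ⟨q, Q, hq⟩ := h1
  obtain ⟨r, R, hr⟩ := hc
  refine ⟨.cond r p q, R + P + Q + .X, fun a => ?_⟩
  obtain ⟨v, hv, h3⟩ := hr a
  rcases h4 : c a with _ | ⟨x, y⟩
  · rw [h4] at h3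
    obtain ⟨t, ht, h1'⟩ := hp ⟨a, h4⟩
    refine ⟨_, ?_, .condLeaf h3 h1'⟩
    have e : (code (⟨a, h4⟩ : {a // c a = .leaf})).size = (code a).size := rfl
    simp only [Polynomial.eval_add, Polynomial.eval_X]
    rw [e] at ht
    omega
  · rw [h4] at h3
    obtain ⟨u, hu, h2⟩ := hq ⟨a, by simp [h4]⟩
    refine ⟨_, ?_, .condNode h3 h2⟩
    have e : (code (⟨a, by simp [h4]⟩ : {a // c a ≠ .leaf})).size = (code a).size := rfl
    simp only [Polynomial.eval_add, Polynomial.eval_X]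
    rw [e] at hu
    omega

theorem PolyTime.ite_bool {c : α → Bool} {f g : α → β} (hc : PolyTime c) (hf : PolyTime f)
    (hg : PolyTime g) : PolyTime fun a => if c a then f a else g a := by
  refine PolyTime.leafCases hc.coded ?_ ?_
  · refine (hg.comp PolyTime.id.subtypeVal).congr_code _ (fun a => a) (fun _ => rfl) ?_
    rintro ⟨a, ha⟩
    cases h : c a
    · simp
    · simp [h] at ha
  · refine (hf.comp PolyTime.id.subtypeVal).congr_code _ (fun a => a) (fun _ => rfl) ?_
    rintro ⟨a, ha⟩
    cases h : c a
    · simp [h] at ha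
    · simp

@[fun_prop]
theorem PolyTime.ite {c : α → Prop} [DecidablePred c] {f g : α → β}
    (hc : PolyTime fun a => decide (c a)) (hf : PolyTime f)
    (hg : PolyTime g) : PolyTime fun a => if c a then f a else g a := by
  simpa using hc.ite_bool hf hg

@[fun_prop]
theorem PolyTime.cons {f : α → β} {g : α → List β} (hf : PolyTime f) (hg : PolyTime g) :
    PolyTime fun a => f a :: g a :=
  (hf.prodMk hg).congr_code _ (fun a => a) (fun _ => rfl) fun _ => rfl

@[fun_prop]
theorem PolyTime.tail {f : α → List β} (hf : PolyTime f) : PolyTime fun a => (f a).tail :=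
  (hf.coded.dataSnd).congr_code _ (fun a => a) (fun _ => rfl) fun a => by cases f a <;> rfl

theorem code_eq_leaf_iff (l : List α) : code l = .leaf ↔ l = [] := by
  cases l <;> simp

/-- On nonempty lists the decomposition into head and tail is the identity on codes, so only the
test for emptiness costs anything. -/
theorem PolyTime.listCases {l : α → List β} {f : α → γ} {g : α × β × List β → γ} {h : α → γ}
    (hl : PolyTime l) (hf : PolyTime f) (hg : PolyTime g)
    (h0 : ∀ a, l a = [] → h a = f a) (h1 : ∀ a b t, l a = b :: t → h a = g (a, b, t)) :
    PolyTime h := by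
  refine PolyTime.leafCases (c := fun a => code (l a)) hl.coded ?_ ?_
  · refine (hf.comp PolyTime.id.subtypeVal).congr_code _ (fun a => a) (fun _ => rfl) ?_
    rintro ⟨a, ha⟩
    rw [h0 a ((code_eq_leaf_iff _).1 ha)]
  · have hne : ∀ a : {a // code (l a) ≠ .leaf}, l a.1 ≠ [] := fun a h =>
      a.2 ((code_eq_leaf_iff _).2 h)
    have h2 : PolyTime fun a : {a // code (l a) ≠ .leaf} =>
        (a.1, (l a.1).head (hne a), (l a.1).tail) := by
      refine (PolyTime.prodMk PolyTime.id.subtypeVal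
        (hl.comp PolyTime.id.subtypeVal)).congr_code _ (fun a => a) (fun _ => rfl) ?_
      intro a
      have := List.cons_head_tail (hne a)
      simp only [code_pair]
      rw [← code_cons, this]
    refine (hg.comp h2).congr_code _ (fun a => a) (fun _ => rfl) fun a => ?_
    rw [h1 a.1 _ _ (List.cons_head_tail (hne a)).symm]

@[fun_prop]
theorem PolyTime.headD {l : α → List β} {d : α → β} (hl : PolyTime l) (hd : PolyTime d) :
    PolyTime fun a => (l a).headD (d a) :=
  hl.listCases hd (g := fun x => x.2.1) (by fun_prop) (fun a h => by simp [h])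
    fun a b t h => by simp [h]

/-- Iteration of a polynomial-time function along a list takes polynomial time if the intermediate
results have polynomial size. -/
theorem PolyTime.foldl_aux {f : α × β × γ → γ} (hf : PolyTime f)
    {p : α → List β → γ → Prop} (hp : ∀ a b l c, p a (b :: l) c → p a l (f (a, b, c)))
    (P : Polynomial ℕ) (B : α × List β × γ → ℕ)
    (hB : ∀ a l c, p a l c → sz c ≤ B (a, l, c))
    (hB' : ∀ a b l c, p a (b :: l) c → B (a, l, f (a, b, c)) ≤ B (a, b :: l, c))
    (hBP : ∀ x, p x.1 x.2.1 x.2.2 → B x ≤ P.eval (sz x)) :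
    PolyTime fun x : {x : α × List β × γ // p x.1 x.2.1 x.2.2} =>
      x.1.2.1.foldl (fun c b => f (x.1.1, b, c)) x.1.2.2 := by
  -- The body of the loop. The remaining list is the left component of the state, so the loop stops
  -- exactly when the list is used up.
  have hg : PolyTime fun x : (β × List β) × α × γ => (x.1.2, x.2.1, f (x.2.1, x.1.1, x.2.2)) :=
    (PolyTime.snd (.fst .id)).prodMk (.prodMk (.fst (.snd .id))
      (hf.comp (.prodMk (.fst (.snd .id)) (.prodMk (.fst (.fst .id)) (.snd (.snd .id))))))
  obtain ⟨q, Q, hq⟩ := hg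
  -- `M` bounds the size of every state that occurs; each of the at most `l.length + 1` passes then
  -- costs at most `Q.eval M + M`.
  have key : ∀ (l : List β) (a : α) (c : γ) (M : ℕ), p a l c → sz a + B (a, l, c) + sz l + 2 ≤ M →
      ∃ t, t ≤ (l.length + 1) * (Q.eval M + M) ∧
      Runs (.loop q) (code (l, a, c)) (code (([] : List β), a, l.foldl (fun c b => f (a, b, c)) c)) t := by
    intro l
    induction l with
    | nil =>
      intro a c M h hM
      refine ⟨_, ?_, .loopDone rfl⟩
      have := hB a _ c h
      simp only [code_pair, Data.size, code_nil]
      simp only [sz, code_nil, Data.size] at *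
      simp only [List.length_nil, zero_add, one_mul]
      omega
    | cons b l ih =>
      intro a c M h hM
      obtain ⟨t, ht, hr⟩ := hq ((b, l), a, c)
      have h1 := hB' a b l c h
      have h3 : sz l ≤ sz (b :: l) := by
        simp only [sz, code_cons, Data.size]; omega
      obtain ⟨u, hu, hs⟩ := ih a (f (a, b, c)) M (hp a b l c h) (by omega)
      have h5 := hB a _ c h
      refine ⟨t + u + (code (b :: l, a, c)).size, ?_, .loopStep (by simp [Data.fst]) hr hs⟩
      have h6 : (code (b :: l, a, c)).size ≤ M := by
        simp only [sz, code_pair, Data.size] at *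
        omega
      have h7 : (code ((b, l), a, c)).size = (code (b :: l, a, c)).size := rfl
      have h8 := eval_mono Q h6
      rw [h7] at ht
      simp only [List.length_cons]
      have : (l.length + 1 + 1) * (Q.eval M + M) =
        (l.length + 1) * (Q.eval M + M) + (Q.eval M + M) := by ring
      omega
  have hl : PolyTime fun x : {x : α × List β × γ // p x.1 x.2.1 x.2.2} =>
      (([] : List β), x.1.1, x.1.2.1.foldl (fun c b => f (x.1.1, b, c)) x.1.2.2) := by
    have h1 : PolyTime fun x : {x : α × List β × γ // p x.1 x.2.1 x.2.2} =>
        (x.1.2.1, x.1.1, x.1.2.2) := by fun_prop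
    obtain ⟨r, R, hr⟩ := h1
    refine ⟨.comp (.loop q) r, R + .X * (Q.comp (.X * 2 + P + 2) + (.X * 2 + P + 2)), ?_⟩
    rintro ⟨x, hx⟩
    obtain ⟨t, ht, hr⟩ := hr ⟨x, hx⟩
    have hlen : x.2.1.length + 1 ≤ sz x := by
      obtain ⟨a, l, c⟩ := x
      have : ∀ l : List β, l.length + 1 ≤ sz l := by
        intro l
        induction l with
        | nil => simp [sz, Data.size]
        | cons b l ih => simp only [sz, code_cons, Data.size, List.length_cons] at *; omega
      have := this l
      simp only [sz_pair]
      omega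
    obtain ⟨u, hu, hs⟩ := key x.2.1 x.1 x.2.2 (sz x * 2 + P.eval (sz x) + 2) hx (by
      have := hBP x hx
      obtain ⟨a, l, c⟩ := x
      simp only [sz_pair] at *
      omega)
    refine ⟨t + u, ?_, .comp hr hs⟩
    have e : (code (⟨x, hx⟩ : {x : α × List β × γ // p x.1 x.2.1 x.2.2})).size = sz x := rfl
    rw [e] at ht ⊢
    simp only [Polynomial.eval_add, Polynomial.eval_mul, Polynomial.eval_comp, Polynomial.eval_X,
      Polynomial.eval_ofNat]
    refine add_le_add ht (hu.trans ?_)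
    exact Nat.mul_le_mul_right _ hlen
  exact (hl.snd).snd

/-- The size bound is needed only along the actual run. The invariant states that the current value
is the fold of a prefix of the list. -/
theorem PolyTime.foldl {l : α → List β} {c : α → γ} {f : α → γ → β → γ} (hl : PolyTime l)
    (hc : PolyTime c) (hf : PolyTime fun x : α × γ × β => f x.1 x.2.1 x.2.2) (P : Polynomial ℕ)
    (hP : ∀ a l', l' <+: l a → sz (l'.foldl (f a) (c a)) ≤ P.eval (sz a)) :
    PolyTime fun a => (l a).foldl (f a) (c a) := by
  have h := PolyTime.foldl_aux (α := α) (f := fun x : α × β × γ => f x.1 x.2.2 x.2.1)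
    (p := fun a m d => ∃ pre, pre ++ m = l a ∧ d = pre.foldl (f a) (c a))
    (hf.comp (f := fun x : α × β × γ => (x.1, x.2.2, x.2.1)) (by fun_prop)) ?_ P
    (fun x => P.eval (sz x.1)) ?_ (fun _ _ _ _ _ => le_rfl) ?_
  · have h2 : PolyTime fun a => (⟨(a, l a, c a), [], rfl, rfl⟩ : {x : α × List β × γ //
        ∃ pre, pre ++ x.2.1 = l x.1 ∧ x.2.2 = pre.foldl (f x.1) (c x.1)}) :=
      (PolyTime.id.prodMk (hl.prodMk hc)).congr_code _ (fun a => a) (fun _ => rfl) fun _ => rfl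
    exact h.comp h2
  · rintro a b m d ⟨pre, h1, rfl⟩
    exact ⟨pre ++ [b], by simpa using h1, by simp⟩
  · rintro a m d ⟨pre, h1, rfl⟩
    exact hP a pre ⟨m, h1⟩
  · rintro ⟨a, m, d⟩ -
    exact eval_mono _ (by simp only [sz_pair]; omega)

theorem length_lt_sz (l : List α) : l.length < sz l := by
  induction l with
  | nil => simp [sz, Data.size]
  | cons b l ih => simp only [sz, code_cons, Data.size, List.length_cons] at *; omega

@[simp] theorem sz_nil : sz ([] : List α) = 1 := rfl

@[simp] theorem sz_cons (a : α) (l : List α) : sz (a :: l) = sz a + sz l + 1 := rfl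

theorem sz_le_of_mem {a : α} {l : List α} (h : a ∈ l) : sz a < sz l := by
  induction l with
  | nil => simp at h
  | cons b l ih =>
    rcases List.mem_cons.1 h with rfl | h
    · simp only [sz_cons]; omega
    · have := ih h
      simp only [sz_cons]; omega

/-- Iteration along a list of a function that adds at most polynomially many vertices. -/
theorem PolyTime.foldl_add {l : α → List β} {c : α → γ} {f : α → γ → β → γ} (hl : PolyTime l)
    (hc : PolyTime c) (hf : PolyTime fun x : α × γ × β => f x.1 x.2.1 x.2.2) (P : Polynomial ℕ)
    (hP : ∀ a d, ∀ b ∈ l a, sz (f a d b) ≤ sz d + P.eval (sz a)) :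
    PolyTime fun a => (l a).foldl (f a) (c a) := by
  obtain ⟨Q, hQ⟩ := hl.sz_le
  obtain ⟨R, hR⟩ := hc.sz_le
  refine hl.foldl hc hf (R + Q * P) fun a l' h' => ?_
  have key : ∀ (l' : List β) (d : γ), (∀ b ∈ l', b ∈ l a) →
      sz (l'.foldl (f a) d) ≤ sz d + l'.length * P.eval (sz a) := by
    intro l'
    induction l' with
    | nil => simp
    | cons b l' ih =>
      intro d h
      have h1 := ih (f a d b) fun b' hb' => h b' (by simp [hb'])
      have h2 := hP a d b (h b (by simp))
      simp only [List.foldl_cons, List.length_cons, add_mul, one_mul]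
      omega
  refine (key l' (c a) fun b hb => h'.subset hb).trans ?_
  rw [Polynomial.eval_add, Polynomial.eval_mul]
  gcongr
  · exact hR a
  · exact h'.length_le.trans ((length_lt_sz _).le.trans (hQ a))

@[fun_prop]
theorem PolyTime.reverse {l : α → List β} (hl : PolyTime l) : PolyTime fun a => (l a).reverse := by
  obtain ⟨Q, hQ⟩ := hl.sz_le
  have := hl.foldl_add (c := fun _ => ([] : List β)) (f := fun _ d b => b :: d) (by fun_prop)
    (by fun_prop) Q fun a d b hb => by
      have := (sz_le_of_mem hb).trans_le (hQ a)
      simp only [sz_cons]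
      omega
  simpa using this

@[fun_prop]
theorem PolyTime.append {l m : α → List β} (hl : PolyTime l) (hm : PolyTime m) :
    PolyTime fun a => l a ++ m a := by
  obtain ⟨Q, hQ⟩ := hl.reverse.sz_le
  have := hl.reverse.foldl_add hm (f := fun _ d b => b :: d) (by fun_prop) Q fun a d b hb => by
      have := (sz_le_of_mem hb).trans_le (hQ a)
      simp only [sz_cons]
      omega
  simpa using this

@[fun_prop]
theorem PolyTime.map {l : α → List β} {f : α → β → γ} (hl : PolyTime l)
    (hf : PolyTime fun x : α × β => f x.1 x.2) : PolyTime fun a => (l a).map (f a) := by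
  obtain ⟨Q, hQ⟩ := hl.sz_le
  obtain ⟨R, hR⟩ := hf.sz_le
  have h := hl.foldl_add (c := fun _ => ([] : List γ)) (f := fun a d b => f a b :: d) (by fun_prop)
    (.cons (hf.comp (f := fun x : α × List γ × β => (x.1, x.2.2)) (by fun_prop)) (by fun_prop))
    (R.comp (.X + Q + 1) + 1) fun a d b hb => by
      have h1 := (sz_le_of_mem hb).trans_le (hQ a)
      have h2 := (hR (a, b)).trans (eval_mono R (b := sz a + Q.eval (sz a) + 1) (by
        simp only [sz_pair]; omega))
      simp only [sz_cons, Polynomial.eval_add, Polynomial.eval_comp, Polynomial.eval_X,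
        Polynomial.eval_one]
      dsimp only at h2
      omega
  have h2 : ∀ a, (l a).foldl (fun d b => f a b :: d) [] = ((l a).map (f a)).reverse := by
    intro a
    rw [← List.foldl_map (g := fun d b => b :: d) ]
    simp
  simp only [h2] at h
  simpa using h.reverse

@[simp] theorem code_replicate_unit (n : ℕ) : code (List.replicate n ()) = code n := by
  induction n with
  | zero => rfl
  | succ n ih => rw [List.replicate_succ, code_cons, ih]; rfl

@[simp] theorem sz_nat (n : ℕ) : sz n = 2 * n + 1 := by
  induction n with
  | zero => rfl
  | succ n ih =>
    have : sz (n + 1) = 1 + sz n + 1 := rfl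
    omega

/-- A natural number as a list of units. -/
theorem PolyTime.replicate_unit {f : α → ℕ} :
    (PolyTime fun a => List.replicate (f a) ()) ↔ PolyTime f :=
  ⟨fun h => h.congr_code _ (fun a => a) (fun _ => rfl) fun _ => (code_replicate_unit _).symm,
    fun h => h.congr_code _ (fun a => a) (fun _ => rfl) fun _ => code_replicate_unit _⟩

@[fun_prop]
theorem PolyTime.length {l : α → List β} (hl : PolyTime l) : PolyTime fun a => (l a).length := by
  rw [← PolyTime.replicate_unit]
  simpa using hl.map (f := fun _ _ => ()) (by fun_prop)

@[fun_prop]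
theorem PolyTime.natAdd {f g : α → ℕ} (hf : PolyTime f) (hg : PolyTime g) :
    PolyTime fun a => f a + g a := by
  rw [← PolyTime.replicate_unit] at *
  simpa [List.replicate_append_replicate] using hf.append hg

@[fun_prop]
theorem PolyTime.natMul {f g : α → ℕ} (hf : PolyTime f) (hg : PolyTime g) :
    PolyTime fun a => f a * g a := by
  obtain ⟨Q, hQ⟩ := hg.sz_le
  have h := (PolyTime.replicate_unit.2 hf).foldl_add (c := fun _ => 0) (f := fun a d (_ : Unit) => d + g a)
    (by fun_prop)
    (.natAdd (by fun_prop) (hg.comp (f := fun x : α × ℕ × Unit => x.1) (by fun_prop))) Q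
    fun a d b hb => by
      have := hQ a
      simp only [sz_nat] at *
      omega
  have h2 : ∀ a, (List.replicate (f a) ()).foldl (fun d _ => d + g a) 0 = f a * g a := by
    intro a
    induction f a with
    | zero => simp
    | succ n ih => rw [List.replicate_succ', List.foldl_append, ih, add_mul]; simp
  simpa [h2] using h

@[fun_prop]
theorem PolyTime.drop {l : α → List β} {f : α → ℕ} (hf : PolyTime f) (hl : PolyTime l) :
    PolyTime fun a => (l a).drop (f a) := by
  have h := (PolyTime.replicate_unit.2 hf).foldl_add hl (f := fun _ d (_ : Unit) => d.tail)
    (by fun_prop) 0 fun a d b hb => by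
      cases d
      · simp
      · simp only [List.tail_cons, sz_cons]; omega
  have h2 : ∀ a, (List.replicate (f a) ()).foldl (fun d _ => d.tail) (l a) = (l a).drop (f a) := by
    intro a
    induction f a with
    | zero => simp
    | succ n ih => rw [List.replicate_succ', List.foldl_append, ih]; simp
  simpa [h2] using h

@[fun_prop]
theorem PolyTime.natSub {f g : α → ℕ} (hf : PolyTime f) (hg : PolyTime g) :
    PolyTime fun a => f a - g a := by
  rw [← PolyTime.replicate_unit] at hf ⊢
  simpa using hg.drop hf

@[fun_prop]
theorem PolyTime.take {l : α → List β} {f : α → ℕ} (hf : PolyTime f) (hl : PolyTime l) :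
    PolyTime fun a => (l a).take (f a) := by
  have h : PolyTime fun a => ((l a).reverse.drop ((l a).length - f a)).reverse := by fun_prop
  refine h.congr_code _ (fun a => a) (fun _ => rfl) fun a => ?_
  rw [List.reverse_drop]
  simp only [List.reverse_reverse, List.length_reverse]
  congr 1
  rcases le_total (f a) (l a).length with h | h
  · rw [Nat.sub_sub_self h]
  · simp [Nat.sub_eq_zero_of_le h, List.take_of_length_le h]

@[fun_prop]
theorem PolyTime.getD {l : α → List β} {f : α → ℕ} {d : α → β} (hf : PolyTime f) (hl : PolyTime l)
    (hd : PolyTime d) : PolyTime fun a => (l a).getD (f a) (d a) := by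
  have h : PolyTime fun a => ((l a).drop (f a)).headD (d a) := by fun_prop
  simpa [List.headD_eq_head?_getD] using h

@[fun_prop]
theorem PolyTime.natEqZero {f : α → ℕ} (hf : PolyTime f) : PolyTime fun a => decide (f a = 0) := by
  refine (PolyTime.replicate_unit.2 hf).listCases (f := fun _ => true) (g := fun _ => false)
    (.const _) (.const _) ?_ ?_
  · intro a h; simpa using h
  · intro a b t h
    have := congrArg List.length h
    simp only [List.length_replicate, List.length_cons] at this
    simp [this]

@[fun_prop]
theorem PolyTime.natLe {f g : α → ℕ} (hf : PolyTime f) (hg : PolyTime g) :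
    PolyTime fun a => decide (f a ≤ g a) := by
  simpa [Nat.sub_eq_zero_iff_le] using (hf.natSub hg).natEqZero

@[fun_prop]
theorem PolyTime.natEq {f g : α → ℕ} (hf : PolyTime f) (hg : PolyTime g) :
    PolyTime fun a => decide (f a = g a) := by
  have h : PolyTime fun a => decide ((f a - g a) + (g a - f a) = 0) := by fun_prop
  refine h.congr_code _ (fun a => a) (fun _ => rfl) fun a => ?_
  congr 2
  simp only [eq_iff_iff]
  omega

@[fun_prop]
theorem PolyTime.eqTrue {f : α → Bool} (hf : PolyTime f) : PolyTime fun a => decide (f a = true) := by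
  simpa using hf

@[fun_prop]
theorem PolyTime.natMin {f g : α → ℕ} (hf : PolyTime f) (hg : PolyTime g) :
    PolyTime fun a => min (f a) (g a) := by
  have h : PolyTime fun a => if f a ≤ g a then f a else g a := by fun_prop
  simpa [min_def] using h

@[fun_prop]
theorem PolyTime.polynomialEval {f : α → ℕ} (hf : PolyTime f) (P : Polynomial ℕ) :
    PolyTime fun a => P.eval (f a) := by
  induction P using Polynomial.induction_on with
  | C c => simpa using PolyTime.const c
  | add p q hp hq => simpa using hp.natAdd hq
  | monomial n c h =>
    have := h.natMul hf
    simp only [Polynomial.eval_mul, Polynomial.eval_C, Polynomial.eval_pow, Polynomial.eval_X,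
      pow_succ, ← mul_assoc] at *
    exact this

theorem PolyTime.isSome {f : α → Option β} (hf : PolyTime f) : PolyTime fun a => (f a).isSome := by
  refine PolyTime.leafCases hf.coded ?_ ?_
  · refine (PolyTime.const false).congr_code _ (fun a => a) (fun _ => rfl) ?_
    rintro ⟨a, ha⟩
    cases h : f a
    · simp
    · rw [h] at ha; cases ha
  · refine (PolyTime.const true).congr_code _ (fun a => a) (fun _ => rfl) ?_
    rintro ⟨a, ha⟩
    cases h : f a
    · rw [h] at ha; exact absurd rfl ha
    · simp

@[simp] theorem code_pi {k : ℕ} (f : Fin k → α) : code f = code (List.ofFn f) := rfl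

@[simp] theorem code_bool_fun (f : Bool → α) : code f = code (f false, f true) := rfl

@[simp] theorem code_vector {k : ℕ} (v : List.Vector α k) : code v = code v.toList := rfl

theorem PolyTime.ofFn {k : ℕ} {f : Fin k → α → β} (hf : ∀ i, PolyTime (f i)) :
    PolyTime fun a => List.ofFn fun i => f i a := by
  induction k with
  | zero => simpa using PolyTime.const _
  | succ k ih =>
    simp only [List.ofFn_succ]
    exact (hf 0).cons (ih fun i => hf i.succ)

@[fun_prop]
theorem PolyTime.pi {k : ℕ} {f : α → Fin k → β} (hf : ∀ i, PolyTime fun a => f a i) :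
    PolyTime fun a i => f a i :=
  (PolyTime.ofFn hf).congr_code _ (fun a => a) (fun _ => rfl) fun _ => rfl

@[fun_prop]
theorem PolyTime.boolPi {f : α → Bool → β} (hf : ∀ i, PolyTime fun a => f a i) :
    PolyTime fun a i => f a i :=
  ((hf false).prodMk (hf true)).congr_code _ (fun a => a) (fun _ => rfl) fun _ => rfl

@[fun_prop]
theorem PolyTime.listOfFn {k : ℕ} {f : α → Fin k → β} (hf : PolyTime f) :
    PolyTime fun a => List.ofFn (f a) :=
  hf.congr_code _ (fun a => a) (fun _ => rfl) fun _ => rfl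

theorem PolyTime.boolApply {f : α → Bool → β} (hf : PolyTime f) (i : Bool) :
    PolyTime fun a => f a i := by
  have h : PolyTime fun a => (f a false, f a true) :=
    hf.congr_code _ (fun a => a) (fun _ => rfl) fun _ => rfl
  cases i
  · exact h.fst
  · exact h.snd

theorem PolyTime.apply {k : ℕ} {f : α → Fin k → β} (hf : PolyTime f) (i : Fin k) :
    PolyTime fun a => f a i := by
  have h : PolyTime fun a => List.ofFn (f a) :=
    hf.congr_code _ (fun a => a) (fun _ => rfl) fun _ => rfl
  induction k with
  | zero => exact i.elim0
  | succ k ih =>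
    -- `headD` needs a default value, which is taken from the value of `f` at some input; if there
    -- is no input, any program serves.
    by_cases hne : Nonempty α
    · obtain ⟨a0⟩ := hne
      have := h.headD (.const (f a0 0))
      have h2 := h.tail
      simp only [List.ofFn_succ, List.headD_cons, List.tail_cons] at this h2
      cases i using Fin.cases with
      | zero => exact this
      | succ i =>
        exact ih (f := fun a i => f a i.succ)
          (h2.congr_code _ (fun a => a) (fun _ => rfl) fun _ => rfl) i h2
    · exact (PolyTime.const (α := α) Data.leaf).congr_code _ (fun a => a) (fun _ => rfl)
        fun a => (hne ⟨a⟩).elim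

@[fun_prop]
theorem polyTime_boolApply (i : Bool) : PolyTime fun f : Bool → β => f i :=
  PolyTime.boolApply (f := fun f => f) .id i

@[fun_prop]
theorem polyTime_apply {k : ℕ} (i : Fin k) : PolyTime fun f : Fin k → β => f i :=
  PolyTime.apply (f := fun f => f) .id i

end PolyTime

end PPM

namespace PPM

open Code (code)
open scoped ENNReal

/-! ### Decoding -/

/-- The list of subtrees along the right spine of a tree. -/
def Data.spine : Data → List Data
  | .leaf => []
  | .node a b => a :: b.spine

@[simp] theorem code_spine (d : Data) : code d.spine = d := by
  induction d with
  | leaf => rfl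
  | node a b _ ih => rw [Data.spine, code_cons, ih]; rfl

@[simp] theorem spine_code (l : List Data) : (code l).spine = l := by
  induction l with
  | nil => rfl
  | cons a l ih => rw [code_cons, Data.spine, ih]; rfl

@[fun_prop]
theorem PolyTime.spine {α : Type} [Code α] {f : α → Data} (hf : PolyTime f) :
    PolyTime fun a => (f a).spine :=
  hf.congr_code _ (fun a => a) (fun _ => rfl) fun _ => code_spine _

/-- Encodings with a polynomial-time decoder. -/
class Decode (α : Type) extends Code α where
  decode : Data → α
  decode_code : ∀ a, decode (code a) = a
  polyTime : PolyTime decode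

open Decode (decode decode_code)

@[fun_prop]
theorem PolyTime.decode {α β : Type} [Code α] [Decode β] {f : α → Data} (hf : PolyTime f) :
    PolyTime fun a => (decode (f a) : β) :=
  Decode.polyTime.comp hf

instance : Decode Data := ⟨fun d => d, fun _ => rfl, .id⟩

instance : Decode Bool :=
  ⟨fun d => !decide (d.spine.length = 0), fun b => by cases b <;> rfl,
    .congr_code (fun d : Data => if d.spine.length = 0 then false else true) (fun d => d)
      (by fun_prop) (fun _ => rfl) fun d => by split_ifs with h <;> simp [h]⟩

instance : Decode ℕ :=
  ⟨fun d => d.spine.length, fun n => by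
    rw [← code_replicate_unit]
    induction n with
    | zero => rfl
    | succ n ih => rw [List.replicate_succ, code_cons, Data.spine, List.length_cons, ih],
    by fun_prop⟩

instance {α β : Type} [Decode α] [Decode β] : Decode (α × β) :=
  ⟨fun d => (decode d.fst, decode d.snd), by
    rintro ⟨a, b⟩
    simp only [code_pair, Data.fst, Data.snd, decode_code],
    by fun_prop⟩

theorem code_map_code {α : Type} [Code α] (l : List α) : code (l.map code) = code l := by
  induction l with
  | nil => rfl
  | cons a l ih => rw [List.map_cons, code_cons, ih]; rfl

instance {α : Type} [Decode α] : Decode (List α) :=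
  ⟨fun d => d.spine.map decode, fun l => by
    rw [← code_map_code, spine_code]
    simp [Function.comp_def, decode_code], by fun_prop⟩

/-- Entry `i` on the right spine of a tree. -/
def Data.nth (d : Data) : ℕ → Data
  | 0 => d.fst
  | i + 1 => d.snd.nth i

theorem nth_code {α : Type} [Code α] {k : ℕ} (f : Fin k → α) (i : Fin k) :
    (code f).nth i = code (f i) := by
  induction k with
  | zero => exact i.elim0
  | succ k ih =>
    rw [code_pi, List.ofFn_succ, code_cons]
    cases i using Fin.cases with
    | zero => rfl
    | succ i => exact ih (fun i => f i.succ) i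

@[fun_prop]
theorem PolyTime.nth {α : Type} [Code α] {f : α → Data} (hf : PolyTime f) (i : ℕ) :
    PolyTime fun a => (f a).nth i := by
  induction i generalizing f with
  | zero => exact hf.dataFst
  | succ i ih => exact ih hf.dataSnd

instance {α : Type} [Decode α] {k : ℕ} : Decode (Fin k → α) :=
  ⟨fun d i => decode (d.nth i), fun f => by
    ext i
    rw [nth_code, decode_code], by fun_prop⟩

/-! ### Random bit strings -/

/-- A uniformly random bit string, as a list. -/
noncomputable def lbits (k : ℕ) : PMF (List Bool) := (bits k).map List.Vector.toList

theorem ex_lbits (k : ℕ) (f : List Bool → ℝ≥0∞) :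
    ex (lbits k) f = ex (bits k) fun r => f r.toList := by
  rw [lbits, ex_map]

theorem lbits_zero (f : List Bool → ℝ≥0∞) : ex (lbits 0) f = f [] := by
  rw [ex_lbits, bits]
  exact (ex_congr _ fun r => by rw [Subsingleton.elim r List.Vector.nil]; rfl).trans (ex_const _ _)

/-- Splitting off the first entry of a vector. -/
def vectorConsEquiv (α : Type) (k : ℕ) : α × List.Vector α k ≃ List.Vector α (k + 1) where
  toFun x := x.1 ::ᵥ x.2
  invFun v := (v.head, v.tail)
  left_inv x := by simp
  right_inv v := by simp

theorem lbits_succ (k : ℕ) (f : List Bool → ℝ≥0∞) :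
    ex (lbits (k + 1)) f = ex (unif Bool) fun b => ex (lbits k) fun l => f (b :: l) := by
  rw [ex_lbits]
  simp only [ex_lbits]
  rw [bits, ex_unif_equiv (vectorConsEquiv Bool k), ex_unif_prod]
  simp [vectorConsEquiv, bits]

theorem lbits_add (j k : ℕ) (f : List Bool → ℝ≥0∞) :
    ex (lbits (j + k)) f = ex (lbits j) fun l => ex (lbits k) fun m => f (l ++ m) := by
  induction j generalizing f with
  | zero => simp [lbits_zero]
  | succ j ih => rw [Nat.succ_add, lbits_succ, lbits_succ]; simp [ih]

theorem length_of_mem_lbits {k : ℕ} {l : List Bool} (h : l ∈ (lbits k).support) : l.length = k := by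
  rw [lbits, PMF.mem_support_map_iff] at h
  obtain ⟨r, -, rfl⟩ := h
  simp

/-- A machine may be given more coins than it uses. This is needed where the number of coins depends
on the length of a message. -/
theorem lbits_take {j k : ℕ} (h : j ≤ k) (f : List Bool → ℝ≥0∞) :
    (ex (lbits k) fun l => f (l.take j)) = ex (lbits j) f := by
  obtain ⟨i, rfl⟩ := Nat.exists_eq_add_of_le h
  rw [lbits_add]
  refine ex_congr_support _ fun l hl => ?_
  rw [← ex_const (lbits i) (f l)]
  refine ex_congr _ fun m => ?_
  rw [← length_of_mem_lbits hl, List.take_left]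

theorem sz_drop_le {α : Type} [Code α] (i : ℕ) (l : List α) : sz (l.drop i) ≤ sz l := by
  induction l generalizing i with
  | nil => simp
  | cons a l ih =>
    cases i with
    | zero => simp
    | succ i => have := ih i; simp only [List.drop_succ_cons, sz_cons]; omega

theorem sz_take_le {α : Type} [Code α] (i : ℕ) (l : List α) : sz (l.take i) ≤ sz l := by
  induction l generalizing i with
  | nil => simp
  | cons a l ih =>
    cases i with
    | zero => simp
    | succ i => have := ih i; simp only [List.take_succ_cons, sz_cons]; omega

/-! ### Statistical distance and efficient sampling -/

section samp

variable {α β γ δ : Type}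

/-- The statistical distance of two distributions is at most `ε`. -/
def SDist (ε : ℝ≥0∞) (p q : PMF α) : Prop :=
  ∀ φ : α → ℝ≥0∞, (∀ a, φ a ≤ 1) → Close ε (ex p φ) (ex q φ)

theorem SDist.of_ex_eq {ε : ℝ≥0∞} {p q : PMF α} (h : ∀ f, ex p f = ex q f) : SDist ε p q :=
  fun _ _ => Close.of_eq (h _)

variable [Code α] [Code β] [Code γ] [Code δ]

/-- `X n a` can be sampled, up to a negligible statistical error that is uniform over the inputs in
`G n`, in polynomial time with a polynomial number of coins. -/
def Samp (G : ℕ → α → Prop) (X : ℕ → α → PMF β) : Prop :=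
  ∃ (f : ℕ × α × List Bool → β) (c : Polynomial ℕ) (ε : ℕ → ℝ≥0∞), PolyTime f ∧ ENegl ε ∧
    ∀ n a, G n a → SDist (ε n) ((lbits (c.eval n)).map fun r => f (n, a, r)) (X n a)

variable {G : ℕ → α → Prop}

theorem Samp.pure {f : ℕ × α → β} (hf : PolyTime f) : Samp G fun n a => PMF.pure (f (n, a)) :=
  ⟨fun x => f (x.1, x.2.1), 0, _, by fun_prop, ENegl.zero, fun n a _ =>
    SDist.of_ex_eq fun φ => by simp⟩

theorem Samp.lbits (c : Polynomial ℕ) : Samp G fun n _ => PPM.lbits (c.eval n) :=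
  ⟨fun x => x.2.2, c, _, by fun_prop, ENegl.zero, fun n a _ =>
    SDist.of_ex_eq fun φ => by simp⟩

theorem Samp.congr {X Y : ℕ → α → PMF β} (h : Samp G X)
    (hXY : ∀ n a, G n a → ∀ f, ex (Y n a) f = ex (X n a) f) : Samp G Y := by
  obtain ⟨f, c, ε, hf, hε, h⟩ := h
  exact ⟨f, c, ε, hf, hε, fun n a ha => by rw [pmf_ext_ex (hXY n a ha)]; exact h n a ha⟩

theorem Samp.comp {G' : ℕ → γ → Prop} {X : ℕ → α → PMF β} (h : Samp G X) {g : ℕ × γ → α}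
    (hg : PolyTime g) (hG : ∀ n c, G' n c → G n (g (n, c))) :
    Samp G' fun n c => X n (g (n, c)) := by
  obtain ⟨f, c, ε, hf, hε, h⟩ := h
  exact ⟨fun x => f (x.1, g (x.1, x.2.1), x.2.2), c, ε, by fun_prop, hε,
    fun n a ha => h n _ (hG n a ha)⟩

/-- The first `c.eval n` coins serve `X`, the others `Y`. The errors add up because the expectation
of a test over the second stage is again a test with values at most one. -/
theorem Samp.bind {G' : ℕ → α × β → Prop} {X : ℕ → α → PMF β} {Y : ℕ → α × β → PMF γ}
    (hX : Samp G X) (hY : Samp G' Y) (hG : ∀ n a, G n a → ∀ b ∈ (X n a).support, G' n (a, b)) :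
    Samp G fun n a => (X n a).bind fun b => Y n (a, b) := by
  obtain ⟨f, c, ε, hf, hε, h⟩ := hX
  obtain ⟨g, d, ε', hg, hε', h'⟩ := hY
  refine ⟨fun x => g (x.1, (x.2.1, f (x.1, x.2.1, x.2.2.take (c.eval x.1))),
    x.2.2.drop (c.eval x.1)), c + d, fun n => ε n + ε' n, by fun_prop, hε.add hε',
    fun n a ha φ hφ => ?_⟩
  have h1 := h n a ha (fun b => ex ((PPM.lbits (d.eval n)).map fun r => g (n, (a, b), r)) φ)
    fun b => ex_le_one _ hφ
  have h2 : Close (ε' n)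
      (ex (X n a) fun b => ex ((PPM.lbits (d.eval n)).map fun r => g (n, (a, b), r)) φ)
      (ex (X n a) fun b => ex (Y n (a, b)) φ) :=
    Close.ex _ fun b hb => h' n _ (hG n a ha b hb) φ hφ
  rw [ex_bind]
  refine Close.trans ?_ h2
  convert h1 using 1
  rw [ex_map, ex_map, Polynomial.eval_add, lbits_add]
  refine ex_congr_support _ fun l hl => ?_
  rw [ex_map]
  refine ex_congr _ fun m => ?_
  simp only [← length_of_mem_lbits hl, List.take_left, List.drop_left]

theorem Samp.map {X : ℕ → α → PMF β} (hX : Samp G X) {f : ℕ × α × β → γ} (hf : PolyTime f) :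
    Samp G fun n a => (X n a).map fun b => f (n, a, b) := by
  have h : Samp (fun _ _ => True) fun n (x : α × β) => PMF.pure (f (n, x.1, x.2)) :=
    Samp.pure (f := fun y : ℕ × α × β => f (y.1, y.2.1, y.2.2)) (by fun_prop)
  exact (hX.bind h fun _ _ _ _ _ => trivial).congr fun n a _ φ => by simp [ex_bind]

theorem Samp.indep {k : ℕ} {X : Fin k → ℕ → α → PMF β} (hX : ∀ i, Samp G (X i)) :
    Samp G fun n a => PPM.indep fun i => X i n a := by
  induction k with
  | zero =>
    exact (Samp.pure (f := fun _ => Fin.elim0) (.const _)).congr fun n a _ φ => by simp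
  | succ k ih =>
    have h1 := ih fun i => hX i.succ
    have h2 : Samp (fun n (x : α × β) => G n x.1) fun n x => PPM.indep fun i => X i.succ n x.1 :=
      h1.comp (g := fun y : ℕ × α × β => y.2.1) (by fun_prop) fun _ _ h => h
    have h3 := (hX 0).bind (h2.map (f := fun y : ℕ × (α × β) × (Fin k → β) =>
      (Fin.cons y.2.1.2 y.2.2 : Fin (k + 1) → β)) (by
        refine PolyTime.pi fun i => ?_
        cases i using Fin.cases <;> simp only [Fin.cons_zero, Fin.cons_succ] <;> fun_prop))
      fun n a h b _ => h
    exact h3.congr fun n a _ φ => by simp [ex_bind, ex_indep_succ]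

theorem Samp.dist (A : PPT α β) : Samp G A.dist :=
  ⟨A.run, A.coins, _, A.polyTime, ENegl.zero, fun n a _ => SDist.of_ex_eq fun φ => by
    simp [PPT.dist, ex_lbits]⟩

/-- Repetition of a randomized step along a list. The state for the next step is computed from the
output of the step. -/
noncomputable def loopDist (X : α × γ × δ → PMF β) (g : β → γ) (e : α) : γ → List δ → PMF (List β)
  | _, [] => PMF.pure []
  | st, x :: l => (X (e, st, x)).bind fun o => (loopDist X g e (g o) l).map fun z => o :: z

/-- The bound on the next state is required for every output `o`, even outside the support of the
step: the underlying program must have polynomial size for all coin sequences. The statistical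
errors of at most `L.eval n` steps add up. -/
theorem Samp.loop {G : ℕ → α × γ × δ → Prop} {X : ℕ → α × γ × δ → PMF β} (hX : Samp G X)
    {g : ℕ × β → γ} (hg : PolyTime g) (B L : Polynomial ℕ) (hB : ∀ n o, sz (g (n, o)) ≤ B.eval n)
    (hG : ∀ n e st x, G n (e, st, x) → ∀ o ∈ (X n (e, st, x)).support, ∀ x',
      G n (e, st, x') → G n (e, g (n, o), x')) :
    Samp (fun n (y : α × γ × List δ) => (∀ x ∈ y.2.2, G n (y.1, y.2.1, x)) ∧
      y.2.2.length ≤ L.eval n)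
      fun n y => loopDist (X n) (fun o => g (n, o)) y.1 y.2.1 y.2.2 := by
  obtain ⟨f, c, ε, hf, hε, h⟩ := hX
  let step : ℕ × α → (γ × List Bool × List β) → δ → γ × List Bool × List β := fun a s x =>
    (g (a.1, f (a.1, (a.2, s.1, x), s.2.1.take (c.eval a.1))), s.2.1.drop (c.eval a.1),
      f (a.1, (a.2, s.1, x), s.2.1.take (c.eval a.1)) :: s.2.2)
  obtain ⟨F, hF⟩ := hf.sz_le
  refine ⟨fun y => ((y.2.1.2.2.foldl (step (y.1, y.2.1.1))
    (y.2.1.2.1, y.2.2, ([] : List β))).2.2).reverse, L * c, fun n => (L.eval n : ℕ) * ε n, ?_,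
    hε.poly_mul L, ?_⟩
  · refine PolyTime.reverse (PolyTime.snd (PolyTime.snd (PolyTime.foldl
      (f := fun (y : ℕ × (α × γ × List δ) × List Bool) => step (y.1, y.2.1.1)) (by fun_prop)
      (by fun_prop) (by simp only [step]; fun_prop) ?_ ?_)))
    -- Bounds for the state, for the remaining coins and for the collected outputs, and two vertices
    -- for the pairs.
    · exact .X + B + .X + (.X * (F.comp (.X + .X + B + 10) + 1) + 1) + 2
    · rintro ⟨n, ⟨e, st, l⟩, r⟩ l' hl'
      set N := sz (n, (e, st, l), r) with hN
      have hn : n ≤ N := by simp only [sz_pair, sz_nat] at hN; omega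
      have key : ∀ l' : List δ, (∀ x ∈ l', x ∈ l) → ∀ s, s = l'.foldl (step (n, e)) (st, r, []) →
          sz s.1 ≤ N + B.eval N ∧ sz s.2.1 ≤ sz r ∧
          sz s.2.2 ≤ l'.length * (F.eval (N + N + B.eval N + 10) + 1) + 1 := by
        intro l'
        induction l' using List.reverseRecOn with
        | nil =>
          rintro - s rfl
          simp only [sz_pair] at hN
          refine ⟨?_, le_rfl, by simp⟩
          simp only [List.foldl_nil]
          omega
        | append_singleton l' x ih =>
          rintro h s rfl
          obtain ⟨h1, h2, h3⟩ := ih (fun x hx => h x (by simp [hx])) _ rfl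
          rw [List.foldl_append, List.foldl_cons, List.foldl_nil]
          generalize l'.foldl (step (n, e)) (st, r, []) = s at *
          refine ⟨(hB _ _).trans ((eval_mono B hn).trans (by omega)), (sz_drop_le _ _).trans h2, ?_⟩
          have h4 := hF (n, (e, s.1, x), s.2.1.take (c.eval n))
          have h5 := sz_take_le (c.eval n) s.2.1
          have h6 := sz_le_of_mem (h x (by simp))
          have h7 := h4.trans (eval_mono F (b := N + N + B.eval N + 10) (by
            simp only [sz_pair] at hN ⊢
            omega))
          simp only [step, sz_cons, List.length_append, List.length_cons, List.length_nil, zero_add,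
            add_mul, one_mul] at h3 h7 ⊢
          omega
      obtain ⟨h1, h2, h3⟩ := key l' (fun x hx => hl'.subset hx) _ rfl
      simp only [Polynomial.eval_add, Polynomial.eval_mul, Polynomial.eval_comp, Polynomial.eval_X,
        Polynomial.eval_ofNat, Polynomial.eval_one]
      have h4 : l'.length ≤ N := by
        have h5 : l'.length ≤ l.length := hl'.length_le
        have h6 := length_lt_sz l
        simp only [sz_pair] at hN
        omega
      have h5 := Nat.mul_le_mul_right (F.eval (N + N + B.eval N + 10) + 1) h4
      have h6 : sz r ≤ N := by simp only [sz_pair] at hN; omega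
      generalize l'.foldl (step (n, e)) (st, r, []) = s at *
      obtain ⟨s1, s2, s3⟩ := s
      simp only [sz_pair] at h1 h2 h3 ⊢
      omega
  · rintro n ⟨e, st, l⟩ ⟨hl, hlen⟩ φ hφ
    -- The supply `N` of coins may exceed the need, since coins for the maximal number of steps are
    -- provided. The outputs accumulate in reverse order in `acc`.
    have key : ∀ (l : List δ) (st : γ) (acc : List β) (N : ℕ), l.length * c.eval n ≤ N →
        (∀ x ∈ l, G n (e, st, x)) →
        Close (l.length * ε n)
          (ex (PPM.lbits N) fun r => φ ((l.foldl (step (n, e)) (st, r, acc)).2.2).reverse)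
          (ex (loopDist (X n) (fun o => g (n, o)) e st l) fun z => φ (acc.reverse ++ z)) := by
      intro l
      induction l with
      | nil => intro st acc N _ _; exact Close.of_eq (by simp [loopDist])
      | cons x l ih =>
        intro st acc N hN hx
        obtain ⟨N, rfl⟩ : ∃ M, N = c.eval n + M := Nat.exists_eq_add_of_le (by
          simp only [List.length_cons, add_mul, one_mul] at hN; omega)
        have h1 := h n (e, st, x) (hx x (by simp))
          (fun o => ex (PPM.lbits N) fun r =>
            φ ((l.foldl (step (n, e)) (g (n, o), r, o :: acc)).2.2).reverse)
          fun o => ex_le_one _ fun _ => hφ _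
        have h2 : Close (l.length * ε n)
            (ex (X n (e, st, x)) fun o => ex (PPM.lbits N) fun r =>
              φ ((l.foldl (step (n, e)) (g (n, o), r, o :: acc)).2.2).reverse)
            (ex (X n (e, st, x)) fun o => ex (loopDist (X n) (fun o => g (n, o)) e (g (n, o)) l)
              fun z => φ ((o :: acc).reverse ++ z)) :=
          Close.ex _ fun o ho => ih _ _ _ (by
            simp only [List.length_cons, add_mul, one_mul] at hN; omega)
            fun x' hx' => hG n e st x (hx x (by simp)) o ho x' (hx x' (by simp [hx']))
        have h3 := h1.trans h2
        convert h3 using 1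
        · simp [add_mul, add_comm]
        · rw [lbits_add, ex_map]
          refine ex_congr_support _ fun m hm => ex_congr _ fun r => ?_
          simp only [List.foldl_cons, step, ← length_of_mem_lbits hm, List.take_left,
            List.drop_left]
        · simp [loopDist, ex_bind]
    have h1 := key l st [] ((L * c).eval n) (by
      rw [Polynomial.eval_mul]; gcongr) hl
    simp only [ex_map]
    refine h1.mono ?_
    gcongr

end samp

end PPM

namespace PPM

open Code (code)
open scoped ENNReal

/-! ### Sampling from a finite set -/

/-- Binary value modulo `q + 1` of a list of bits, computed from the remainders only. -/
def modBits (q : ℕ) (l : List Bool) : ℕ :=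
  l.foldr (fun b v => let w := v + v + if b then 1 else 0
    min q (if w ≤ q then w else w - (q + 1))) 0

theorem modBits_le (q : ℕ) (l : List Bool) : modBits q l ≤ q := by
  cases l with
  | nil => simp [modBits]
  | cons b l => exact min_le_left _ _

/-- A remainder at most `q`, doubled and increased by a bit, is less than twice `q + 1`, so one
subtraction reduces it. Hence the outer `min` in `modBits` never takes effect; it only makes the
size bound in `polyTime_modBits` immediate. -/
theorem modBits_cons (q : ℕ) (b : Bool) (l : List Bool) :
    modBits q (b :: l) = (2 * modBits q l + if b then 1 else 0) % (q + 1) := by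
  have h := modBits_le q l
  have e : modBits q (b :: l) = (let w := modBits q l + modBits q l + if b then 1 else 0
    min q (if w ≤ q then w else w - (q + 1))) := rfl
  rw [e, two_mul]
  set w := modBits q l + modBits q l + if b then 1 else 0 with hw
  have hw2 : w < (q + 1) + (q + 1) := by split_ifs at hw <;> omega
  dsimp only
  split_ifs with h1
  · rw [Nat.mod_eq_of_lt (by omega), min_eq_right h1]
  · rw [Nat.mod_eq_sub_mod (by omega), Nat.mod_eq_of_lt (by omega), min_eq_right (by omega)]

theorem polyTime_modBits : PolyTime fun x : ℕ × List Bool => modBits x.1 x.2 := by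
  have h : PolyTime fun x : ℕ × List Bool => x.2.reverse.foldl (fun v b =>
      min x.1 (if (v + v + if b = true then 1 else 0) ≤ x.1 then (v + v + if b = true then 1 else 0)
        else (v + v + if b = true then 1 else 0) - (x.1 + 1))) 0 := by
    refine PolyTime.foldl (c := fun _ => 0) (f := fun (x : ℕ × List Bool) v (b : Bool) =>
      min x.1 (if (v + v + if b = true then 1 else 0) ≤ x.1 then (v + v + if b = true then 1 else 0)
        else (v + v + if b = true then 1 else 0) - (x.1 + 1))) (by fun_prop) (by fun_prop) ?_
        (2 * .X + 1) ?_
    · fun_prop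
    · rintro ⟨q, l⟩ l' -
      have h1 : sz q ≤ sz (q, l) := by simp only [sz_pair]; omega
      cases l' using List.reverseRecOn with
      | nil => simp
      | append_singleton l' b =>
        rw [List.foldl_append, List.foldl_cons, List.foldl_nil]
        simp only [sz_nat, Polynomial.eval_add, Polynomial.eval_mul, Polynomial.eval_ofNat,
          Polynomial.eval_X, Polynomial.eval_one] at h1 ⊢
        refine Nat.succ_le_succ (Nat.mul_le_mul_left 2 ((min_le_left _ _).trans ?_))
        simp only [sz_pair, sz_nat]
        omega
  simpa [modBits, List.foldl_reverse] using h

theorem sum_range_two_mul (M : ℕ) (φ : ℕ → ℝ≥0∞) :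
    ∑ u ∈ Finset.range (2 * M), φ u = ∑ u ∈ Finset.range M, (φ (2 * u) + φ (2 * u + 1)) := by
  induction M with
  | zero => simp
  | succ M ih =>
    rw [show 2 * (M + 1) = 2 * M + 1 + 1 by ring, Finset.sum_range_succ, Finset.sum_range_succ,
      Finset.sum_range_succ, ih, add_assoc]

/-- The bits run through all binary values below `2 ^ N`. The head of the list is the least
significant bit, so the induction splits the range into even and odd numbers. -/
theorem ex_modBits (q N : ℕ) (φ : ℕ → ℝ≥0∞) :
    (ex (lbits N) fun l => φ (modBits q l)) =
      ∑ u ∈ Finset.range (2 ^ N), (2 ^ N : ℝ≥0∞)⁻¹ * φ (u % (q + 1)) := by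
  induction N generalizing φ with
  | zero => simp [lbits_zero, modBits]
  | succ N ih =>
    rw [lbits_succ]
    simp only [modBits_cons]
    have ih' := fun b : Bool => ih fun v => φ ((2 * v + if b then 1 else 0) % (q + 1))
    simp only [ih']
    rw [ex_unif, pow_succ', sum_range_two_mul]
    simp only [Fintype.univ_bool, Finset.mem_singleton, reduceCtorEq, not_false_eq_true,
      Finset.sum_insert, Finset.sum_singleton, Fintype.card_bool, Finset.mul_sum,
      ← Finset.sum_add_distrib]
    refine Finset.sum_congr rfl fun u _ => ?_
    have h1 : (2 * (u % (q + 1)) + if True then 1 else 0) % (q + 1) = (2 * u + 1) % (q + 1) := by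
      simp [Nat.add_mod, Nat.mul_mod]
    have h2 : (2 * (u % (q + 1)) + if False then 1 else 0) % (q + 1) = (2 * u) % (q + 1) := by
      simp [Nat.mul_mod]
    rw [h1, h2, pow_succ' (2 : ℝ≥0∞), ENNReal.mul_inv (by simp) (by simp)]
    push_cast
    ring

theorem sum_range_mod (Q M : ℕ) (φ : ℕ → ℝ≥0∞) :
    ∑ u ∈ Finset.range M, φ (u % Q) =
      (M / Q : ℕ) * ∑ i ∈ Finset.range Q, φ i + ∑ i ∈ Finset.range (M % Q), φ i := by
  rcases Nat.eq_zero_or_pos Q with rfl | hQ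
  · simp
  have h1 : ∀ A B, B ≤ Q → ∑ u ∈ Finset.range (Q * A + B), φ (u % Q) =
      A * ∑ i ∈ Finset.range Q, φ i + ∑ i ∈ Finset.range B, φ i := by
    intro A
    induction A with
    | zero =>
      intro B hB
      simp only [mul_zero, zero_add, Nat.cast_zero, zero_mul]
      exact Finset.sum_congr rfl fun i hi => by
        rw [Nat.mod_eq_of_lt ((Finset.mem_range.1 hi).trans_le hB)]
    | succ A ih =>
      intro B hB
      rw [Finset.sum_range_add, mul_add, mul_one, ih Q le_rfl]
      push_cast
      rw [add_mul, one_mul]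
      congr 1
      exact Finset.sum_congr rfl fun i hi => by
        rw [← mul_add_one, Nat.mul_add_mod, Nat.mod_eq_of_lt ((Finset.mem_range.1 hi).trans_le hB)]
  conv_lhs => rw [← Nat.div_add_mod M Q]
  exact h1 _ _ (Nat.mod_lt _ hQ).le

/-- Write `2 ^ N` as a multiple of `q + 1` plus a remainder. The full periods give the uniform
average up to normalization, and the remainder has weight at most `(q + 1) / 2 ^ N`. -/
theorem close_modBits (q N : ℕ) (φ : ℕ → ℝ≥0∞) (hφ : ∀ i, φ i ≤ 1) :
    Close ((q + 1 : ℕ) * (2 ^ N : ℝ≥0∞)⁻¹) (ex (lbits N) fun l => φ (modBits q l))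
      (ex (unif (Fin (q + 1))) fun i => φ i) := by
  rw [ex_modBits, ← Finset.mul_sum, sum_range_mod, ex_unif, ← Finset.mul_sum,
    Fin.sum_univ_eq_sum_range (fun i => φ i), Fintype.card_fin]
  have hM : (2 ^ N : ℝ≥0∞) * (2 ^ N : ℝ≥0∞)⁻¹ = 1 := ENNReal.mul_inv_cancel (by simp) (by simp)
  have hdiv : ((2 ^ N : ℕ) : ℝ≥0∞) = (2 ^ N : ℝ≥0∞) := by push_cast; rfl
  have hdm := Nat.div_add_mod (2 ^ N) (q + 1)
  have hB := (Nat.mod_lt (2 ^ N) (Nat.succ_pos q)).le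
  have hR : ∀ k, ∑ i ∈ Finset.range k, φ i ≤ k := fun k =>
    (Finset.sum_le_sum fun i _ => hφ i).trans (by simp)
  generalize 2 ^ N / (q + 1) = A at *
  have hRB := hR (2 ^ N % (q + 1))
  generalize ∑ i ∈ Finset.range (2 ^ N % (q + 1)), φ i = R at *
  generalize 2 ^ N % (q + 1) = B at *
  have hS := hR (q + 1)
  generalize ∑ i ∈ Finset.range (q + 1), φ i = S at *
  have hQ : ((q + 1 : ℕ) : ℝ≥0∞) * ((q + 1 : ℕ) : ℝ≥0∞)⁻¹ = 1 :=
    ENNReal.mul_inv_cancel (by simp) (by simp)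
  rw [← hdm] at hdiv
  have hBQ : (B : ℝ≥0∞) ≤ (q + 1 : ℕ) := by exact_mod_cast hB
  rw [Nat.cast_add, Nat.cast_mul] at hdiv
  generalize (2 ^ N : ℝ≥0∞) = M at *
  generalize ((q + 1 : ℕ) : ℝ≥0∞) = Q at *
  generalize (B : ℝ≥0∞) = b at *
  generalize (A : ℝ≥0∞) = a at *
  constructor
  · have h1 : a ≤ M * Q⁻¹ := by
      calc a = a * (Q * Q⁻¹) := by rw [hQ, mul_one]
        _ = (Q * a) * Q⁻¹ := by ring
        _ ≤ M * Q⁻¹ := by gcongr; rw [← hdiv]; exact le_self_add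
    calc M⁻¹ * (a * S + R) ≤ M⁻¹ * (M * Q⁻¹ * S + Q) := by
          gcongr
          exact hRB.trans hBQ
      _ = (M * M⁻¹) * (Q⁻¹ * S) + Q * M⁻¹ := by ring
      _ = _ := by rw [hM, one_mul]
  · have h2 : Q⁻¹ * S ≤ 1 := by
      calc Q⁻¹ * S ≤ Q⁻¹ * Q := by gcongr
        _ = 1 := by rw [mul_comm, hQ]
    calc Q⁻¹ * S = Q⁻¹ * S * (M * M⁻¹) := by rw [hM, mul_one]
      _ = M⁻¹ * ((Q * Q⁻¹) * (a * S) + Q⁻¹ * S * b) := by rw [← hdiv]; ring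
      _ ≤ M⁻¹ * (a * S + R + Q) := by
        rw [hQ, one_mul]
        gcongr
        · exact le_self_add
        · exact (mul_le_mul' h2 hBQ).trans (by rw [one_mul])
      _ = _ := by ring

section

variable {α β γ : Type} [Code α] [Code β] [Code γ] {G : ℕ → α → Prop}

theorem Samp.fin (Q : Polynomial ℕ) :
    Samp G fun n _ => (unif (Fin (Q.eval n + 1))).map fun i => i.val := by
  -- With `n + Q(n) + 1` coins the error is at most `2 ^ (-n)`, because `Q(n) + 1 ≤ 2 ^ (Q(n) + 1)`.
  refine ⟨fun x => modBits (Q.eval x.1) x.2.2, .X + (Q + 1), fun n => 2⁻¹ ^ n, ?_, ENegl.two_pow, ?_⟩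
  · exact polyTime_modBits.comp (f := fun x : ℕ × α × List Bool => (Q.eval x.1, x.2.2)) (by fun_prop)
  · intro n a _ φ hφ
    rw [ex_map, ex_map]
    refine (close_modBits _ _ φ hφ).mono ?_
    simp only [Polynomial.eval_add, Polynomial.eval_X, Polynomial.eval_one]
    have h1 : ((Q.eval n + 1 : ℕ) : ℝ≥0∞) ≤ 2 ^ (Q.eval n + 1) := by
      exact_mod_cast (Nat.lt_two_pow_self).le
    rw [← ENNReal.inv_pow, pow_add, ENNReal.mul_inv (by simp) (by simp), mul_left_comm]
    calc _ ≤ (2 ^ n : ℝ≥0∞)⁻¹ * ((2 ^ (Q.eval n + 1)) * (2 ^ (Q.eval n + 1))⁻¹) := by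
          gcongr
      _ = _ := by rw [ENNReal.mul_inv_cancel (by simp) (by simp), mul_one]

/-- Finite sets with a fixed number of elements can be sampled. -/
theorem Samp.unif_finite (δ : Type) [Fintype δ] [Nonempty δ] (f : δ → β) :
    Samp G fun _ _ => (unif δ).map f := by
  obtain ⟨q, hq⟩ : ∃ q, Fintype.card δ = q + 1 := Nat.exists_eq_succ_of_ne_zero Fintype.card_ne_zero
  let e : Fin (q + 1) ≃ δ := (Fintype.equivFinOfCardEq hq).symm
  have h := (Samp.fin (G := G) (Polynomial.C q)).map
    (f := fun x => (List.ofFn fun i => f (e i)).getD x.2.2 (f (e 0))) (by fun_prop)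
  refine h.congr fun n a _ φ => ?_
  -- The type of indices involves the value of the constant polynomial, hence the generalization to
  -- `q'`.
  have key : ∀ q', q' = q → ex (unif δ) (fun d => φ (f d)) = ex (unif (Fin (q' + 1))) fun i =>
      φ ((List.ofFn fun i => f (e i)).getD i.val (f (e 0))) := by
    rintro _ rfl
    rw [ex_unif_equiv e]
    refine ex_congr _ fun i => ?_
    have := i.is_le
    simp [-List.ofFn_succ, this]
  simp only [ex_map]
  exact key _ (by simp)

end

end PPM

/-! ### Sizes of codes and sampling of ciphertexts -/

namespace PPM

open Code (code)
open Decode (decode decode_code)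
open scoped ENNReal

theorem sz_bits_le (l : List Bool) : sz l ≤ 4 * l.length + 1 := by
  induction l with
  | nil => simp
  | cons b l ih =>
    have : sz b ≤ 3 := by cases b <;> simp [sz, Data.size]
    simp only [sz_cons, List.length_cons]
    omega

theorem sz_list_le {α : Type} [Code α] {l : List α} {B : ℕ} (h : ∀ a ∈ l, sz a ≤ B) :
    sz l ≤ l.length * (B + 1) + 1 := by
  induction l with
  | nil => simp
  | cons b l ih =>
    have h1 := ih fun a ha => h a (by simp [ha])
    have h2 := h b (by simp)
    simp only [sz_cons, List.length_cons, add_mul, one_mul] at *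
    omega

theorem sz_pi_le {α : Type} [Code α] {k : ℕ} {f : Fin k → α} {B : ℕ} (h : ∀ i, sz (f i) ≤ B) :
    sz f ≤ k * (B + 1) + 1 := by
  have : sz f = sz (List.ofFn f) := rfl
  rw [this]
  refine (sz_list_le (B := B) ?_).trans (by simp)
  intro a ha
  obtain ⟨i, rfl⟩ := (List.mem_ofFn' f a).1 ha
  exact h i

theorem sz_fst_lt {α β : Type} [Code α] [Code β] (x : α × β) : sz x.1 < sz x := by
  have : sz x = sz x.1 + sz x.2 + 1 := rfl
  omega

theorem sz_snd_lt {α β : Type} [Code α] [Code β] (x : α × β) : sz x.2 < sz x := by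
  have : sz x = sz x.1 + sz x.2 + 1 := rfl
  omega

theorem sz_apply_lt {α : Type} [Code α] {k : ℕ} (f : Fin k → α) (i : Fin k) : sz (f i) < sz f :=
  sz_le_of_mem (l := List.ofFn f) ((List.mem_ofFn' f _).2 ⟨i, rfl⟩)

theorem getD_ofFn {α : Type} {k i : ℕ} (f : Fin k → α) (h : i < k) (d : α) :
    (List.ofFn f).getD i d = f ⟨i, h⟩ := by
  simp [h]

namespace EncScheme

variable (S : EncScheme)

theorem ex_encrypt (n : ℕ) (k m : List Bool) (f : List Bool × List Bool → ℝ≥0∞) :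
    ex (S.encrypt n k m) f =
      ex (lbits (S.coins.eval (n + m.length))) fun r => f (S.enc n k m r, r) := by
  rw [encrypt, ex_map, ex_lbits]

theorem mem_support_encrypt {n : ℕ} {k m : List Bool} {c : List Bool × List Bool}
    (h : c ∈ (S.encrypt n k m).support) :
    c.2.length = S.coins.eval (n + m.length) ∧ c.1 = S.enc n k m c.2 := by
  rw [encrypt, PMF.mem_support_map_iff] at h
  obtain ⟨r, -, rfl⟩ := h
  simp

theorem dec_of_mem_support {n : ℕ} {k m : List Bool} {c : List Bool × List Bool}
    (h : c ∈ (S.encrypt n k m).support) (hk : k.length = n) : S.dec n k c.1 = some m := by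
  obtain ⟨h1, h2⟩ := S.mem_support_encrypt h
  rw [h2, S.dec_enc n k m c.2 hk h1]

/-- Ciphertexts and coins have polynomial length. -/
theorem exists_length_le (Q : Polynomial ℕ) : ∃ Q' : Polynomial ℕ, ∀ n k m, k.length ≤ n →
    m.length ≤ Q.eval n → ∀ r : List Bool, r.length ≤ S.coins.eval (n + m.length) →
      (S.enc n k m r).length ≤ Q'.eval n ∧ S.coins.eval (n + m.length) ≤ Q'.eval n := by
  obtain ⟨P, hP⟩ := S.enc_polyTime.sz_le
  let R := S.coins.comp (.X + Q)
  refine ⟨P.comp (2 * .X + 4 * .X + 4 * Q + 4 * R + 10) + R, fun n k m hk hm r hr => ?_⟩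
  have h1 : S.coins.eval (n + m.length) ≤ R.eval n := by
    simp only [R, Polynomial.eval_comp, Polynomial.eval_add, Polynomial.eval_X]
    exact eval_mono _ (by omega)
  have h2 := (length_lt_sz _).le.trans (hP (n, k, m, r))
  have h3 := h2.trans (eval_mono P (b := 2 * n + 4 * n + 4 * Q.eval n + 4 * R.eval n + 10) (by
    have e1 := sz_bits_le k
    have e2 := sz_bits_le m
    have e3 := sz_bits_le r
    simp only [sz_pair, sz_nat]
    omega))
  simp only [Polynomial.eval_comp, Polynomial.eval_add, Polynomial.eval_X, Polynomial.eval_mul,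
    Polynomial.eval_ofNat]
  simp only at h3
  omega

theorem exists_support_length_le (Q : Polynomial ℕ) : ∃ Q' : Polynomial ℕ, ∀ n k m, k.length ≤ n →
    m.length ≤ Q.eval n → ∀ c ∈ (S.encrypt n k m).support,
      c.1.length ≤ Q'.eval n ∧ c.2.length ≤ Q'.eval n := by
  obtain ⟨Q', h⟩ := S.exists_length_le Q
  refine ⟨Q', fun n k m hk hm c hc => ?_⟩
  obtain ⟨h1, h2⟩ := S.mem_support_encrypt hc
  have := h n k m hk hm c.2 h1.le
  rw [h2, h1]
  exact this

theorem enc_polyTime' {α : Type} [Code α] {n : α → ℕ} {k m r : α → List Bool} (hn : PolyTime n)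
    (hk : PolyTime k) (hm : PolyTime m) (hr : PolyTime r) :
    PolyTime fun a => S.enc (n a) (k a) (m a) (r a) :=
  S.enc_polyTime.comp (f := fun a => (n a, k a, m a, r a)) (by fun_prop)

theorem dec_polyTime' {α : Type} [Code α] {n : α → ℕ} {k c : α → List Bool} (hn : PolyTime n)
    (hk : PolyTime k) (hc : PolyTime c) : PolyTime fun a => S.dec (n a) (k a) (c a) :=
  S.dec_polyTime.comp (f := fun a => (n a, k a, c a)) (by fun_prop)

/-- Coins for the longest admissible message are drawn and then cut to the number that the actual
message needs. -/
theorem samp_encrypt (Q : Polynomial ℕ) :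
    Samp (fun n (a : List Bool × List Bool) => a.2.length ≤ Q.eval n)
      fun n a => S.encrypt n a.1 a.2 := by
  refine ⟨fun x => (S.enc x.1 x.2.1.1 x.2.1.2 (x.2.2.take (S.coins.eval (x.1 + x.2.1.2.length))),
    x.2.2.take (S.coins.eval (x.1 + x.2.1.2.length))), S.coins.comp (.X + Q), _, ?_, ENegl.zero, ?_⟩
  · exact .prodMk (S.enc_polyTime' (by fun_prop) (by fun_prop) (by fun_prop) (by fun_prop))
      (by fun_prop)
  · rintro n ⟨k, m⟩ h
    refine SDist.of_ex_eq fun φ => ?_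
    rw [ex_map, ex_encrypt]
    have h1 : S.coins.eval (n + m.length) ≤ (S.coins.comp (.X + Q)).eval n := by
      simp only [Polynomial.eval_comp, Polynomial.eval_add, Polynomial.eval_X]
      exact eval_mono _ (by simpa using h)
    exact lbits_take h1 fun r => φ (S.enc n k m r, r)

end EncScheme

/-! ### Uniformity over advice -/

/-- A supremum need not be attained, but half of a positive supremum is exceeded somewhere. This
selects a nearly worst advice for each security parameter. -/
theorem exists_half_max {T : Type} [Nonempty T] (f : T → ℝ) (h1 : ∀ t, f t ≤ 1) :
    ∃ t₀, ∀ t, f t ≤ 2 * |f t₀| := by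
  have hb : BddAbove (Set.range f) := ⟨1, by rintro _ ⟨t, rfl⟩; exact h1 t⟩
  rcases le_or_gt (sSup (Set.range f)) 0 with h | h
  · exact ⟨Classical.arbitrary T, fun t => (le_csSup hb ⟨t, rfl⟩).trans (h.trans (by positivity))⟩
  · obtain ⟨_, ⟨t₀, rfl⟩, ht⟩ := exists_lt_of_lt_csSup (Set.range_nonempty f) (half_lt_self h)
    refine ⟨t₀, fun t => (le_csSup hb ⟨t, rfl⟩).trans ?_⟩
    have := le_abs_self (f t₀)
    linarith

/-- A bound that is negligible for each choice of polynomial-size advice is negligible uniformly in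
the advice. -/
theorem exists_uniform_negligible {T : Type} [Code T] [Inhabited T] (B : Polynomial ℕ)
    (f : ℕ → T → ℝ) (h1 : ∀ n t, f n t ≤ 1)
    (h : ∀ w : ℕ → T, (∃ P : Polynomial ℕ, ∀ n, sz (w n) ≤ P.eval n) →
      Negligible fun n => |f n (w n)|) :
    ∃ ε : ℕ → ℝ, Negligible ε ∧ (∀ n, 0 ≤ ε n) ∧ ∀ n t, sz t ≤ B.eval n → f n t ≤ ε n := by
  -- If no object is small enough, the default object is taken; its size is the constant added to
  -- `B` below.
  have key : ∀ n, ∃ w : T, sz w ≤ B.eval n + sz (default : T) ∧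
      ∀ t, sz t ≤ B.eval n → f n t ≤ 2 * |f n w| := by
    intro n
    by_cases hn : Nonempty {t : T // sz t ≤ B.eval n}
    · obtain ⟨⟨w, hw⟩, h⟩ := exists_half_max (fun t : {t : T // sz t ≤ B.eval n} => f n t)
        fun t => h1 n t
      exact ⟨w, by omega, fun t ht => h ⟨t, ht⟩⟩
    · exact ⟨default, by omega, fun t ht => (hn ⟨t, ht⟩).elim⟩
  choose w hw hw' using key
  refine ⟨fun n => 2 * |f n (w n)|, ?_, fun n => by positivity, fun n t ht => hw' n t ht⟩
  exact (h w ⟨B + Polynomial.C (sz (default : T)), fun n => by simpa using hw n⟩).const_mul 2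

/-! ### Chosen plaintext attacks with a fixed script -/

/-- The keyed part of a script, `((a, b, w), (x, k, ρ))`: encrypt `x` under the secret key if `a`,
then encrypt the result under the secret key if `b`, then encrypt the result under the key `k` with
coins taken from `ρ` if `w`. -/
abbrev Row : Type := (Bool × Bool × Bool) × (List Bool × List Bool × List Bool)

theorem sz_row_le (r : Row) :
    sz r ≤ 4 * (r.2.1.length + r.2.2.1.length + r.2.2.2.length) + 20 := by
  obtain ⟨⟨a, b, w⟩, x, k, ρ⟩ := r
  have h : ∀ b : Bool, sz b ≤ 3 := fun b => by cases b <;> simp [sz, Data.size]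
  have := h a
  have := h b
  have := h w
  have := sz_bits_le x
  have := sz_bits_le k
  have := sz_bits_le ρ
  simp only [sz_pair]
  omega

namespace Row

/-- The message of the second encryption, given the reply to the first one. -/
def second (r : Row) (c : List Bool) : List Bool := if r.1.1 then c else r.2.1

/-- The last step, given the replies to the two encryptions. -/
def out (S : EncScheme) (n : ℕ) (r : Row) (c d : List Bool) : List Bool :=
  let e := if r.1.2.1 then d else r.second c
  if r.1.2.2 then S.enc n r.2.2.1 e (r.2.2.2.take (S.coins.eval (n + e.length))) else e

/-- Replies to the two encryptions under the key `K`. -/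
noncomputable def replies (S : EncScheme) (n : ℕ) (K : List Bool) (r : Row) :
    PMF (List Bool × List Bool) :=
  (S.encrypt n K r.2.1).bind fun c => (S.encrypt n K (r.second c.1)).map fun d => (c.1, d.1)

/-- Result of a row for the secret key `K`. -/
noncomputable def dist (S : EncScheme) (n : ℕ) (K : List Bool) (r : Row) : PMF (List Bool) :=
  (r.replies S n K).map fun p => r.out S n p.1 p.2

end Row

theorem Row.ex_dist (S : EncScheme) (n : ℕ) (K : List Bool) (r : Row) :
    r.dist S n K = ((S.encrypt n K r.2.1).map Prod.fst).bind fun c =>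
      ((S.encrypt n K (r.second c)).map Prod.fst).map fun d => r.out S n c d := by
  refine pmf_ext_ex fun φ => ?_
  simp [Row.dist, Row.replies, ex_bind]

namespace EncScheme

variable (S : EncScheme)

theorem polyTime_rowOut {α : Type} [Code α] {n : α → ℕ} {r : α → Row} {c d : α → List Bool}
    (hn : PolyTime n) (hr : PolyTime r) (hc : PolyTime c) (hd : PolyTime d) :
    PolyTime fun a => (r a).out S (n a) (c a) (d a) := by
  simp only [Row.out, Row.second]
  exact .ite (by fun_prop) (S.enc_polyTime' hn (by fun_prop) (by fun_prop) (by fun_prop))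
    (by fun_prop)

/-- Queries of a block whose messages depend only on the replies before the block are answered by
independent encryptions. -/
theorem cpaReplies_block (A : CPAAdversary) (b : Bool) (n : ℕ) (K r : List Bool) (t k : ℕ)
    (M : List (List Bool) → ℕ → List Bool)
    (hM : ∀ h ∈ (S.cpaReplies A b n K r t).support, ∀ h', h'.length < k →
      A.message b n r (h ++ h') = M h h'.length) (φ : List (List Bool) → ℝ≥0∞) :
    ex (S.cpaReplies A b n K r (t + k)) φ = ex (S.cpaReplies A b n K r t) fun h =>
      ex (indep fun j : Fin k => (S.encrypt n K (M h j)).map Prod.fst) fun e =>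
        φ (h ++ List.ofFn e) := by
  induction k generalizing φ with
  | zero => simp
  | succ k ih =>
    rw [← add_assoc, cpaReplies]
    simp only [ex_bind', ex_pure]
    rw [ih fun h hh h' hl => hM h hh h' (by omega)]
    refine ex_congr_support _ fun h hh => ?_
    rw [ex_indep_snoc]
    refine ex_congr _ fun e => ?_
    rw [hM h hh _ (by simp), ex_map, List.length_ofFn, Fin.val_last]
    refine ex_congr _ fun c => ?_
    rw [List.ofFn_succ']
    simp

theorem length_of_mem_cpaReplies {A : CPAAdversary} {b : Bool} {n : ℕ} {K r : List Bool} {t : ℕ}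
    {h : List (List Bool)} (hh : h ∈ (S.cpaReplies A b n K r t).support) : h.length = t := by
  induction t generalizing h with
  | zero =>
    have : h = [] := by simpa [cpaReplies, monad_pure_eq] using hh
    simp [this]
  | succ t ih =>
    simp only [cpaReplies, monad_bind_eq, monad_pure_eq, PMF.mem_support_bind_iff,
      PMF.mem_support_pure_iff] at hh
    obtain ⟨h', h1, c, -, rfl⟩ := hh
    simp [ih h1]

/-- Replies that are used as later messages are genuine ciphertexts. Their lengths are therefore
bounded, and the truncation of messages has no effect on them. -/
theorem exists_of_mem_cpaReplies {A : CPAAdversary} {b : Bool} {n : ℕ} {K r : List Bool} {t : ℕ}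
    {h : List (List Bool)} (hh : h ∈ (S.cpaReplies A b n K r t).support) (j : ℕ) (hj : j < t) :
    ∃ c ∈ (S.encrypt n K (A.message b n r (h.take j))).support, h.getD j [] = c.1 := by
  induction t generalizing h with
  | zero => omega
  | succ t ih =>
    simp only [cpaReplies, monad_bind_eq, monad_pure_eq, PMF.mem_support_bind_iff,
      PMF.mem_support_pure_iff] at hh
    obtain ⟨h', h1, c, hc, rfl⟩ := hh
    have hl := S.length_of_mem_cpaReplies h1
    rcases Nat.lt_succ_iff_lt_or_eq.1 hj with hj | rfl
    · obtain ⟨c', h2, h3⟩ := ih h1 hj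
      refine ⟨c', ?_, ?_⟩
      · rwa [List.take_append_of_le_length (by omega)]
      · rwa [List.getD_append _ _ _ _ (by omega)]
    · refine ⟨c, ?_, ?_⟩
      · rwa [← hl, List.take_left]
      · rw [List.getD_append_right _ _ _ _ (by omega)]
        simp [hl]

section script

variable (N : ℕ) {T : Type}
  (H : ℕ × T × List Bool × (Fin N → List Bool) × List Bool → Bool) (cD : Polynomial ℕ)

/-- Success of a test on the results of `N` rows and of a further row `ch`, the first step of which
is an encryption under the secret key. -/
noncomputable def scriptGame (n : ℕ) (aux : T) (rows : Fin N → Row) (ch : Row) : ℝ≥0∞ :=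
  ex (bits n) fun K => ex (lbits (cD.eval n)) fun r =>
    ex (indep fun i => (rows i).dist S n K.toList) fun e => ex (ch.dist S n K.toList) fun c =>
      if H (n, aux, r, e, c) then 1 else 0

theorem scriptGame_le_one (n : ℕ) (aux : T) (rows : Fin N → Row) (ch : Row) :
    S.scriptGame N H cD n aux rows ch ≤ 1 :=
  ex_le_one _ fun _ => ex_le_one _ fun _ => ex_le_one _ fun _ => ex_le_one _ fun _ => by
    split_ifs <;> simp

variable [Decode T]

/-- The adversary that follows a script. -/
noncomputable def scriptAdversary (hH : PolyTime H) (w : ℕ → (Fin N → Row) × Row × List Bool × T)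
    (hw : ∃ P : Polynomial ℕ, ∀ n, sz (w n) ≤ P.eval n) (Q : Polynomial ℕ) : CPAAdversary where
  advice := ⟨fun n => code (w n), hw⟩
  coins := cD
  pre := Polynomial.C (N + N)
  post := Polynomial.C 1
  msgLen := Q
  ask x := let w : (Fin N → Row) × Row × List Bool × T := decode x.2.1
    (((List.ofFn fun i => (w.1 i).2.1) ++
      (List.ofFn fun i : Fin N => (w.1 i).second (x.2.2.2.getD i [])) ++
      [w.2.1.2.1, x.2.2.2.getD (N + N) []]).getD x.2.2.2.length [], w.2.2.1)
  ask_polyTime := by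
    simp only [Row.second]
    fun_prop
  guess x := let w : (Fin N → Row) × Row × List Bool × T := decode x.2.1
    H (x.1, w.2.2.2, x.2.2.1,
      fun i => (w.1 i).out S x.1 (x.2.2.2.getD i []) (x.2.2.2.getD (N + i) []),
      w.2.1.out S x.1 (x.2.2.2.getD (N + N) []) (x.2.2.2.getD (N + N + 1) []))
  guess_polyTime := by
    refine hH.comp (.prodMk (by fun_prop) (.prodMk (by fun_prop) (.prodMk (by fun_prop) (.prodMk
      (.pi fun i => S.polyTime_rowOut (by fun_prop) (by fun_prop) (by fun_prop) (by fun_prop))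
      (S.polyTime_rowOut (by fun_prop) (by fun_prop) (by fun_prop) (by fun_prop))))))

theorem cpaGame_true_eq (A : CPAAdversary) (b : Bool) (n : ℕ) :
    S.cpaGame A b n true = ex (bits n) fun K => ex (lbits (A.coins.eval n)) fun r =>
      ex (S.cpaReplies A b n K.toList r (A.pre.eval n + 1 + A.post.eval n)) fun h =>
        if A.guess (n, A.advice.val n, r, h) then 1 else 0 := by
  rw [apply_eq_ex, cpaGame]
  simp only [ex_bind', ex_pure, ex_lbits]

/-- There are four blocks of queries: the first encryptions of the `N` rows, their second
encryptions, the challenge, and the second encryption of the challenge row. Encryptions that a row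
does not need are made nevertheless, both here and in `Row.replies`, and ignored. The bounds on
lengths make the truncation to `Q` harmless. -/
theorem scriptAdversary_game (hH : PolyTime H) (w : ℕ → (Fin N → Row) × Row × List Bool × T)
    (hw : ∃ P : Polynomial ℕ, ∀ n, sz (w n) ≤ P.eval n) (Q : Polynomial ℕ) (n : ℕ)
    (h1 : ∀ i, ((w n).1 i).2.1.length ≤ Q.eval n)
    (h2 : ∀ i, ∀ K : List Bool, K.length = n → ∀ c ∈ (S.encrypt n K ((w n).1 i).2.1).support,
      c.1.length ≤ Q.eval n)
    (h3 : (w n).2.1.2.1.length ≤ Q.eval n) (h3' : (w n).2.2.1.length = (w n).2.1.2.1.length)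
    (h4 : ∀ K : List Bool, K.length = n → ∀ c ∈ (S.encrypt n K (w n).2.1.2.1).support,
      c.1.length ≤ Q.eval n)
    (h4' : ∀ K : List Bool, K.length = n → ∀ c ∈ (S.encrypt n K (w n).2.2.1).support,
      c.1.length ≤ Q.eval n)
    (ha : (w n).2.1.1.1 = true) (b : Bool) :
    S.cpaGame (scriptAdversary S N H cD hH w hw Q) b n true =
      S.scriptGame N H cD n (w n).2.2.2 (w n).1
        ((w n).2.1.1, if b then (w n).2.2.1 else (w n).2.1.2.1, (w n).2.1.2.2) := by
  rw [cpaGame_true_eq, scriptGame]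
  set A := scriptAdversary S N H cD hH w hw Q with hA
  refine ex_congr _ fun K => ex_congr _ fun r => ?_
  have e : A.pre.eval n + 1 + A.post.eval n = 0 + N + N + 1 + 1 := by
    simp [hA, scriptAdversary]
  rw [e]
  have hask : ∀ h, (A.ask (n, A.advice.val n, r, h)).1 = ((List.ofFn fun i => ((w n).1 i).2.1) ++
      (List.ofFn fun i : Fin N => ((w n).1 i).second (h.getD i [])) ++
      [(w n).2.1.2.1, h.getD (N + N) []]).getD h.length [] := fun h => by
    simp [hA, scriptAdversary, decode_code]
  have hask2 : ∀ h, (A.ask (n, A.advice.val n, r, h)).2 = (w n).2.2.1 := fun h => by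
    simp [hA, scriptAdversary, decode_code]
  have hpre : A.pre.eval n = N + N := by simp [hA, scriptAdversary]
  have hlen : A.msgLen = Q := rfl
  have hm1 : ∀ h, (hh : h.length < N) → A.message b n r h = ((w n).1 ⟨h.length, hh⟩).2.1 := by
    intro h hh
    simp only [CPAAdversary.message, hpre, hlen, hask]
    rw [if_neg (by omega), List.getD_append _ _ _ _ (by simp; omega),
      List.getD_append _ _ _ _ (by simp; omega), List.getD_eq_getElem _ _ (by simpa using hh),
      List.getElem_ofFn, List.take_of_length_le (h1 _)]
  have hm2 : ∀ i : Fin N, ∀ h, h.length = N + i → (h.getD i []).length ≤ Q.eval n →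
      A.message b n r h = ((w n).1 i).second (h.getD i []) := by
    intro i h hh hQ
    simp only [CPAAdversary.message, hpre, hlen, hask]
    rw [if_neg (by omega), List.getD_append _ _ _ _ (by simp; omega),
      List.getD_append_right _ _ _ _ (by simp; omega)]
    have e1 : h.length - (List.ofFn fun i => ((w n).1 i).2.1).length = i := by simp; omega
    rw [e1, List.getD_eq_getElem _ _ (by simp), List.getElem_ofFn, List.take_of_length_le]
    simp only [Row.second]
    split_ifs
    · exact hQ
    · exact h1 _
  have hm3 : ∀ h, h.length = N + N →
      A.message b n r h = if b then (w n).2.2.1 else (w n).2.1.2.1 := by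
    intro h hh
    simp only [CPAAdversary.message, hpre, hlen, hask, hask2]
    rw [if_pos hh, List.getD_append_right _ _ _ _ (by simp; omega)]
    have e1 : h.length - ((List.ofFn fun i => ((w n).1 i).2.1) ++
      (List.ofFn fun i : Fin N => ((w n).1 i).second (h.getD i []))).length = 0 := by simp; omega
    rw [e1, List.getD_cons_zero, List.take_of_length_le h3, List.take_of_length_le (by omega),
      if_pos h3'.symm]
  have hm4 : ∀ h, h.length = N + N + 1 → (h.getD (N + N) []).length ≤ Q.eval n →
      A.message b n r h = h.getD (N + N) [] := by
    intro h hh hQ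
    simp only [CPAAdversary.message, hpre, hlen, hask]
    rw [if_neg (by omega), List.getD_append_right _ _ _ _ (by simp; omega)]
    have e1 : h.length - ((List.ofFn fun i => ((w n).1 i).2.1) ++
      (List.ofFn fun i : Fin N => ((w n).1 i).second (h.getD i []))).length = 1 := by simp; omega
    rw [e1, List.getD_cons_succ, List.getD_cons_zero, List.take_of_length_le hQ]
  -- The blocks are split off from the last query backwards; the conditions on the messages are
  -- verified at the end.
  have hK := K.toList_length
  rw [S.cpaReplies_block A b n K.toList r (0 + N + N + 1) 1 fun h _ => h.getD (N + N) []]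
  · rw [S.cpaReplies_block A b n K.toList r (0 + N + N) 1 fun h _ =>
      if b then (w n).2.2.1 else (w n).2.1.2.1]
    · rw [S.cpaReplies_block A b n K.toList r (0 + N) N fun h j =>
        (List.ofFn fun i => ((w n).1 i).second (h.getD i [])).getD j []]
      · rw [S.cpaReplies_block A b n K.toList r 0 N fun h j =>
          (List.ofFn fun i => ((w n).1 i).2.1).getD j []]
        · rw [cpaReplies, ex_pure]
          simp only [List.getD_eq_getElem, List.length_ofFn, Fin.is_lt, List.getElem_ofFn,
            List.nil_append, Fin.eta]
          have hd : ∀ i, ((w n).1 i).dist S n K.toList = _ := fun i => Row.ex_dist S n K.toList _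
          simp only [hd, Row.ex_dist]
          rw [ex_indep_bind]
          refine ex_congr _ fun e1 => ?_
          rw [indep_map (fun i => (S.encrypt n K.toList (((w n).1 i).second (e1 i))).map Prod.fst)
            (fun i d => ((w n).1 i).out S n (e1 i) d), ex_map]
          refine ex_congr _ fun e2 => ?_
          rw [ex_indep_succ, ex_bind]
          simp only [indep_zero, ex_pure]
          have hif : (if b = true then (w n).2.2.1 else (w n).2.1.2.1) =
            Row.second ((w n).2.1.1, if b = true then (w n).2.2.1 else (w n).2.1.2.1,
              (w n).2.1.2.2) (if b = true then (w n).2.2.1 else (w n).2.1.2.1) := by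
            simp [Row.second]
          refine ex_congr _ fun c => ?_
          rw [ex_indep_succ, ex_map ((S.encrypt n K.toList _).map Prod.fst)]
          simp only [indep_zero, ex_pure]
          have hc : (List.ofFn e1 ++ List.ofFn e2 ++ List.ofFn (Fin.cons c Fin.elim0 : Fin 1 → _)).getD
              (N + N) [] = c := by
            rw [List.getD_append_right _ _ _ _ (by simp)]
            simp
          rw [hc]
          have hs : Row.second ((w n).2.1.1, if b = true then (w n).2.2.1 else (w n).2.1.2.1,
              (w n).2.1.2.2) c = c := by simp [Row.second, ha]
          rw [hs]
          refine ex_congr _ fun d => ?_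
          have hgd : ∀ h : List (List Bool), A.guess (n, A.advice.val n, r, h) = H (n, (w n).2.2.2, r,
              fun i => ((w n).1 i).out S n (h.getD i []) (h.getD (N + i) []),
              (w n).2.1.out S n (h.getD (N + N) []) (h.getD (N + N + 1) [])) := fun h => by
            simp [hA, scriptAdversary, decode_code]
          have hd1 : ∀ i : Fin N, (List.ofFn e1 ++ List.ofFn e2 ++
              List.ofFn (Fin.cons c Fin.elim0 : Fin 1 → _) ++
              List.ofFn (Fin.cons d Fin.elim0 : Fin 1 → _)).getD i [] = e1 i := fun i => by
            rw [List.getD_append _ _ _ _ (by simp; omega), List.getD_append _ _ _ _ (by simp; omega),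
              List.getD_append _ _ _ _ (by simp)]
            simp
          have hd2 : ∀ i : Fin N, (List.ofFn e1 ++ List.ofFn e2 ++
              List.ofFn (Fin.cons c Fin.elim0 : Fin 1 → _) ++
              List.ofFn (Fin.cons d Fin.elim0 : Fin 1 → _)).getD (N + i) [] = e2 i := fun i => by
            rw [List.getD_append _ _ _ _ (by simp), List.getD_append _ _ _ _ (by simp),
              List.getD_append_right _ _ _ _ (by simp)]
            simp
          have hd3 : (List.ofFn e1 ++ List.ofFn e2 ++
              List.ofFn (Fin.cons c Fin.elim0 : Fin 1 → _) ++
              List.ofFn (Fin.cons d Fin.elim0 : Fin 1 → _)).getD (N + N) [] = c := by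
            rw [List.getD_append _ _ _ _ (by simp), hc]
          have hd4 : (List.ofFn e1 ++ List.ofFn e2 ++
              List.ofFn (Fin.cons c Fin.elim0 : Fin 1 → _) ++
              List.ofFn (Fin.cons d Fin.elim0 : Fin 1 → _)).getD (N + N + 1) [] = d := by
            rw [List.getD_append_right _ _ _ _ (by simp [add_assoc])]
            simp
          simp only [hgd, hd1, hd2, hd3, hd4]
          have ho : Row.out S n ((w n).2.1.1, if b = true then (w n).2.2.1 else (w n).2.1.2.1,
              (w n).2.1.2.2) c d = (w n).2.1.out S n c d := by
            simp [Row.out, Row.second, ha]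
          simp only [ho]
        · intro h hh h' hl
          have hl0 : h = [] := List.length_eq_zero_iff.1 (S.length_of_mem_cpaReplies hh)
          subst hl0
          rw [List.nil_append, hm1 _ hl, List.getD_eq_getElem _ _ (by simpa using hl),
            List.getElem_ofFn]
      · intro h hh h' hl
        have hl0 := S.length_of_mem_cpaReplies hh
        have hg : (h ++ h').getD h'.length [] = h.getD h'.length [] :=
          List.getD_append _ _ _ _ (by omega)
        obtain ⟨c, hc, hc'⟩ := S.exists_of_mem_cpaReplies hh h'.length (by omega)
        have ht : (h.take h'.length).length = h'.length := by simp; omega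
        have hc2 : c ∈ (S.encrypt n K.toList ((w n).1 ⟨h'.length, hl⟩).2.1).support := by
          rw [hm1 _ (by omega)] at hc
          simpa only [ht] using hc
        rw [hm2 ⟨h'.length, hl⟩ (h ++ h') (by simp; omega) (by
          simp only [hg, hc']
          exact h2 _ _ hK c hc2)]
        simp only [hg]
        rw [getD_ofFn _ hl]
    · intro h hh h' hl
      have hl0 := S.length_of_mem_cpaReplies hh
      exact hm3 _ (by simp; omega)
  · intro h hh h' hl
    obtain rfl : h' = [] := List.length_eq_zero_iff.1 (by omega)
    have hl0 := S.length_of_mem_cpaReplies hh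
    rw [List.append_nil, hm4 _ (by omega)]
    obtain ⟨c, hc, hc'⟩ := S.exists_of_mem_cpaReplies hh (N + N) (by omega)
    rw [hm3 _ (by simp; omega)] at hc
    rw [hc']
    cases b
    · exact h4 _ hK c (by simpa using hc)
    · exact h4' _ hK c (by simpa using hc)

/-- Replacing the message of one encryption in a script is undetectable, uniformly in all scripts
and auxiliary inputs of polynomial size. -/
theorem close_scriptGame (hcpa : S.CPASecure) [Inhabited T] (hH : PolyTime H) (B : Polynomial ℕ) :
    ∃ ε, ENegl ε ∧ ∀ n (aux : T) (rows : Fin N → Row) (ch : Row) (x' : List Bool),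
      sz (rows, ch, x', aux) ≤ B.eval n → ch.1.1 = true → x'.length = ch.2.1.length →
      Close (ε n) (S.scriptGame N H cD n aux rows ch)
        (S.scriptGame N H cD n aux rows (ch.1, x', ch.2.2)) := by
  classical
  obtain ⟨Q, hQ⟩ := S.exists_support_length_le B
  let G : ℕ → Bool → (Fin N → Row) × Row × List Bool × T → ℝ≥0∞ := fun n b w =>
    S.scriptGame N H cD n w.2.2.2 w.1 (w.2.1.1, if b then w.2.2.1 else w.2.1.2.1, w.2.1.2.2)
  -- Inadmissible scripts get the value zero, so that the function is negligible along every choice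
  -- of advice.
  let F : ℕ → (Fin N → Row) × Row × List Bool × T → ℝ := fun n w =>
    if sz w ≤ B.eval n ∧ w.2.1.1.1 = true ∧ w.2.2.1.length = w.2.1.2.1.length then
      |(G n true w).toReal - (G n false w).toReal| else 0
  have hF : ∀ n w, F n w ≤ 1 := by
    intro n w
    simp only [F]
    split_ifs
    · have e : ∀ b, 0 ≤ (G n b w).toReal ∧ (G n b w).toReal ≤ 1 := fun b =>
        ⟨ENNReal.toReal_nonneg, ENNReal.toReal_le_of_le_ofReal zero_le_one (by
          simpa using scriptGame_le_one ..)⟩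
      rw [abs_le]
      have := e true
      have := e false
      constructor <;> linarith
    · exact zero_le_one
  have hF' : ∀ w : ℕ → (Fin N → Row) × Row × List Bool × T,
      (∃ P : Polynomial ℕ, ∀ n, sz (w n) ≤ P.eval n) → Negligible fun n => |F n (w n)| := by
    intro w hw
    -- `B` bounds the messages of the script, and `Q` the ciphertexts that are encrypted a second
    -- time.
    refine (hcpa (scriptAdversary S N H cD hH w hw (B + Q))).mono (fun n => abs_nonneg _) fun n => ?_
    simp only [F]
    split_ifs with hc
    · obtain ⟨h1, h2, h3⟩ := hc
      have hlen : ∀ i, ((w n).1 i).2.1.length ≤ B.eval n := by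
        intro i
        have e1 := length_lt_sz ((w n).1 i).2.1
        have e2 := sz_fst_lt ((w n).1 i).2
        have e3 := sz_snd_lt ((w n).1 i)
        have e4 := sz_apply_lt (w n).1 i
        have e5 := sz_fst_lt (w n)
        omega
      have hlen2 : (w n).2.1.2.1.length ≤ B.eval n := by
        have e1 := length_lt_sz (w n).2.1.2.1
        have e2 := sz_fst_lt (w n).2.1.2
        have e3 := sz_snd_lt (w n).2.1
        have e4 := sz_fst_lt (w n).2
        have e5 := sz_snd_lt (w n)
        omega
      have key := fun b => S.scriptAdversary_game N H cD hH w hw (B + Q) n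
        (fun i => (hlen i).trans (by simp)) (fun i K hK c hc =>
          (hQ n K _ hK.le (hlen i) c hc).1.trans (by simp)) (hlen2.trans (by simp)) h3
        (fun K hK c hc => (hQ n K _ hK.le hlen2 c hc).1.trans (by simp))
        (fun K hK c hc => (hQ n K _ hK.le (h3.trans_le hlen2) c hc).1.trans (by simp)) h2 b
      simp only [prTrue]
      rw [key, key, abs_abs]
    · simp
  obtain ⟨ε, hε, hε0, h⟩ := exists_uniform_negligible B F hF hF'
  refine ⟨fun n => ENNReal.ofReal (ε n), ENegl.ofReal hε, fun n aux rows ch x' hs ha hx => ?_⟩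
  have h1 := h n (rows, ch, x', aux) hs
  simp only [F, hs, ha, hx, true_and, if_true] at h1
  refine (Close.of_abs (scriptGame_le_one ..) (scriptGame_le_one ..) h1).symm

end script

end EncScheme

end PPM

namespace PPM

open Code (code)
open Decode (decode decode_code)
open scoped ENNReal

/-! ### Lengths of ciphertexts under a known key -/

namespace EncScheme

variable (S : EncScheme)

/-- Probability that a ciphertext of `m` under the key `K` has length `l`. -/
noncomputable def lenProb (n : ℕ) (K m : List Bool) (l : ℕ) : ℝ≥0∞ :=
  ex (S.encrypt n K m) fun c => if c.1.length = l then 1 else 0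

/-- Distance of the distributions of the lengths of the ciphertexts of two messages. -/
noncomputable def lenGap (n : ℕ) (K m m' : List Bool) : ℝ≥0∞ :=
  ∑' l, ((S.lenProb n K m l - S.lenProb n K m' l) + (S.lenProb n K m' l - S.lenProb n K m l))

theorem lenProb_le_one (n : ℕ) (K m : List Bool) (l : ℕ) : S.lenProb n K m l ≤ 1 :=
  ex_le_one _ fun _ => by split_ifs <;> simp

theorem ex_encrypt_length (n : ℕ) (K m : List Bool) (h : ℕ → ℝ≥0∞) :
    (ex (S.encrypt n K m) fun c => h c.1.length) = ∑' l, S.lenProb n K m l * h l := by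
  simp only [lenProb, ← ex_mul_right]
  simp only [ex]
  rw [ENNReal.tsum_comm]
  refine tsum_congr fun c => ?_
  rw [ENNReal.tsum_mul_left, tsum_eq_single c.1.length]
  · simp
  · intro l hl
    simp [hl.symm]

theorem lenGap_comm (n : ℕ) (K m m' : List Bool) : S.lenGap n K m m' = S.lenGap n K m' m :=
  tsum_congr fun _ => add_comm _ _

/-- The key is fixed and may be known to the test, as long as the test sees only the length of the
ciphertext. -/
theorem close_length (n : ℕ) (K m m' : List Bool) (h : ℕ → ℝ≥0∞) (hh : ∀ l, h l ≤ 1) :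
    Close (S.lenGap n K m m') (ex (S.encrypt n K m) fun c => h c.1.length)
      (ex (S.encrypt n K m') fun c => h c.1.length) := by
  have key : ∀ m m', (ex (S.encrypt n K m) fun c => h c.1.length) ≤
      (ex (S.encrypt n K m') fun c => h c.1.length) + S.lenGap n K m m' := by
    intro m m'
    rw [ex_encrypt_length, ex_encrypt_length, lenGap, ← ENNReal.tsum_add]
    refine ENNReal.tsum_le_tsum fun l => ?_
    calc S.lenProb n K m l * h l
        ≤ (S.lenProb n K m' l + (S.lenProb n K m l - S.lenProb n K m' l)) * h l := by
          gcongr; exact le_add_tsub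
      _ ≤ S.lenProb n K m' l * h l + (S.lenProb n K m l - S.lenProb n K m' l) * 1 := by
          rw [add_mul]; gcongr; exact hh l
      _ ≤ _ := by rw [mul_one]; gcongr; exact le_self_add
  exact ⟨key m m', S.lenGap_comm n K m m' ▸ key m' m⟩

/-- Inner products of length distributions under a common key are probabilities of an event that a
chosen plaintext attack can observe. The distribution for one particular key is not observable in
this sense. -/
theorem ex_encrypt_collision (n : ℕ) (K m m' : List Bool) :
    (ex (S.encrypt n K m) fun c => ex (S.encrypt n K m') fun d =>
      if c.1.length = d.1.length then (1 : ℝ≥0∞) else 0) =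
      ∑' l, S.lenProb n K m l * S.lenProb n K m' l := by
  rw [← ex_encrypt_length (h := fun l => S.lenProb n K m' l)]
  refine ex_congr _ fun c => ex_congr _ fun d => ?_
  simp [eq_comm]

/-- The gap is at most the squared gap, up to scaling and a small additive error. -/
theorem gap_le {a b η : ℝ≥0∞} (hη : η ≠ 0) (ha : a ≤ 1) (hb : b ≤ 1) :
    (a - b) + (b - a) + η⁻¹ * (a * b + a * b) ≤ η + η⁻¹ * (a * a + b * b) := by
  wlog hab : b ≤ a generalizing a b
  · have := this hb ha (le_of_not_ge hab)
    rw [add_comm (a - b), mul_comm a b, add_comm (a * a)]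
    exact this
  rw [tsub_eq_zero_of_le hab, add_zero]
  obtain ⟨d, rfl⟩ := exists_add_of_le hab
  have hb' : b ≠ ∞ := (hb.trans_lt ENNReal.one_lt_top).ne
  have hd : d ≤ 1 := le_add_self.trans ha
  have hd' : d ≠ ∞ := (hd.trans_lt ENNReal.one_lt_top).ne
  rw [ENNReal.add_sub_cancel_left hb']
  -- Either `d ≤ η`, or `1 ≤ d / η` and so `d ≤ d² / η`. With `a = b + d`, the remaining terms
  -- amount to `a² + b² - 2ab = d²`, written without subtraction.
  have h1 : d ≤ η + η⁻¹ * (d * d) := by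
    rcases le_total d η with h | h
    · exact h.trans le_self_add
    · have hη' : η ≠ ∞ := (h.trans_lt hd'.lt_top).ne
      calc d = η⁻¹ * (d * η) := by
            rw [mul_left_comm, ENNReal.inv_mul_cancel hη hη', mul_one]
        _ ≤ η⁻¹ * (d * d) := by gcongr
        _ ≤ _ := le_add_self
  calc d + η⁻¹ * ((b + d) * b + (b + d) * b)
      ≤ η + η⁻¹ * (d * d) + η⁻¹ * ((b + d) * b + (b + d) * b) := by gcongr
    _ = η + η⁻¹ * ((b + d) * (b + d) + b * b) := by ring

/-- The distribution of the length of a ciphertext hardly depends on the message, even if the key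
is known: otherwise lengths would collide with different probabilities. -/
theorem exists_lenGap_le (hcpa : S.CPASecure) (Q : Polynomial ℕ) : ∃ ε, ENegl ε ∧
    ∀ n (m m' : List Bool), m.length = m'.length → m.length ≤ Q.eval n →
      (ex (bits n) fun K => S.lenGap n K.toList m m') ≤ ε n := by
  obtain ⟨P, hP⟩ := S.exists_support_length_le Q
  -- The test compares the length of the single row with that of the challenge.
  let H : ℕ × Data × List Bool × (Fin 1 → List Bool) × List Bool → Bool := fun x =>
    decide ((x.2.2.2.1 0).length = x.2.2.2.2.length)
  have hH : PolyTime H := by fun_prop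
  have : Inhabited Data := ⟨.leaf⟩
  obtain ⟨ε, ⟨δ, hδ, hδ0, hεδ⟩, h⟩ := S.close_scriptGame 1 H 0 hcpa hH (12 * Q + 100)
  let row : List Bool → Row := fun m => ((false, true, false), m, [], [])
  let ch : List Bool → Row := fun m => ((true, false, false), m, [], [])
  have hgame : ∀ n m m', S.scriptGame 1 H 0 n .leaf (fun _ => row m) (ch m') =
      ex (bits n) fun K => ∑' l, S.lenProb n K.toList m l * S.lenProb n K.toList m' l := by
    intro n m m'
    simp only [scriptGame, ← ex_encrypt_collision, ex_indep_succ, indep_zero, ex_pure, Row.dist,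
      Row.replies, ex_map, ex_bind, Row.out, row, ch, Row.second, H,
      Polynomial.eval_zero, lbits_zero]
    simp
  have hsmall : ∀ n (m m₀ m₁ : List Bool), m.length ≤ Q.eval n → m₀.length = m.length →
      m₁.length = m.length → sz ((fun _ => row m : Fin 1 → Row), ch m₀, m₁, Data.leaf) ≤
        (12 * Q + 100 : Polynomial ℕ).eval n := by
    intro n m m₀ m₁ h1 h2 h3
    have e3 := sz_bits_le m₁
    have e4 : sz (fun _ => row m : Fin 1 → Row) ≤ 1 * (4 * m.length + 20 + 1) + 1 :=
      sz_pi_le fun i => (sz_row_le _).trans (by simp [row])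
    have e5 : sz (ch m₀) ≤ 4 * m₀.length + 20 := (sz_row_le _).trans (by simp [ch])
    have e6 : sz Data.leaf = 1 := rfl
    simp only [Polynomial.eval_add, Polynomial.eval_mul, Polynomial.eval_ofNat, sz_pair]
    omega
  -- The scale `√δ` balances the two errors, since `δ / √δ = √δ`. The summand `2 ^ (-n)` keeps `η`
  -- invertible where `δ` vanishes.
  let η : ℕ → ℝ := fun n => Real.sqrt (δ n) + (1 / 2) ^ n
  refine ⟨fun n => ((P + 1).eval n : ℕ) * ENNReal.ofReal (η n) + 2 * ENNReal.ofReal (Real.sqrt (δ n)),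
    ?_, ?_⟩
  · have := (ENegl.ofReal hδ.sqrt).const_mul 2
    push_cast at this
    exact ((ENegl.ofReal (hδ.sqrt.add Negligible.two_pow)).poly_mul _).add this
  · intro n m m' hm hQ
    have h1 := h n .leaf (fun _ => row m) (ch m) m' (hsmall n m m m' hQ rfl hm.symm) rfl hm.symm
    have h2 := h n .leaf (fun _ => row m') (ch m') m (hsmall n m' m' m (hm ▸ hQ) rfl hm) rfl hm
    have e1 : ((ch m).1, m', (ch m).2.2) = ch m' := rfl
    have e2 : ((ch m').1, m, (ch m').2.2) = ch m := rfl
    rw [e1, hgame, hgame] at h1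
    rw [e2, hgame, hgame] at h2
    have hη : ENNReal.ofReal (η n) ≠ 0 := by
      have : 0 < η n := by positivity
      simpa using this
    have hz : ∀ K : List Bool, K.length = n → ∀ l, l ∉ Finset.range (P.eval n + 1) →
        S.lenProb n K m l = 0 ∧ S.lenProb n K m' l = 0 := by
      intro K hK l hl
      have key : ∀ m : List Bool, m.length ≤ Q.eval n → S.lenProb n K m l = 0 := by
        intro m hm
        refine le_antisymm (ex_le_of_support _ fun c hc => ?_) bot_le
        rw [if_neg]
        rintro rfl
        exact hl (Finset.mem_range.2 (Nat.lt_succ_of_le (hP n K m hK.le hm c hc).1))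
      exact ⟨key m hQ, key m' (hm ▸ hQ)⟩
    set X := ENNReal.ofReal (η n) with hX
    set AA := ex (bits n) fun K => ∑' l, S.lenProb n K.toList m l * S.lenProb n K.toList m l
    set AB := ex (bits n) fun K => ∑' l, S.lenProb n K.toList m l * S.lenProb n K.toList m' l
    set BB := ex (bits n) fun K => ∑' l, S.lenProb n K.toList m' l * S.lenProb n K.toList m' l
    have hAB' : (ex (bits n) fun K => ∑' l, S.lenProb n K.toList m' l * S.lenProb n K.toList m l) =
        AB := by
      simp only [mul_comm]; rfl
    rw [hAB'] at h2
    -- `gap_le` is summed over the at most `P.eval n + 1` lengths that occur and averaged over the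
    -- key. Below, CPA security shows that `AA` and `BB` exceed `AB` by at most `δ`.
    have key : (ex (bits n) fun K => S.lenGap n K.toList m m') + X⁻¹ * (AB + AB) ≤
        ((P + 1).eval n : ℕ) * X + X⁻¹ * (AA + BB) := by
      rw [← ex_add, ← ex_add, ← ex_mul_left, ← ex_mul_left, ← ex_add]
      rw [← ex_const (bits n) (((P + 1).eval n : ℕ) * X), ← ex_add]
      refine ex_mono _ fun K => ?_
      have hz' := hz K.toList K.toList_length
      rw [lenGap, tsum_eq_sum (s := Finset.range (P.eval n + 1)) fun l hl => by
          simp [(hz' l hl).1, (hz' l hl).2],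
        tsum_eq_sum (s := Finset.range (P.eval n + 1)) fun l hl => by simp [(hz' l hl).1],
        tsum_eq_sum (s := Finset.range (P.eval n + 1)) fun l hl => by simp [(hz' l hl).1],
        tsum_eq_sum (s := Finset.range (P.eval n + 1)) fun l hl => by simp [(hz' l hl).2]]
      rw [← Finset.sum_add_distrib, ← Finset.sum_add_distrib, Finset.mul_sum, Finset.mul_sum,
        ← Finset.sum_add_distrib]
      refine (Finset.sum_le_sum fun l _ =>
        gap_le hη (S.lenProb_le_one n K.toList m l) (S.lenProb_le_one n K.toList m' l)).trans ?_
      rw [Finset.sum_add_distrib]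
      simp
    -- The mixed term is finite and can be cancelled from both sides.
    have hfin : X⁻¹ * (AB + AB) ≠ ∞ := by
      have hAB : AB ≤ 1 := by
        refine ex_le_one _ fun K => ?_
        rw [← ex_encrypt_collision]
        exact ex_le_one _ fun _ => ex_le_one _ fun _ => by split_ifs <;> simp
      have := (hAB.trans_lt ENNReal.one_lt_top).ne
      exact ENNReal.mul_ne_top (ENNReal.inv_ne_top.2 hη) (ENNReal.add_ne_top.2 ⟨this, this⟩)
    have hX1 : X⁻¹ * ENNReal.ofReal (δ n) ≤ ENNReal.ofReal (Real.sqrt (δ n)) := by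
      calc X⁻¹ * ENNReal.ofReal (δ n)
          = X⁻¹ * (ENNReal.ofReal (Real.sqrt (δ n)) * ENNReal.ofReal (Real.sqrt (δ n))) := by
            rw [← ENNReal.ofReal_mul (by positivity), Real.mul_self_sqrt (hδ0 n)]
        _ ≤ X⁻¹ * (X * ENNReal.ofReal (Real.sqrt (δ n))) := by
            gcongr
            exact ENNReal.ofReal_le_ofReal (le_add_of_nonneg_right (by positivity))
        _ = _ := by
            rw [← mul_assoc, ENNReal.inv_mul_cancel hη ENNReal.ofReal_ne_top, one_mul]
    refine (ENNReal.add_le_add_iff_right hfin).1 (key.trans ?_)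
    calc ((P + 1).eval n : ℕ) * X + X⁻¹ * (AA + BB)
        ≤ ((P + 1).eval n : ℕ) * X + X⁻¹ * ((AB + ENNReal.ofReal (δ n)) +
          (AB + ENNReal.ofReal (δ n))) := by
          gcongr
          · exact h1.1.trans (by gcongr; exact hεδ n)
          · exact h2.1.trans (by gcongr; exact hεδ n)
      _ = ((P + 1).eval n : ℕ) * X + 2 * (X⁻¹ * ENNReal.ofReal (δ n)) + X⁻¹ * (AB + AB) := by ring
      _ ≤ _ := by
        dsimp only
        rw [← hX]
        gcongr

end EncScheme

end PPM

namespace PPM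

open Code (code)
open scoped ENNReal

/-! ### Wires and labels -/

/-- Wires as elements of a sum type. -/
def Src.equivSum (m s g : ℕ) : Src m s g ≃ Fin m ⊕ Fin s ⊕ Fin g where
  toFun
    | .mon i => .inl i
    | .sys i => .inr (.inl i)
    | .gate i => .inr (.inr i)
  invFun
    | .inl i => .mon i
    | .inr (.inl i) => .sys i
    | .inr (.inr i) => .gate i
  left_inv x := by cases x <;> rfl
  right_inv x := by rcases x with _ | _ | _ <;> rfl

instance (m s g : ℕ) : Fintype (Src m s g) := .ofEquiv _ (Src.equivSum m s g).symm

instance (m s g : ℕ) : DecidableEq (Src m s g) := (Src.equivSum m s g).decidableEq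

/-- Families indexed by wires as triples of families. -/
def Src.arrowEquiv (m s g : ℕ) (X : Type) :
    ((Fin m → X) × (Fin s → X) × (Fin g → X)) ≃ (Src m s g → X) where
  toFun x := Src.val x.1 x.2.1 x.2.2
  invFun f := (fun i => f (.mon i), fun i => f (.sys i), fun i => f (.gate i))
  left_inv x := rfl
  right_inv f := by ext w; cases w <;> rfl

theorem ex_unif_wires {m s g : ℕ} {X : Type} [Fintype X] [Nonempty X]
    (φ : (Src m s g → X) → ℝ≥0∞) :
    ex (unif (Src m s g → X)) φ = ex (unif (Fin m → X)) fun a => ex (unif (Fin s → X)) fun b =>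
      ex (unif (Fin g → X)) fun c => φ (Src.val a b c) := by
  rw [ex_unif_equiv (Src.arrowEquiv m s g X), ex_unif_prod]
  simp only [ex_unif_prod]
  rfl

theorem ex_unif_curry {ι : Type} [Fintype ι] [DecidableEq ι] {X : Type} [Fintype X] [Nonempty X]
    (φ : (ι → Bool → X) → ℝ≥0∞) :
    ex (unif (ι → Bool → X)) φ = ex (unif (ι × Bool → X)) fun f => φ fun i b => f (i, b) :=
  ex_unif_equiv (Equiv.curry ι Bool X) φ

/-- Restriction of a uniformly random function along an injection. -/
theorem ex_unif_comp_injective {ι κ X : Type} [Fintype ι] [DecidableEq ι] [Fintype κ]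
    [DecidableEq κ] [Fintype X] [Nonempty X] (f : κ → ι) (hf : Function.Injective f)
    (φ : (κ → X) → ℝ≥0∞) :
    (ex (unif (ι → X)) fun g => φ fun i => g (f i)) = ex (unif (κ → X)) φ := by
  classical
  let e := Equiv.piEquivPiSubtypeProd (fun i => i ∈ Set.range f) fun _ => X
  rw [ex_unif_equiv e.symm, ex_unif_prod,
    ex_unif_equiv (Equiv.arrowCongr (Equiv.ofInjective f hf).symm (Equiv.refl X))]
  refine ex_congr _ fun g => ?_
  rw [← ex_const (unif ({i // i ∉ Set.range f} → X)) (φ _)]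
  refine ex_congr _ fun h => ?_
  congr 1
  funext i
  have hi : f i ∈ Set.range f := ⟨i, rfl⟩
  change (if h' : f i ∈ Set.range f then g ⟨f i, h'⟩ else h ⟨f i, h'⟩) = g ⟨f i, hi⟩
  rw [dif_pos hi]

namespace Circuit

variable {m s : ℕ} (C : Circuit m s)

/-- A feed-in wire of a gate as a wire of the circuit with all gates. -/
def lift : Src m s C.g → Src m s (C.g + m + 1)
  | .mon i => .mon i
  | .sys i => .sys i
  | .gate k => .gate (C.inner k)

theorem val_lift {X : Type} (a : Fin m → X) (b : Fin s → X) (c : Fin (C.g + m + 1) → X)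
    (w : Src m s C.g) : (Src.val a b c (C.lift w)) = w.val a b fun k => c (C.inner k) := by
  cases w <;> rfl

theorem lift_ne_gate {j : Fin (C.g + m + 1)} {w : Src m s C.g}
    (hw : ∀ k, w = .gate k → k.val < j.val) : C.lift w ≠ .gate j := by
  cases w with
  | mon i => simp [lift]
  | sys i => simp [lift]
  | gate k =>
    have := hw k rfl
    simp only [lift, inner, ne_eq, Src.gate.injEq, Fin.ext_iff]
    omega

/-- Feed-in wires refer only to the first `C.g` gates. Hence the state and flag output labels of a
round are never keys in that round. -/
theorem lift_ne_gate_of_le {j : Fin (C.g + m + 1)} (w : Src m s C.g) (hj : C.g ≤ j.val) :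
    C.lift w ≠ .gate j :=
  C.lift_ne_gate fun k _ => k.is_lt.trans_le hj

theorem stateGate_injective : Function.Injective C.stateGate := by
  intro i j h
  simpa [stateGate, Fin.ext_iff] using h

end Circuit

/-! ### Garbled gates for arbitrary truth tables -/

namespace OpenSpec

variable {m s : ℕ}

/-- The values of the feed-in wires that belong to the rows of a gate. -/
def rowBits : Fin 4 → Bool × Bool := ![(false, false), (false, true), (true, false), (true, true)]

theorem rowBits_injective : Function.Injective rowBits := by decide

/-- A garbled gate for the binary operation `t`. -/
noncomputable def garble (S : EncScheme) (n : ℕ) (t : Bool → Bool → Bool)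
    (L R W : Bool → Label n) : PMF ((Fin 4 → List Bool) × Data) :=
  (indep fun i => encrypt₂ S n (L (rowBits i).1).toList (R (rowBits i).2).toList
    (W (t (rowBits i).1 (rowBits i).2)).toList).bind fun e =>
  (unif (Equiv.Perm (Fin 4))).map fun p =>
    (fun i => (e (p i)).1, code ((fun i => (e i).2), (fun i => p i)))

/-- The operation of a NAND gate. -/
def nand (a b : Bool) : Bool := !(a && b)

theorem garbleGate_eq (S : EncScheme) (n : ℕ) (L R W : Bool → Label n) :
    garbleGate S n L R W = garble S n nand L R W := by
  refine pmf_ext_ex fun φ => ?_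
  simp only [garbleGate, garble, ex_bind', ex_bind, ex_indep_succ, indep_zero, ex_pure, ex_map]
  refine ex_congr _ fun e0 => ex_congr _ fun e1 => ex_congr _ fun e2 => ex_congr _ fun e3 =>
    ex_congr _ fun p => ?_
  have h : ![e0, e1, e2, e3] = Fin.cons e0 (Fin.cons e1 (Fin.cons e2 (Fin.cons e3 Fin.elim0))) := by
    funext i
    fin_cases i <;> rfl
  rw [h]

/-- The garbled gates of a round, for given labels of all wires. -/
noncomputable def garbleRound (S : EncScheme) (C : Circuit m s) (n : ℕ)
    (t : Fin (C.g + m + 1) → Bool → Bool → Bool) (lab : Src m s (C.g + m + 1) → Bool → Label n) :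
    PMF (Fin (C.g + m + 1) → (Fin 4 → List Bool) × Data) :=
  indep fun j => garble S n (t j) (lab (C.lift (C.left j))) (lab (C.lift (C.right j)))
    (lab (.gate j))

/-- The labels of all wires of a round are collected in one family indexed by wires, on which
renaming and resampling act uniformly. -/
theorem ex_sysRound (S : EncScheme) (C : Circuit m s) (n : ℕ) (cur : Fin m → Bool → Label n)
    (x : Fin s → Bool) (φ : (Fin m → Bool → Label n) × Msg C × Data → ℝ≥0∞) :
    ex (sysRound S C n cur x) φ =
      ex (unif (Fin s → Bool → Label n)) fun sysL =>
      ex (unif (Fin (C.g + m + 1) → Bool → Label n)) fun gateL =>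
      ex (garbleRound S C n (fun _ => nand) (Src.val cur sysL gateL)) fun G =>
        φ (fun i => gateL (C.stateGate i),
          ((fun j => (G j).1), (fun i => (sysL i (x i)).toList),
            ((gateL C.flagGate false).toList, (gateL C.flagGate true).toList)),
          code (sysL, gateL, fun j => (G j).2)) := by
  simp only [sysRound, ex_bind', ex_pure, garbleRound, C.val_lift, garbleGate_eq]
  rfl

theorem mem_support_encrypt₂ {S : EncScheme} {n : ℕ} {l r x : List Bool}
    {e : List Bool × (List Bool × List Bool)} (h : e ∈ (encrypt₂ S n l r x).support) :
    ∃ c ∈ (S.encrypt n r x).support, ∃ d ∈ (S.encrypt n l c.1).support, e = (d.1, (c.2, d.2)) := by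
  simpa only [encrypt₂, monad_bind_eq, monad_pure_eq, PMF.mem_support_bind_iff,
    PMF.mem_support_pure_iff, exists_prop] using h

theorem ex_encrypt₂ (S : EncScheme) (n : ℕ) (l r x : List Bool)
    (φ : List Bool × (List Bool × List Bool) → ℝ≥0∞) :
    ex (encrypt₂ S n l r x) φ = ex (S.encrypt n r x) fun c => ex (S.encrypt n l c.1) fun d =>
      φ (d.1, (c.2, d.2)) := by
  simp only [encrypt₂, ex_bind', ex_pure]

end OpenSpec

end PPM

/-! ### Rejection of ciphertexts by wrong keys -/

namespace PPM

open Code (code)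
open Decode (decode decode_code)
open scoped ENNReal

theorem PolyTime.replicate {α β : Type} [Code α] [Code β] {f : α → ℕ} (hf : PolyTime f) (b : β) :
    PolyTime fun a => List.replicate (f a) b := by
  have h := (PolyTime.replicate_unit.2 hf).map (f := fun _ _ => b) (.const b)
  simpa using h

/-- A uniform guess hits `l` with probability `1 / (q + 1)`. -/
theorem le_mul_ex_unif_fin (q : ℕ) (f : ℕ → ℝ≥0∞) {l : ℕ} (hl : l ≤ q) :
    f l ≤ ((q + 1 : ℕ) : ℝ≥0∞) * ex (unif (Fin (q + 1))) fun i => f i := by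
  rw [ex_unif, ← Finset.mul_sum, ← mul_assoc, Fintype.card_fin,
    ENNReal.mul_inv_cancel (by simp) (by simp), one_mul]
  exact Finset.single_le_sum (f := fun i : Fin (q + 1) => f i) (fun _ _ => zero_le)
    (Finset.mem_univ ⟨l, Nat.lt_succ_of_le hl⟩)

namespace EncScheme

variable (S : EncScheme)

/-- Indicator of the acceptance of a string by decryption. -/
noncomputable def acc (n : ℕ) (k c : List Bool) : ℝ≥0∞ := if (S.dec n k c).isSome then 1 else 0

theorem acc_le_one (n : ℕ) (k c : List Bool) : S.acc n k c ≤ 1 := by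
  unfold acc; split_ifs <;> simp

/-- Elusiveness speaks of machines; it extends to distributions that are sampled up to a negligible
statistical error. -/
theorem eNegl_of_samp (hel : S.ElusiveRange) {X : ℕ → Unit → PMF (List Bool)}
    (hX : Samp (fun _ _ => True) X) :
    ENegl fun n => ex (bits n) fun k => ex (X n ()) fun c => S.acc n k.toList c := by
  obtain ⟨f, c, ε, hf, hε, h⟩ := hX
  let A : PPT Unit (List Bool) := ⟨f, hf, c⟩
  have h1 : ENegl fun n => ex (bits n) fun k => ex (A.dist n ()) fun c => S.acc n k.toList c := by
    refine (ENegl.ofReal (hel A)).mono fun n => le_of_eq ?_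
    rw [prTrue, ENNReal.ofReal_toReal (PMF.apply_ne_top _ _), apply_eq_ex]
    simp only [ex_bind', ex_pure, acc]
  refine (h1.add hε).mono fun n => ?_
  have h2 : ∀ k : List.Vector Bool n, Close (ε n) (ex (A.dist n ()) fun c => S.acc n k.toList c)
      (ex (X n ()) fun c => S.acc n k.toList c) := by
    intro k
    convert h n () trivial (fun c => S.acc n k.toList c) fun c => S.acc_le_one _ _ _ using 1
    simp [A, PPT.dist, ex_lbits]
  exact (Close.ex (bits n) fun k _ => h2 k).2

/-- A ciphertext under a fresh key of a double encryption under the same key is rejected. -/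
theorem eNegl_acc_twice (hel : S.ElusiveRange) :
    ENegl fun n => ex (bits n) fun k => ex (bits n) fun K => ex (bits n) fun W =>
      ex (S.encrypt n K.toList W.toList) fun c => ex (S.encrypt n K.toList c.1) fun d =>
        S.acc n k.toList d.1 := by
  obtain ⟨Q, hQ⟩ := S.exists_support_length_le .X
  have h1 : Samp (fun _ (_ : Unit) => True) fun n _ => lbits ((.X : Polynomial ℕ).eval n) :=
    Samp.lbits _
  have h2 : Samp (fun n (y : Unit × List Bool) => y.2.length = n) fun n _ =>
    lbits ((.X : Polynomial ℕ).eval n) := Samp.lbits _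
  have h3 : Samp (fun n (y : (Unit × List Bool) × List Bool) => y.1.2.length = n ∧ y.2.length = n)
      fun n y => S.encrypt n y.1.2 y.2 :=
    (S.samp_encrypt .X).comp (g := fun z : ℕ × (Unit × List Bool) × List Bool => (z.2.1.2, z.2.2))
      (by fun_prop) (by rintro n ⟨⟨u, K⟩, W⟩ ⟨_, h⟩; simp_all)
  have h4 : Samp (fun n (y : ((Unit × List Bool) × List Bool) × List Bool × List Bool) =>
      y.2.1.length ≤ Q.eval n) fun n y => (S.encrypt n y.1.1.2 y.2.1).map Prod.fst :=
    ((S.samp_encrypt Q).comp (g := fun z : ℕ × ((Unit × List Bool) × List Bool) ×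
      List Bool × List Bool => (z.2.1.1.2, z.2.2.1)) (by fun_prop) (by
        rintro n ⟨⟨⟨u, K⟩, W⟩, c⟩ h; simpa using h)).map (f := fun x => x.2.2.1) (by fun_prop)
  have h5 := h1.bind (h2.bind (h3.bind h4 (by
    rintro n ⟨⟨u, K⟩, W⟩ ⟨e1, e2⟩ c hc
    exact (hQ n K W (le_of_eq e1) (by simpa using le_of_eq e2) c hc).1))
    (by
      rintro n ⟨u, K⟩ h W hW
      exact ⟨h, by simpa using length_of_mem_lbits hW⟩))
    (by rintro n u - K hK; simpa using length_of_mem_lbits hK)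
  refine (S.eNegl_of_samp hel h5).mono fun n => le_of_eq ?_
  simp only [ex_bind, ex_lbits, ex_map, Polynomial.eval_X]

/-- Ciphertexts of messages of bounded random length. -/
theorem eNegl_acc_zeros (hel : S.ElusiveRange) (Q : Polynomial ℕ) :
    ENegl fun n => ex (bits n) fun k => ex (unif (Fin (Q.eval n + 1))) fun l =>
      ex (bits n) fun K => ex (S.encrypt n K.toList (List.replicate l false)) fun c =>
        S.acc n k.toList c.1 := by
  have h1 : Samp (fun _ (_ : Unit) => True) fun n _ =>
    (unif (Fin (Q.eval n + 1))).map fun i => i.val := Samp.fin Q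
  have h2 : Samp (fun n (y : Unit × ℕ) => y.2 ≤ Q.eval n) fun n _ =>
    lbits ((.X : Polynomial ℕ).eval n) := Samp.lbits _
  have h3 : Samp (fun n (y : (Unit × ℕ) × List Bool) => y.1.2 ≤ Q.eval n)
      fun n y => (S.encrypt n y.2 (List.replicate y.1.2 false)).map Prod.fst :=
    ((S.samp_encrypt Q).comp (g := fun z : ℕ × (Unit × ℕ) × List Bool =>
      (z.2.2, List.replicate z.2.1.2 false)) (.prodMk (by fun_prop) (.replicate (by fun_prop) _))
      (by rintro n ⟨⟨u, l⟩, W⟩ h; simpa using h)).map (f := fun x => x.2.2.1) (by fun_prop)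
  have h5 := h1.bind (h2.bind h3 (by rintro n ⟨u, l⟩ h K _; exact h)) (by
    rintro n u - l hl
    rw [PMF.mem_support_map_iff] at hl
    obtain ⟨i, -, rfl⟩ := hl
    exact i.is_le)
  refine (S.eNegl_of_samp hel h5).mono fun n => le_of_eq ?_
  simp only [ex_bind, ex_lbits, ex_map, Polynomial.eval_X]

/-- A ciphertext under a fresh key is rejected by another key, also if the message depends on the
latter. -/
theorem exists_acc_le (hcpa : S.CPASecure) (hel : S.ElusiveRange) (Q : Polynomial ℕ) :
    ∃ ε, ENegl ε ∧ ∀ n (Y : List.Vector Bool n → PMF (List Bool)),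
      (∀ k, ∀ y ∈ (Y k).support, y.length ≤ Q.eval n) →
      (ex (bits n) fun k => ex (Y k) fun y => ex (bits n) fun K => ex (S.encrypt n K.toList y) fun c =>
        S.acc n k.toList c.1) ≤ ε n := by
  let H : ℕ × List Bool × List Bool × (Fin 0 → List Bool) × List Bool → Bool := fun x =>
    (S.dec x.1 x.2.1 x.2.2.2.2).isSome
  have hH : PolyTime H := PolyTime.isSome (S.dec_polyTime' (by fun_prop) (by fun_prop) (by fun_prop))
  obtain ⟨ε, hε, h⟩ := S.close_scriptGame 0 H 0 hcpa hH (8 * Q + 4 * .X + 100)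
  refine ⟨fun n => ((Q + 1).eval n : ℕ) * (ex (bits n) fun k => ex (unif (Fin (Q.eval n + 1))) fun l =>
      ex (bits n) fun K => ex (S.encrypt n K.toList (List.replicate l false)) fun c =>
        S.acc n k.toList c.1) + ε n, ((S.eNegl_acc_zeros hel Q).poly_mul _).add hε, fun n Y hY => ?_⟩
  have hgame : ∀ (k : List.Vector Bool n) y,
      S.scriptGame 0 H 0 n k.toList (fun i => i.elim0) ((true, false, false), y, [], []) =
      ex (bits n) fun K => ex (S.encrypt n K.toList y) fun c => S.acc n k.toList c.1 := by
    intro k y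
    simp only [scriptGame, Row.dist, Row.replies, Row.out, Row.second, lbits_zero, ex_bind, ex_map,
      Polynomial.eval_zero, indep_zero, ex_pure, Bool.false_eq_true, if_false, if_true]
    refine ex_congr _ fun K => ex_congr _ fun c => ?_
    rw [← ex_const (S.encrypt n K.toList c.1) (S.acc n k.toList c.1)]
    rfl
  -- CPA security for the key `K`: the test key `k` is auxiliary input of the test, so the plaintext
  -- may depend on it arbitrarily.
  have h1 : ∀ (k : List.Vector Bool n), ∀ y ∈ (Y k).support,
      (ex (bits n) fun K => ex (S.encrypt n K.toList y) fun c => S.acc n k.toList c.1) ≤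
      (ex (bits n) fun K => ex (S.encrypt n K.toList (List.replicate y.length false)) fun c =>
        S.acc n k.toList c.1) + ε n := by
    intro k y hy
    have hq := hY k y hy
    have h2 := h n k.toList (fun i => i.elim0) ((true, false, false), y, [], [])
      (List.replicate y.length false) (by
        have e1 := sz_row_le ((true, false, false), y, [], [])
        have e2 := sz_bits_le (List.replicate y.length false)
        have e3 := sz_bits_le k.toList
        have e4 : sz (fun i => i.elim0 : Fin 0 → Row) = 1 := rfl
        simp only [List.length_replicate, List.Vector.toList_length, List.length_nil] at e1 e2 e3
        simp only [Polynomial.eval_add, Polynomial.eval_mul, Polynomial.eval_ofNat,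
          Polynomial.eval_X]
        rw [sz_pair, e4]
        simp only [sz_pair (α := Row), sz_pair (α := List Bool) (β := List Bool) (List.replicate _ _)]
        omega) rfl (by simp)
    rw [hgame, hgame] at h2
    exact h2.1
  dsimp only
  rw [← ex_mul_left, ← ex_const (bits n) (ε n), ← ex_add]
  refine ex_mono _ fun k => ex_le_of_support _ fun y hy => (h1 k y hy).trans ?_
  refine add_le_add ?_ le_rfl
  -- The length of the plaintext may still depend on `k`. It is guessed, after which the ciphertext
  -- is independent of `k` and elusiveness applies.
  have hl := le_mul_ex_unif_fin (Q.eval n) (fun l => ex (bits n) fun K =>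
    ex (S.encrypt n K.toList (List.replicate l false)) fun c => S.acc n k.toList c.1) (hY k y hy)
  simpa only [Polynomial.eval_add, Polynomial.eval_one] using hl

end EncScheme

namespace OpenSpec

variable {m s : ℕ} (S : EncScheme)

/-- Indicator of the acceptance of a string by decryption under two keys. -/
noncomputable def acc₂ (n : ℕ) (l r c : List Bool) : ℝ≥0∞ :=
  if ((S.dec n l c).bind (S.dec n r)).isSome then 1 else 0

theorem acc₂_le (n : ℕ) (l r c : List Bool) : acc₂ S n l r c ≤ S.acc n l c := by
  unfold acc₂ EncScheme.acc
  cases S.dec n l c <;> simp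
  split_ifs <;> simp

theorem openGate_eq {n : ℕ} {e : Fin 4 → List Bool} {l r x : List Bool} (i₀ : Fin 4)
    (h₀ : (S.dec n l (e i₀)).bind (S.dec n r) = some x)
    (h : ∀ i, i ≠ i₀ → (S.dec n l (e i)).bind (S.dec n r) = none) :
    openGate S n e l r = some x := by
  have h1 : (List.ofFn e).filterMap (fun c => (S.dec n l c).bind (S.dec n r)) = [x] := by
    fin_cases i₀ <;>
    · have a0 := h 0
      have a1 := h 1
      have a2 := h 2
      have a3 := h 3
      simp at h₀ a0 a1 a2 a3
      simp [List.ofFn_succ, *]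
  rw [openGate, h1]

theorem ex_unif_label (n : ℕ) (φ : Label n → ℝ≥0∞) : ex (unif (Label n)) φ = ex (bits n) φ := rfl

theorem dec_dec_of_mem_support {n : ℕ} {l r x : List Bool} {e : List Bool × (List Bool × List Bool)}
    (h : e ∈ (encrypt₂ S n l r x).support) (hl : l.length = n) (hr : r.length = n) :
    (S.dec n l e.1).bind (S.dec n r) = some x := by
  obtain ⟨c, hc, d, hd, rfl⟩ := mem_support_encrypt₂ h
  rw [S.dec_of_mem_support hd hl, Option.bind_some, S.dec_of_mem_support hc hr]

/-- A row of a garbled gate is rejected if one of the two labels is wrong. -/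
theorem exists_acc₂_le (hcpa : S.CPASecure) (hel : S.ElusiveRange) : ∃ ε, ENegl ε ∧
    ∀ {ι : Type} [Fintype ι] [DecidableEq ι] (n : ℕ) (u v o : ι) (_ : u ≠ o) (_ : v ≠ o)
      (a b α β w : Bool), (α, β) ≠ (a, b) →
      (ex (unif (ι → Bool → Label n)) fun lab =>
        ex (encrypt₂ S n (lab u α).toList (lab v β).toList (lab o w).toList) fun c =>
          acc₂ S n (lab u a).toList (lab v b).toList c.1) ≤ ε n := by
  obtain ⟨Q, hQ⟩ := S.exists_support_length_le .X
  obtain ⟨ε₁, hε₁, h₁⟩ := S.exists_acc_le hcpa hel Q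
  obtain ⟨ε₂, hε₂, h₂⟩ := S.exists_acc_le hcpa hel .X
  have hε₃ := S.eNegl_acc_twice hel
  refine ⟨_, (hε₁.add hε₂).add hε₃, ?_⟩
  intro ι _ _ n u v o huo hvo a b α β w hne
  rw [ex_unif_curry]
  by_cases hα : α = a
  -- The outer key is right, so the outer layer is removed without loss. The inner ciphertext is
  -- under a wrong key, and its plaintext is a label of a third kind, independent of both keys.
  · subst hα
    have hβ : β ≠ b := fun h => hne (by rw [h])
    refine le_trans ?_ (le_self_add.trans' le_add_self)
    rw [ex_unif_update (v, β), ex_unif_update (v, b)]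
    refine ex_le_of_support _ fun f _ => ?_
    refine le_trans ?_ (h₂ n (fun _ => PMF.pure (f (o, w)).toList) (by simp))
    refine ex_mono _ fun k => ?_
    rw [ex_pmf_pure]
    refine ex_mono _ fun K => ?_
    have e1 : ((o, w) : ι × Bool) ≠ (v, β) := fun h => hvo (by simp_all)
    have e2 : ((o, w) : ι × Bool) ≠ (v, b) := fun h => hvo (by simp_all)
    have e3 : ((v, b) : ι × Bool) ≠ (v, β) := fun h => hβ (by simp_all)
    rw [ex_encrypt₂]
    simp only [Function.update_self, Function.update_of_ne e1, Function.update_of_ne e2,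
      Function.update_of_ne e3]
    refine ex_mono _ fun c => ex_le_of_support _ fun d hd => ?_
    rw [acc₂, S.dec_of_mem_support hd (by simp), Option.bind_some, EncScheme.acc]
  -- The outer key is wrong: rejection of the outer layer suffices.
  · have e0 : ((u, a) : ι × Bool) ≠ (u, α) := fun h => hα (by simp_all)
    have e1 : ((o, w) : ι × Bool) ≠ (u, α) := fun h => huo (by simp_all)
    have e2 : ((o, w) : ι × Bool) ≠ (u, a) := fun h => huo (by simp_all)
    rw [ex_unif_update (u, α), ex_unif_update (u, a)]
    by_cases huv : ((v, β) : ι × Bool) = (u, α)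
    -- Both layers use the same label, so the outer plaintext depends on the encryption key and the
    -- previous replacement is not available. The accepting key is independent of the whole
    -- ciphertext, and elusiveness alone is enough.
    · refine le_trans ?_ le_add_self
      rw [ex_unif_update (o, w)]
      refine ex_le_of_support _ fun f _ => ?_
      rw [ex_comm]
      refine ex_mono _ fun k => ?_
      rw [ex_comm]
      refine ex_mono _ fun K => ex_mono _ fun W => ?_
      simp only [ex_encrypt₂, huv, Function.update_self, Function.update_of_ne e0,
        Function.update_of_ne e1, Function.update_of_ne e2]
      exact ex_mono _ fun c => ex_mono _ fun d => acc₂_le S _ _ _ _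
    -- The outer key is fresh. The inner key may coincide with the accepting key, which is why
    -- `exists_acc_le` admits plaintexts that depend on it.
    · refine le_trans ?_ (le_self_add.trans' le_self_add)
      refine ex_le_of_support _ fun f _ => ?_
      refine le_trans ?_ (h₁ n (fun k => (S.encrypt n
        (Function.update f (u, a) k (v, β)).toList (f (o, w)).toList).map Prod.fst) ?_)
      · refine ex_mono _ fun k => ?_
        rw [ex_map, ex_comm]
        refine ex_mono _ fun K => ?_
        simp only [ex_encrypt₂, Function.update_self, Function.update_of_ne e0,
          Function.update_of_ne e1, Function.update_of_ne e2, Function.update_of_ne huv]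
        exact ex_mono _ fun c => ex_mono _ fun d => acc₂_le S _ _ _ _
      · intro k y hy
        rw [PMF.mem_support_map_iff] at hy
        obtain ⟨c, hc, rfl⟩ := hy
        exact (hQ n _ _ (by simp) (by simp) c hc).1

theorem exists_rowBits (a b : Bool) : ∃ i, rowBits i = (a, b) := by
  revert a b; decide

/-- Opening a garbled gate with two of its labels yields the right label, except with negligible
probability. -/
theorem exists_openGate_le (hcpa : S.CPASecure) (hel : S.ElusiveRange) : ∃ ε, ENegl ε ∧
    ∀ {ι : Type} [Fintype ι] [DecidableEq ι] (n : ℕ) (u v o : ι) (_ : u ≠ o) (_ : v ≠ o)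
      (t : Bool → Bool → Bool) (a b : Bool),
      (ex (unif (ι → Bool → Label n)) fun lab => ex (garble S n t (lab u) (lab v) (lab o)) fun G =>
        if openGate S n G.1 (lab u a).toList (lab v b).toList = some (lab o (t a b)).toList
          then 0 else 1) ≤ ε n := by
  obtain ⟨ε, hε, h⟩ := exists_acc₂_le S hcpa hel
  -- Only three rows can be wrongly accepted; their number is bounded crudely by four.
  refine ⟨_, hε.const_mul 4, ?_⟩
  intro ι _ _ n u v o huo hvo t a b
  obtain ⟨i₀, hi₀⟩ := exists_rowBits a b
  have key : ∀ lab : ι → Bool → Label n, (ex (garble S n t (lab u) (lab v) (lab o)) fun G =>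
        if openGate S n G.1 (lab u a).toList (lab v b).toList = some (lab o (t a b)).toList
          then 0 else 1) ≤ ∑ i ∈ Finset.univ.filter (· ≠ i₀),
        ex (encrypt₂ S n (lab u (rowBits i).1).toList (lab v (rowBits i).2).toList
          (lab o (t (rowBits i).1 (rowBits i).2)).toList) fun c =>
          acc₂ S n (lab u a).toList (lab v b).toList c.1 := by
    intro lab
    have e : ∀ i, (ex (encrypt₂ S n (lab u (rowBits i).1).toList (lab v (rowBits i).2).toList
          (lab o (t (rowBits i).1 (rowBits i).2)).toList) fun c =>
          acc₂ S n (lab u a).toList (lab v b).toList c.1) =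
        ex (indep fun i => encrypt₂ S n (lab u (rowBits i).1).toList (lab v (rowBits i).2).toList
          (lab o (t (rowBits i).1 (rowBits i).2)).toList) fun e =>
          acc₂ S n (lab u a).toList (lab v b).toList (e i).1 := fun i =>
      (ex_indep_apply (fun i => encrypt₂ S n (lab u (rowBits i).1).toList
          (lab v (rowBits i).2).toList (lab o (t (rowBits i).1 (rowBits i).2)).toList) i
        fun c => acc₂ S n (lab u a).toList (lab v b).toList c.1).symm
    simp only [e]
    rw [← ex_finset_sum, garble, ex_bind]
    refine ex_mono_support _ fun e he => ?_
    rw [mem_support_indep] at he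
    rw [ex_map]
    refine ex_le_of_support _ fun p _ => ?_
    by_cases hrej : ∀ i, i ≠ i₀ →
        ((S.dec n (lab u a).toList (e i).1).bind (S.dec n (lab v b).toList)) = none
    · rw [if_pos]
      · exact zero_le
      -- The right row `i₀` stands at position `p.symm i₀` of the shuffled gate.
      · refine openGate_eq S (p.symm i₀) ?_ fun i hi => ?_
        · have := he i₀
          rw [hi₀] at this
          simpa using dec_dec_of_mem_support S this (by simp) (by simp)
        · exact hrej _ fun h => hi (by rw [← h, Equiv.symm_apply_apply])
    · push Not at hrej
      obtain ⟨i, hi, hr⟩ := hrej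
      refine le_trans ?_ (Finset.single_le_sum (fun _ _ => zero_le)
        (Finset.mem_filter.2 ⟨Finset.mem_univ i, hi⟩))
      rw [acc₂, if_pos (Option.isSome_iff_ne_none.2 hr)]
      split_ifs <;> simp
  refine (ex_mono _ key).trans ?_
  rw [ex_finset_sum]
  refine (Finset.sum_le_card_nsmul _ _ (ε n) fun i hi => ?_).trans ?_
  · exact h n u v o huo hvo a b _ _ _ fun he => (Finset.mem_filter.1 hi).2
      (rowBits_injective (he.trans hi₀.symm))
  · rw [nsmul_eq_mul]
    gcongr
    exact (Finset.card_le_univ _).trans (by simp)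

end OpenSpec

end PPM

/-! ### Correctness of the protocol -/

namespace PPM

open Code (code)
open Decode (decode decode_code)
open scoped ENNReal

namespace OpenSpec

variable {m s : ℕ} (S : EncScheme) (C : Circuit m s)

/-- The value of a wire of the circuit with all gates. -/
def wireBit (μ : Fin m → Bool) (x : Fin s → Bool) : Src m s (C.g + m + 1) → Bool :=
  Src.val μ x (C.eval μ x)

theorem eval_eq (μ : Fin m → Bool) (x : Fin s → Bool) (j : Fin (C.g + m + 1)) :
    C.eval μ x j = nand (wireBit C μ x (C.lift (C.left j))) (wireBit C μ x (C.lift (C.right j))) := by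
  rw [wireBit, C.val_lift, C.val_lift, Circuit.eval, C.run_eq]
  rfl

/-- If all gates open correctly, then the monitor obtains the labels of the values. -/
theorem monRound_eq {n : ℕ} {lab : Src m s (C.g + m + 1) → Bool → Label n} {μ : Fin m → Bool}
    {x : Fin s → Bool} {G : Fin (C.g + m + 1) → Fin 4 → List Bool}
    (hG : ∀ j, openGate S n (G j)
      (lab (C.lift (C.left j)) (wireBit C μ x (C.lift (C.left j)))).toList
      (lab (C.lift (C.right j)) (wireBit C μ x (C.lift (C.right j)))).toList =
        some (lab (.gate j) (C.eval μ x j)).toList)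
    (hF : lab (.gate C.flagGate) true ≠ lab (.gate C.flagGate) false) :
    monRound S C n (fun i => some (lab (.mon i) (μ i)).toList)
      (G, fun i => (lab (.sys i) (x i)).toList,
        (lab (.gate C.flagGate) false).toList, (lab (.gate C.flagGate) true).toList) =
      (fun i => some (lab (.gate (C.stateGate i)) (C.nextState μ x i)).toList,
        some (C.flag μ x)) := by
  have key : ∀ N, ∀ j : Fin (C.g + m + 1), j.val < N →
      C.run (fun i => some (lab (.mon i) (μ i)).toList)
        (fun i => some (lab (.sys i) (x i)).toList) (fun j l r =>
          l.bind fun l => r.bind fun r => openGate S n (G j) l r) j =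
        some (lab (.gate j) (C.eval μ x j)).toList := by
    intro N
    induction N with
    | zero => intro j hj; omega
    | succ N ih =>
      intro j hj
      have hw : ∀ w : Src m s C.g, (∀ k, w = .gate k → k.val < j.val) →
          (w.val (fun i => some (lab (.mon i) (μ i)).toList)
            (fun i => some (lab (.sys i) (x i)).toList) fun k =>
              C.run (fun i => some (lab (.mon i) (μ i)).toList)
                (fun i => some (lab (.sys i) (x i)).toList) (fun j l r =>
                l.bind fun l => r.bind fun r => openGate S n (G j) l r) (C.inner k)) =
          some (lab (C.lift w) (wireBit C μ x (C.lift w))).toList := by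
        intro w hw
        cases w with
        | mon i => rfl
        | sys i => rfl
        | gate k =>
          have := hw k rfl
          exact ih (C.inner k) (by simp only [Circuit.inner]; omega)
      rw [C.run_eq, hw _ (C.left_lt j), hw _ (C.right_lt j)]
      exact hG j
  have key' := fun j => key _ j (Nat.lt_succ_self _)
  have hne : (lab (.gate C.flagGate) true).toList ≠ (lab (.gate C.flagGate) false).toList :=
    fun h => hF (List.Vector.toList_injective h)
  simp only [monRound, key', Circuit.nextState, Circuit.flag, Option.some.injEq]
  congr 1
  cases C.eval μ x C.flagGate <;> simp [hne]

/-- Indicator that a round of the monitor fails. -/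
noncomputable def roundFails (n : ℕ) (cur : Fin m → Bool → Label n) (μ : Fin m → Bool)
    (x : Fin s → Bool) (a : (Fin m → Bool → Label n) × Msg C × Data) : ℝ≥0∞ :=
  if monRound S C n (fun i => some (cur i (μ i)).toList) a.2.1 =
    (fun i => some (a.1 i (C.nextState μ x i)).toList, some (C.flag μ x)) then 0 else 1

theorem ex_bits_eq_le {n : ℕ} (c : Label n) :
    (ex (bits n) fun k => if k = c then 1 else 0) ≤ (2⁻¹ : ℝ≥0∞) ^ n := by
  rw [bits, ← apply_eq_ex, PMF.uniformOfFintype_apply, card_vector, Fintype.card_bool]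
  simp [ENNReal.inv_pow]

/-- Union bound over the gates, together with the event of probability `2 ^ (-n)` that the two flag
labels coincide. -/
theorem exists_roundFails_le (hcpa : S.CPASecure) (hel : S.ElusiveRange) : ∃ ε, ENegl ε ∧
    ∀ n μ x, (ex (unif (Fin m → Bool → Label n)) fun cur => ex (sysRound S C n cur x) fun a =>
      roundFails S C n cur μ x a) ≤ ε n := by
  obtain ⟨ε, hε, h⟩ := exists_openGate_le S hcpa hel
  refine ⟨_, (hε.const_mul (C.g + m + 1)).add ENegl.two_pow, fun n μ x => ?_⟩
  let good : (Src m s (C.g + m + 1) → Bool → Label n) → (Fin 4 → List Bool) × Data →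
      Fin (C.g + m + 1) → ℝ≥0∞ := fun lab G j =>
    if openGate S n G.1 (lab (C.lift (C.left j)) (wireBit C μ x (C.lift (C.left j)))).toList
      (lab (C.lift (C.right j)) (wireBit C μ x (C.lift (C.right j)))).toList =
        some (lab (.gate j) (nand (wireBit C μ x (C.lift (C.left j)))
          (wireBit C μ x (C.lift (C.right j))))).toList then 0 else 1
  let Φ : (Src m s (C.g + m + 1) → Bool → Label n) → ℝ≥0∞ := fun lab =>
    (∑ j, ex (garble S n nand (lab (C.lift (C.left j))) (lab (C.lift (C.right j))) (lab (.gate j)))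
      fun G => good lab G j) +
    if lab (.gate C.flagGate) true = lab (.gate C.flagGate) false then 1 else 0
  have h1 : (ex (unif (Fin m → Bool → Label n)) fun cur => ex (sysRound S C n cur x) fun a =>
      roundFails S C n cur μ x a) ≤ ex (unif (Src m s (C.g + m + 1) → Bool → Label n)) Φ := by
    rw [ex_unif_wires]
    refine ex_mono _ fun cur => ?_
    rw [ex_sysRound]
    refine ex_mono _ fun sysL => ex_mono _ fun gateL => ?_
    set lab := Src.val cur sysL gateL with hlab
    have e : ∀ j, (ex (garble S n nand (lab (C.lift (C.left j))) (lab (C.lift (C.right j)))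
        (lab (.gate j))) fun G => good lab G j) =
        ex (garbleRound S C n (fun _ => nand) lab) fun G => good lab (G j) j := fun j =>
      (ex_indep_apply (fun j => garble S n nand (lab (C.lift (C.left j)))
        (lab (C.lift (C.right j))) (lab (.gate j))) j fun G => good lab G j).symm
    simp only [Φ, e]
    rw [← ex_finset_sum]
    conv_rhs => rw [← ex_const (garbleRound S C n (fun _ => nand) lab) (ite _ _ _), ← ex_add]
    refine ex_mono _ fun G => ?_
    by_cases hF : lab (.gate C.flagGate) true = lab (.gate C.flagGate) false
    · rw [if_pos hF]
      refine le_trans ?_ le_add_self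
      unfold roundFails
      split_ifs <;> simp
    · rw [if_neg hF, add_zero]
      by_cases hG : ∀ j, good lab (G j) j = 0
      · have hr := monRound_eq S C (G := fun j => (G j).1) (lab := lab) (μ := μ) (x := x)
          (fun j => by
            have := hG j
            simp only [good, ite_eq_left_iff, one_ne_zero, imp_false, not_not] at this
            rw [eval_eq]
            exact this) hF
        rw [roundFails, if_pos]
        · exact zero_le
        · exact hr
      · push Not at hG
        obtain ⟨j, hj⟩ := hG
        refine le_trans ?_ (Finset.single_le_sum (fun _ _ => zero_le) (Finset.mem_univ j))
        have : good lab (G j) j = 1 := by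
          simp only [good] at hj ⊢
          split_ifs at hj ⊢ with h <;> simp_all
        rw [this, roundFails]
        split_ifs <;> simp
  refine h1.trans ?_
  simp only [Φ]
  rw [ex_add, ex_finset_sum]
  refine add_le_add ?_ ?_
  · refine (Finset.sum_le_card_nsmul _ _ (ε n) fun j _ => ?_).trans (by simp)
    exact h n _ _ _ (C.lift_ne_gate (C.left_lt j)) (C.lift_ne_gate (C.right_lt j)) nand _ _
  · rw [ex_unif_curry, ex_unif_update (.gate C.flagGate, true)]
    refine ex_le_of_support _ fun f _ => ?_
    simp only [Function.update_self]
    rw [ex_unif_label]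
    have e1 : ((.gate C.flagGate, false) : Src m s (C.g + m + 1) × Bool) ≠
      (.gate C.flagGate, true) := by simp
    simp only [Function.update_of_ne e1]
    exact ex_bits_eq_le _

/-- The state output labels are uniform whatever the input labels are. Every round, taken by itself,
therefore starts from uniform labels. -/
theorem ex_sysRound_fst (n : ℕ) (cur : Fin m → Bool → Label n) (x : Fin s → Bool)
    (ψ : (Fin m → Bool → Label n) → ℝ≥0∞) :
    (ex (sysRound S C n cur x) fun a => ψ a.1) = ex (unif (Fin m → Bool → Label n)) ψ := by
  rw [ex_sysRound]
  simp only [ex_const]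
  exact ex_unif_comp_injective C.stateGate C.stateGate_injective ψ

theorem rounds_cons (n : ℕ) (cur : Fin m → Bool → Label n) (st : Fin m → Option (List Bool))
    (x : Fin s → Bool) (σ : List (Fin s → Bool))
    (φ : List (Msg C) × List Data × List (Option Bool) → ℝ≥0∞) :
    ex (rounds S C n cur st (x :: σ)) φ = ex (sysRound S C n cur x) fun a =>
      ex (rounds S C n a.1 (monRound S C n st a.2.1).1 σ) fun z =>
        φ (a.2.1 :: z.1, a.2.2 :: z.2.1, (monRound S C n st a.2.1).2 :: z.2.2) := by
  simp only [rounds, ex_bind', ex_pure]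

/-- After a successful round the monitor holds the labels of the next state, and by
`ex_sysRound_fst` the following rounds fail no more often than a fresh run. No independence between
rounds is used. -/
theorem rounds_fail_le {n : ℕ} {ε : ℝ≥0∞}
    (h : ∀ μ x, (ex (unif (Fin m → Bool → Label n)) fun cur => ex (sysRound S C n cur x) fun a =>
      roundFails S C n cur μ x a) ≤ ε) (μ : Fin m → Bool) (σ : List (Fin s → Bool)) :
    (ex (unif (Fin m → Bool → Label n)) fun cur =>
      ex (rounds S C n cur (fun i => some (cur i (μ i)).toList) σ) fun z =>
        if z.2.2 = (C.flags μ σ).map some then 0 else 1) ≤ σ.length * ε := by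
  induction σ generalizing μ with
  | nil =>
    refine ex_le_of_support _ fun cur _ => ?_
    simp [rounds, Circuit.flags]
  | cons x σ ih =>
    have key : ∀ cur : Fin m → Bool → Label n,
        (ex (rounds S C n cur (fun i => some (cur i (μ i)).toList) (x :: σ)) fun z =>
          if z.2.2 = (C.flags μ (x :: σ)).map some then 0 else 1) ≤
        (ex (sysRound S C n cur x) fun a => roundFails S C n cur μ x a) +
        ex (unif (Fin m → Bool → Label n)) fun cur =>
          ex (rounds S C n cur (fun i => some (cur i (C.nextState μ x i)).toList) σ)
            fun z => if z.2.2 = (C.flags (C.nextState μ x) σ).map some then 0 else 1 := by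
      intro cur
      rw [← ex_sysRound_fst S C n cur x, rounds_cons, ← ex_add]
      refine ex_mono _ fun a => ?_
      by_cases hg : monRound S C n (fun i => some (cur i (μ i)).toList) a.2.1 =
        (fun i => some (a.1 i (C.nextState μ x i)).toList, some (C.flag μ x))
      · rw [hg]
        simp [Circuit.flags]
      · refine le_trans ?_ le_self_add
        rw [roundFails, if_neg hg]
        exact ex_le_one _ fun z => by split_ifs <;> simp
    refine (ex_mono _ key).trans ?_
    rw [ex_add, ex_const]
    refine (add_le_add (h μ x) (ih _)).trans (le_of_eq ?_)
    simp only [List.length_cons, Nat.cast_add, Nat.cast_one]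
    ring

/-- Union bound over the `m` transfers, each of which may deliver a wrong label, and over the
rounds. -/
theorem protocol_fail_le {OT : OTProtocol} {n : ℕ} {ε δ : ℝ≥0∞}
    (h : ∀ μ x, (ex (unif (Fin m → Bool → Label n)) fun cur => ex (sysRound S C n cur x) fun a =>
      roundFails S C n cur μ x a) ≤ ε)
    (hOT : ∀ (x₀ x₁ : Label n) β, (ex (OT.exec n (x₀.toList, x₁.toList) β) fun e =>
      if e.output = (if β then x₁.toList else x₀.toList) then 0 else 1) ≤ δ)
    (μ : Fin m → Bool) (σ : List (Fin s → Bool)) :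
    (ex (protocol S OT C n μ σ) fun e => if e.output = (C.flags μ σ).map some then 0 else 1) ≤
      m * δ + σ.length * ε := by
  simp only [protocol, ex_bind', ex_pure]
  refine le_trans ?_ (add_le_add_right (rounds_fail_le S C h μ σ) _)
  rw [← ex_const (unif (Fin m → Bool → Label n)) (m * δ), ← ex_add]
  refine ex_mono _ fun init => ?_
  have h1 : (ex (indep fun i => OT.exec n ((init i false).toList, (init i true).toList) (μ i))
      fun t => ∑ i, if (t i).output = (init i (μ i)).toList then (0 : ℝ≥0∞) else 1) ≤ m * δ := by
    rw [ex_finset_sum]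
    refine (Finset.sum_le_card_nsmul _ _ δ fun i _ => ?_).trans (by simp)
    rw [ex_indep_apply (fun i => OT.exec n ((init i false).toList, (init i true).toList) (μ i)) i
      fun e => if e.output = (init i (μ i)).toList then (0 : ℝ≥0∞) else 1]
    have e : (if μ i = true then (init i true).toList else (init i false).toList) =
        (init i (μ i)).toList := by cases μ i <;> rfl
    simpa only [e] using hOT (init i false) (init i true) (μ i)
  refine le_trans ?_ (add_le_add_left h1 _)
  rw [← ex_const (indep fun i => OT.exec n ((init i false).toList, (init i true).toList) (μ i))
    (ex (rounds S C n init _ σ) _), ← ex_add]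
  refine ex_mono _ fun t => ?_
  by_cases ht : ∀ i, (t i).output = (init i (μ i)).toList
  · simp only [ht]
    exact le_add_self
  · push Not at ht
    obtain ⟨i, hi⟩ := ht
    refine le_trans ?_ (le_self_add)
    refine le_trans ?_ (Finset.single_le_sum (fun _ _ => zero_le) (Finset.mem_univ i))
    rw [if_neg hi]
    exact ex_le_one _ fun z => by split_ifs <;> simp

theorem ENegl.eventually_lt {ε : ℕ → ℝ≥0∞} (h : ENegl ε) (d : ℕ) :
    ∀ᶠ n : ℕ in atTop, ε n < ENNReal.ofReal (1 / (n : ℝ) ^ d) := by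
  obtain ⟨δ, h1, h2, h3⟩ := h
  filter_upwards [(h1 d).eventually (gt_mem_nhds (zero_lt_one)), eventually_gt_atTop 0] with n hn hn0
  refine (h3 n).trans_lt ((ENNReal.ofReal_lt_ofReal_iff_of_nonneg (h2 n)).2 ?_)
  have : (0 : ℝ) < (n : ℝ) ^ d := by positivity
  rw [lt_div_iff₀ this, mul_comm]
  exact hn

theorem protocol_correct (hcpa : S.CPASecure) (hel : S.ElusiveRange) {OT : OTProtocol}
    (hOT : OT.Secure) (ℓ : Polynomial ℕ) : (protocol S OT C).Correct C ℓ := by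
  obtain ⟨⟨δ, hδ, hδ'⟩, -⟩ := hOT
  obtain ⟨ε, hε, h⟩ := exists_roundFails_le S C hcpa hel
  intro d
  filter_upwards [ENegl.eventually_lt (((ENegl.ofReal hδ).const_mul m).add (hε.poly_mul ℓ)) d]
    with n hn μ σ hσ
  have h1 := protocol_fail_le S C (OT := OT) (δ := ENNReal.ofReal (δ n)) (h n) (fun x₀ x₁ β => by
    refine le_trans (le_of_eq ?_) (ENNReal.ofReal_le_ofReal (hδ' n x₀ x₁ β))
    rw [prTrue, ENNReal.ofReal_toReal (PMF.apply_ne_top _ _), apply_eq_ex, ex_map]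
    refine ex_congr _ fun e => ?_
    simp only [decide_eq_true_eq, ne_eq, ite_not]) μ σ
  rw [hσ] at h1
  have h2 := h1.trans_lt hn
  have h3 : prTrue ((protocol S OT C n μ σ).map fun e => decide (e.output = (C.flags μ σ).map some)) =
      1 - (ex (protocol S OT C n μ σ) fun e =>
        if e.output = (C.flags μ σ).map some then 0 else 1).toReal := by
    have h4 : (ex (protocol S OT C n μ σ) fun e =>
        if e.output = (C.flags μ σ).map some then 1 else 0) +
        (ex (protocol S OT C n μ σ) fun e =>
        if e.output = (C.flags μ σ).map some then 0 else 1) = 1 := by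
      rw [← ex_add, ← ex_const (protocol S OT C n μ σ) 1]
      exact ex_congr _ fun e => by split_ifs <;> simp
    rw [prTrue, apply_eq_ex, ex_map]
    simp only [decide_eq_true_eq]
    have h5 := congrArg ENNReal.toReal h4
    rw [ENNReal.toReal_add, ENNReal.toReal_one] at h5
    · linarith
    · exact ((ex_le_one _ fun e => by split_ifs <;> simp).trans_lt ENNReal.one_lt_top).ne
    · exact ((ex_le_one _ fun e => by split_ifs <;> simp).trans_lt ENNReal.one_lt_top).ne
  rw [h3]
  have h6 := (ENNReal.toReal_lt_toReal h2.ne_top ENNReal.ofReal_ne_top).2 h2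
  rw [ENNReal.toReal_ofReal (by positivity)] at h6
  linarith

end OpenSpec

end PPM

/-! ### Renaming labels so that active labels have index `false` -/

namespace PPM

open Code (code)
open Decode (decode decode_code)
open scoped ENNReal

theorem ex_indep_comp_map {α β : Type} {k : ℕ} (p : Fin k → PMF α) (g : α → β)
    (φ : (Fin k → β) → ℝ≥0∞) :
    (ex (indep p) fun f => φ fun i => g (f i)) = ex (indep fun i => (p i).map g) φ := by
  rw [indep_map, ex_map]

/-- Exchanging the two labels of the wires that carry the value `true`. -/
def flip {ι X : Type} (μ : ι → Bool) (f : ι → Bool → X) : ι → Bool → X := fun i b => f i (xor b (μ i))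

theorem flip_flip {ι X : Type} (μ : ι → Bool) : Function.Involutive (flip μ : (ι → Bool → X) → _) := by
  intro f
  funext i b
  simp [flip]

theorem ex_unif_flip {ι X : Type} [Fintype ι] [DecidableEq ι] [Fintype X] [Nonempty X]
    (μ : ι → Bool) (φ : (ι → Bool → X) → ℝ≥0∞) :
    ex (unif (ι → Bool → X)) φ = ex (unif (ι → Bool → X)) fun f => φ (flip μ f) :=
  ex_unif_equiv (flip_flip μ).toPerm φ

namespace OpenSpec

variable {m s : ℕ} (S : EncScheme) (C : Circuit m s)

/-- Rows of a gate as pairs of bits. -/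
noncomputable def rowEquiv : Fin 4 ≃ Bool × Bool :=
  Equiv.ofBijective rowBits ⟨rowBits_injective, fun x => exists_rowBits x.1 x.2⟩

/-- Addition of a bit. -/
def xorPerm (b : Bool) : Equiv.Perm Bool where
  toFun c := xor c b
  invFun c := xor c b
  left_inv c := by simp
  right_inv c := by simp

/-- The permutation of the rows that exchanges the labels of the feed-in wires. -/
noncomputable def flipRow (a b : Bool) : Equiv.Perm (Fin 4) :=
  (rowEquiv.trans (Equiv.prodCongr (xorPerm a) (xorPerm b))).trans rowEquiv.symm

theorem rowBits_flipRow (a b : Bool) (i : Fin 4) :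
    rowBits (flipRow a b i) = (xor (rowBits i).1 a, xor (rowBits i).2 b) := by
  have h : rowEquiv (flipRow a b i) =
      Equiv.prodCongr (xorPerm a) (xorPerm b) (rowEquiv i) := by
    simp [flipRow]
  have h' : rowBits (flipRow a b i) =
      Equiv.prodCongr (xorPerm a) (xorPerm b) (rowBits i) := h
  rw [h']
  rfl

/-- The operation of a NAND gate after exchanging labels. -/
def nandFlip (a b o : Bool) : Bool → Bool → Bool := fun α β => xor (nand (xor α a) (xor β b)) o

/-- Exchanging the labels of feed-in wires permutes the four rows, and the uniformly random order
absorbs this permutation. Only the ciphertexts are compared, not the recorded random choices. -/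
theorem garble_flip (n : ℕ) (L R W : Bool → Label n) (a b o : Bool) :
    (garble S n nand L R W).map Prod.fst =
      (garble S n (nandFlip a b o) (fun c => L (xor c a)) (fun c => R (xor c b))
        fun c => W (xor c o)).map Prod.fst := by
  refine pmf_ext_ex fun φ => ?_
  simp only [garble, ex_map, ex_bind]
  have h := indep_equiv (fun i => encrypt₂ S n (L (rowBits i).1).toList (R (rowBits i).2).toList
    (W (nand (rowBits i).1 (rowBits i).2)).toList) (flipRow a b) fun e =>
      ex (unif (Equiv.Perm (Fin 4))) fun p => φ fun i => (e (p i)).1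
  simp only [rowBits_flipRow] at h
  simp only [nandFlip, Bool.xor_assoc, Bool.xor_self, Bool.xor_false] at h ⊢
  rw [h]
  refine ex_congr _ fun e => ?_
  rw [ex_unif_equiv (Equiv.mulLeft (flipRow a b))]
  rfl

/-- Truth tables for all gates. -/
abbrev Tables (C : Circuit m s) : Type := Fin (C.g + m + 1) → Bool → Bool → Bool

/-- The messages of the system, if the gates are garbled according to given truth tables, the
labels of the observation are those with index `false`, and the flag labels are in the given
order. -/
noncomputable def messages (n : ℕ) :
    (Fin m → Bool → Label n) → List (Tables C × Bool) → PMF (List (Msg C))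
  | _, [] => PMF.pure []
  | cur, x :: l =>
    (unif (Fin s → Bool → Label n)).bind fun sysL =>
    (unif (Fin (C.g + m + 1) → Bool → Label n)).bind fun gateL =>
    (garbleRound S C n x.1 (Src.val cur sysL gateL)).bind fun G =>
    (messages n (fun i => gateL (C.stateGate i)) l).map fun z =>
      (((fun j => (G j).1), (fun i => (sysL i false).toList),
        ((gateL C.flagGate x.2).toList, (gateL C.flagGate (!x.2)).toList)) : Msg C) :: z

/-- The truth tables of the gates of a round after exchanging labels so that the values of all wires
are represented by the labels with index `false`. -/
def flipTables (μ : Fin m → Bool) (x : Fin s → Bool) : Tables C := fun j =>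
  nandFlip (wireBit C μ x (C.lift (C.left j))) (wireBit C μ x (C.lift (C.right j))) (C.eval μ x j)

theorem flipTables_false (μ : Fin m → Bool) (x : Fin s → Bool) (j : Fin (C.g + m + 1)) :
    flipTables C μ x j false false = false := by
  simp only [flipTables, nandFlip, Bool.false_xor, ← eval_eq, Bool.xor_self]

/-- The truth tables and flags of all rounds. -/
def allTables : (Fin m → Bool) → List (Fin s → Bool) → List (Tables C × Bool)
  | _, [] => []
  | μ, x :: σ => (flipTables C μ x, C.flag μ x) :: allTables (C.nextState μ x) σ

theorem length_allTables (μ : Fin m → Bool) (σ : List (Fin s → Bool)) :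
    (allTables C μ σ).length = σ.length := by
  induction σ generalizing μ with
  | nil => rfl
  | cons x σ ih => simp [allTables, ih]

theorem map_snd_allTables (μ : Fin m → Bool) (σ : List (Fin s → Bool)) :
    (allTables C μ σ).map Prod.snd = C.flags μ σ := by
  induction σ generalizing μ with
  | nil => rfl
  | cons x σ ih => simp [allTables, Circuit.flags, ih]

theorem allTables_false (μ : Fin m → Bool) (σ : List (Fin s → Bool)) :
    ∀ x ∈ allTables C μ σ, ∀ j, x.1 j false false = false := by
  induction σ generalizing μ with
  | nil => simp [allTables]
  | cons x σ ih =>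
    intro y hy
    rcases List.mem_cons.1 hy with rfl | hy
    · exact flipTables_false C μ x
    · exact ih _ y hy

theorem garbleRound_flip (n : ℕ) (lab : Src m s (C.g + m + 1) → Bool → Label n)
    (μ : Fin m → Bool) (x : Fin s → Bool)
    (ψ : (Fin (C.g + m + 1) → Fin 4 → List Bool) → ℝ≥0∞) :
    (ex (garbleRound S C n (fun _ => nand) lab) fun G => ψ fun j => (G j).1) =
      ex (garbleRound S C n (flipTables C μ x) (flip (wireBit C μ x) lab)) fun G =>
        ψ fun j => (G j).1 := by
  rw [garbleRound, garbleRound, ex_indep_comp_map _ Prod.fst, ex_indep_comp_map _ Prod.fst]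
  congr 1
  exact indep_congr fun j => garble_flip S n _ _ _ _ _ _

/-- The two labels of a wire have the same joint distribution in either order, so each pair may be
exchanged according to the value of its wire. Afterwards state and observation influence only the
truth tables and the order of the flag labels. The messages do not depend on what the monitor holds,
hence `st` is arbitrary. -/
theorem rounds_eq_messages (n : ℕ) (μ : Fin m → Bool) (σ : List (Fin s → Bool))
    (cur : Fin m → Bool → Label n) (st : Fin m → Option (List Bool)) (φ : List (Msg C) → ℝ≥0∞) :
    (ex (rounds S C n cur st σ) fun z => φ z.1) =
      ex (messages S C n (flip μ cur) (allTables C μ σ)) φ := by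
  induction σ generalizing μ cur st φ with
  | nil => simp [rounds, messages, allTables]
  | cons x σ ih =>
    rw [rounds_cons, ex_sysRound]
    simp only [allTables, messages, ex_bind, ex_map]
    refine (ex_congr _ fun sysL => ex_congr _ fun gateL => ex_congr _ fun G =>
      ih (C.nextState μ x) _ _ fun z => φ (_ :: z)).trans ?_
    conv_rhs => rw [ex_unif_flip x]
    refine ex_congr _ fun sysL => ?_
    conv_rhs => rw [ex_unif_flip (C.eval μ x)]
    refine ex_congr _ fun gateL => ?_
    have hlab : Src.val (flip μ cur) (flip x sysL) (flip (C.eval μ x) gateL) =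
        flip (wireBit C μ x) (Src.val cur sysL gateL) := by
      funext w
      cases w <;> rfl
    rw [hlab, garbleRound_flip S C n (Src.val cur sysL gateL) μ x fun G =>
      ex (messages S C n (flip (C.nextState μ x) fun i => gateL (C.stateGate i))
        (allTables C (C.nextState μ x) σ)) fun z => φ ((G, (fun i => (sysL i (x i)).toList),
          ((gateL C.flagGate false).toList, (gateL C.flagGate true).toList)) :: z)]
    refine ex_congr _ fun G => ?_
    have e1 : ∀ b, flip (C.eval μ x) gateL C.flagGate b = gateL C.flagGate (xor b (C.flag μ x)) :=
      fun b => rfl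
    have e2 : ∀ i, flip x sysL i false = sysL i (x i) := fun i => by simp [flip]
    simp only [e1, e2, Bool.xor_self, Bool.not_xor, Bool.not_false]
    rfl

end OpenSpec

end PPM

/-! ### Rows of garbled gates as chosen plaintext scripts -/

namespace PPM

open Code (code)
open Decode (decode decode_code)
open scoped ENNReal

/-- Nested families of independent samples are families indexed by pairs. -/
theorem ex_indep_prod {α : Type} {a b : ℕ} (p : Fin a → Fin b → PMF α)
    (φ : (Fin a → Fin b → α) → ℝ≥0∞) :
    ex (indep fun j => indep (p j)) φ =
      ex (indep fun q : Fin (a * b) => p (finProdFinEquiv.symm q).1 (finProdFinEquiv.symm q).2)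
        fun e => φ fun j i => e (finProdFinEquiv (j, i)) := by
  let E : (Fin (a * b) → α) ≃ (Fin a → Fin b → α) :=
    (Equiv.arrowCongr finProdFinEquiv.symm (Equiv.refl α)).trans (Equiv.curry _ _ _)
  have hE : ∀ e j i, E e j i = e (finProdFinEquiv (j, i)) := fun e j i => rfl
  simp only [ex]
  rw [← E.tsum_eq]
  refine tsum_congr fun e => ?_
  congr 1
  simp only [indep_apply, hE]
  rw [← Fintype.prod_prod_type' (f := fun j i => p j i (e (finProdFinEquiv (j, i)))),
    ← Equiv.prod_comp finProdFinEquiv]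
  simp

namespace OpenSpec

section rows

variable (S : EncScheme)

/-- The part of a double encryption that does not depend on the secret key; `none` stands for the
secret key. -/
noncomputable def encRow (n L : ℕ) (l r : Option (List Bool)) (x : List Bool) : PMF Row :=
  match l, r with
  | none, none => PMF.pure ((true, true, false), x, [], [])
  | some k, none => (lbits L).map fun ρ => ((true, false, true), x, k, ρ)
  | none, some k => (S.encrypt n k x).map fun c => ((true, false, false), c.1, [], [])
  | some k, some k' => (encrypt₂ S n k k' x).map fun c => ((false, false, false), c.1, [], [])

/-- Everything in a row that does not involve the secret key can be computed in advance and put into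
a script. With a known outer key over a secret inner one, the outer coins are drawn in advance for
the longest inner ciphertext, which explains `L`. The last clause bounds the challenge rows that
arise when only the outer key is secret. -/
theorem exists_encRow : ∃ L R : Polynomial ℕ, ∀ n (l r : Option (List Bool)) (x : List Bool),
    (∀ k ∈ l, k.length = n) → (∀ k ∈ r, k.length = n) → x.length = n →
    (∀ (K : List Bool), K.length = n → ∀ φ : List Bool → ℝ≥0∞,
      (ex (encRow S n (L.eval n) l r x) fun ρ => ex (ρ.dist S n K) φ) =
        ex (encrypt₂ S n (l.getD K) (r.getD K) x) fun c => φ c.1) ∧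
    (∀ ρ ∈ (encRow S n (L.eval n) l r x).support, sz ρ ≤ R.eval n) ∧
    (∀ k ∈ r, ∀ c ∈ (S.encrypt n k x).support, c.1.length ≤ R.eval n ∧
      ∀ y : List Bool, y.length = c.1.length →
        sz (((true, false, false), y, [], []) : Row) ≤ R.eval n) := by
  obtain ⟨Q, hQ⟩ := S.exists_support_length_le .X
  obtain ⟨Q', hQ'⟩ := S.exists_support_length_le Q
  refine ⟨S.coins.comp (.X + Q), 4 * (.X + Q + Q' + .X + S.coins.comp (.X + Q)) + 20,
    fun n l r x hl hr hx => ⟨?_, ?_, ?_⟩⟩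
  · intro K hK φ
    simp only [Row.dist, Row.replies, ex_map, ex_bind, ex_encrypt₂]
    rcases l with - | k <;> rcases r with - | k'
    · simp [encRow, Row.out, Row.second]
    · simp [encRow, Row.out, Row.second]
    · simp only [encRow, ex_map, Row.second, if_true, Option.getD_some, Option.getD_none, Row.out,
        Bool.false_eq_true, if_false, ex_const]
      rw [ex_comm]
      refine ex_congr_support _ fun c hc => ?_
      rw [S.ex_encrypt n k c.1]
      refine lbits_take ?_ fun r => φ (S.enc n k c.1 r)
      simp only [Polynomial.eval_comp, Polynomial.eval_add, Polynomial.eval_X]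
      refine eval_mono _ ?_
      have := (hQ n K x hK.le (by simp [hx]) c hc).1
      omega
    · simp [encRow, Row.out, Row.second, ex_encrypt₂]
  · intro ρ hρ
    refine (sz_row_le ρ).trans ?_
    simp only [Polynomial.eval_add, Polynomial.eval_mul, Polynomial.eval_ofNat, Polynomial.eval_X]
    rcases l with - | k <;> rcases r with - | k' <;>
      simp only [encRow, PMF.mem_support_pure_iff, PMF.mem_support_map_iff] at hρ
    · subst hρ
      simp only [List.length_nil]
      omega
    · obtain ⟨c, hc, rfl⟩ := hρ
      have := (hQ n k' x (hr k' rfl).le (by simp [hx]) c hc).1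
      simp only [List.length_nil]
      omega
    · obtain ⟨c, hc, rfl⟩ := hρ
      have h1 := length_of_mem_lbits hc
      have h2 := hl k rfl
      simp only
      omega
    · obtain ⟨c, hc, rfl⟩ := hρ
      obtain ⟨d, hd, e, he, rfl⟩ := mem_support_encrypt₂ hc
      have h1 := (hQ n k' x (hr k' rfl).le (by simp [hx]) d hd).1
      have h2 := (hQ' n k d.1 (hl k rfl).le h1 e he).1
      simp only [List.length_nil]
      omega
  · intro k hk c hc
    have h1 := (hQ n k x (hr k hk).le (by simp [hx]) c hc).1
    refine ⟨?_, fun y hy => (sz_row_le _).trans ?_⟩ <;>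
    · simp only [Polynomial.eval_add, Polynomial.eval_mul, Polynomial.eval_ofNat,
        Polynomial.eval_X, List.length_nil]
      omega

end rows

variable {m s : ℕ} (S : EncScheme) (C : Circuit m s) (D : PPT (Data × Data) Bool)

/-- A view of the monitor. -/
def view (A B : Data) (msgs : List (Msg C)) : Data := .node A (.node B (code msgs))

/-- Probability that a distinguisher accepts. -/
noncomputable def test (n : ℕ) (z v : Data) : ℝ≥0∞ :=
  ex (lbits (D.coins.eval n)) fun r => if D.run (n, (z, v), r) then 1 else 0

theorem test_eq (n : ℕ) (z v : Data) : test D n z v = D.dist n (z, v) true := by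
  rw [apply_eq_ex, PPT.dist, ex_map, test, ex_lbits]

theorem test_le_one (n : ℕ) (z v : Data) : test D n z v ≤ 1 :=
  ex_le_one _ fun _ => by split_ifs <;> simp

/-- Number of rows of all garbled gates. -/
abbrev numRows : ℕ := (C.g + m + 1) * 4

/-- What a reduction has to know in order to complete the results of the rows to a view. -/
abbrev Context : Type :=
  Data × (Data × Data) × (List (Msg C) × List (Msg C)) × (Fin (C.g + m + 1) → Fin 4 → ℕ) ×
    ((Fin s → List Bool) × (List Bool × List Bool))

instance : Inhabited (Context C) :=
  ⟨.leaf, (.leaf, .leaf), ([], []), fun _ _ => 0, fun _ => [], [], []⟩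

/-- The test of a reduction. -/
def rowTest : ℕ × Context C × List Bool × (Fin (numRows C) → List Bool) × List Bool → Bool := fun y =>
  D.run (y.1, (y.2.1.1, view C y.2.1.2.1.1 y.2.1.2.1.2 (y.2.1.2.2.1.1 ++
    ((fun j i => (List.ofFn y.2.2.2.1 ++ [y.2.2.2.2]).getD (y.2.1.2.2.2.1 j i) [],
      y.2.1.2.2.2.2) : Msg C) :: y.2.1.2.2.1.2)), y.2.2.1)

theorem polyTime_rowTest : PolyTime (rowTest C D) := by
  refine D.polyTime.comp ?_
  unfold view
  fun_prop

/-- Positions of the rows; row `q₀` comes last. -/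
def position (p : Fin (C.g + m + 1) → Equiv.Perm (Fin 4)) (q₀ : Fin (numRows C)) :
    Fin (C.g + m + 1) → Fin 4 → ℕ := fun j i =>
  if finProdFinEquiv (j, p j i) = q₀ then numRows C else (finProdFinEquiv (j, p j i)).val

/-- The challenge takes the place of row `q₀`; the result of the scripted row `q₀` is computed but
not used. -/
theorem scriptGame_rowTest (n : ℕ) (z A B : Data) (pre rest : List (Msg C))
    (p : Fin (C.g + m + 1) → Equiv.Perm (Fin 4)) (q₀ : Fin (numRows C))
    (u : (Fin s → List Bool) × (List Bool × List Bool)) (rows : Fin (numRows C) → Row) (ch : Row) :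
    S.scriptGame (numRows C) (rowTest C D) D.coins n (z, (A, B), (pre, rest), position C p q₀, u)
      rows ch =
    ex (bits n) fun K => ex (indep fun i => (rows i).dist S n K.toList) fun e =>
      ex (ch.dist S n K.toList) fun c => test D n z (view C A B (pre ++
        ((fun j i => Function.update e q₀ c (finProdFinEquiv (j, p j i)), u) : Msg C) :: rest)) := by
  refine ex_congr _ fun K => ?_
  rw [ex_comm]
  refine ex_congr _ fun e => ?_
  rw [ex_comm]
  refine ex_congr _ fun c => ex_congr _ fun r => ?_
  have h : ∀ j i, (List.ofFn e ++ [c]).getD (position C p q₀ j i) [] =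
      Function.update e q₀ c (finProdFinEquiv (j, p j i)) := by
    intro j i
    unfold position
    split_ifs with hq
    · rw [hq, Function.update_self, List.getD_append_right _ _ _ _ (by rw [List.length_ofFn]),
        List.length_ofFn, Nat.sub_self]
      rfl
    · rw [Function.update_of_ne hq, List.getD_append _ _ _ _ (by
        rw [List.length_ofFn]
        exact Fin.is_lt _), getD_ofFn _ (Fin.is_lt _)]
  simp only [rowTest, h]

theorem sz_position_le (p : Fin (C.g + m + 1) → Equiv.Perm (Fin 4)) (q₀ : Fin (numRows C)) :
    sz (position C p q₀) ≤ (C.g + m + 1) * (4 * (2 * numRows C + 1 + 1) + 1 + 1) + 1 := by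
  refine sz_pi_le fun j => sz_pi_le fun i => ?_
  rw [sz_nat]
  unfold position
  split_ifs
  · omega
  · have := (finProdFinEquiv (j, p j i)).is_lt
    unfold numRows at *
    omega

end OpenSpec

end PPM

/-! ### Changing one plaintext of a garbled circuit -/

namespace PPM

open Code (code)
open Decode (decode decode_code)
open scoped ENNReal

namespace OpenSpec

variable {m s : ℕ} (S : EncScheme) (C : Circuit m s) (D : PPT (Data × Data) Bool)

/-- Changing the message in one row of a garbled circuit, if one of its keys is secret. -/
theorem exists_close_entry (hcpa : S.CPASecure) (P : Polynomial ℕ) : ∃ ε, ENegl ε ∧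
    ∀ n (z A B : Data) (pre rest : List (Msg C)) (p : Fin (C.g + m + 1) → Equiv.Perm (Fin 4))
      (u : (Fin s → List Bool) × (List Bool × List Bool)) (q₀ : Fin (numRows C))
      (l r : Fin (numRows C) → Option (List Bool)) (x : Fin (numRows C) → List Bool)
      (x' : List Bool), (∀ q, ∀ k ∈ l q, k.length = n) → (∀ q, ∀ k ∈ r q, k.length = n) →
      (∀ q, (x q).length = n) → x'.length = n → (l q₀ = none ∨ r q₀ = none) →
      sz z + sz A + sz B + sz pre + sz rest + sz u ≤ P.eval n →
      ∀ Φ : (Fin (numRows C) → List Bool) → ℝ≥0∞,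
      (∀ e, Φ e = test D n z (view C A B (pre ++
        ((fun j i => e (finProdFinEquiv (j, p j i)), u) : Msg C) :: rest))) →
      Close (ε n + match r q₀ with | some k => S.lenGap n k (x q₀) x' | none => 0)
        (ex (bits n) fun K => ex (indep fun q =>
          encrypt₂ S n ((l q).getD K.toList) ((r q).getD K.toList) (x q)) fun e => Φ fun q => (e q).1)
        (ex (bits n) fun K => ex (indep fun q =>
          encrypt₂ S n ((l q).getD K.toList) ((r q).getD K.toList) (Function.update x q₀ x' q))
            fun e => Φ fun q => (e q).1) := by
  obtain ⟨L, R, hLR⟩ := exists_encRow S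
  obtain ⟨ε, hε, h⟩ := S.close_scriptGame (numRows C) (rowTest C D) D.coins hcpa
    (polyTime_rowTest C D) (Polynomial.C (numRows C) * (R + 1) + R + (4 * .X + 4 * R) + P +
      Polynomial.C ((C.g + m + 1) * (4 * (2 * numRows C + 1 + 1) + 1 + 1) + 100))
  refine ⟨_, hε.const_mul 2, ?_⟩
  intro n z A B pre rest p u q₀ l r x x' hl hr hx hx' hlr hsz Φ hΦ
  let Γ : Fin (numRows C) → PMF Row := fun q => encRow S n (L.eval n) (l q) (r q) (x q)
  let aux : Context C := (z, (A, B), (pre, rest), position C p q₀, u)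
  have hrow := fun q => hLR n (l q) (r q) (x q) (hl q) (hr q) (hx q)
  have hbound : ∀ rows ∈ (indep Γ).support, ∀ (ch : Row) (y : List Bool), sz ch ≤ R.eval n →
      y.length ≤ n + R.eval n → sz (rows, ch, y, aux) ≤
        (Polynomial.C (numRows C) * (R + 1) + R + (4 * .X + 4 * R) + P +
        Polynomial.C ((C.g + m + 1) * (4 * (2 * numRows C + 1 + 1) + 1 + 1) + 100)).eval n := by
    intro rows hrows ch y hch hy
    rw [mem_support_indep] at hrows
    have e1 : sz rows ≤ numRows C * (R.eval n + 1) + 1 := sz_pi_le fun q => (hrow q).2.1 _ (hrows q)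
    have e2 := sz_bits_le y
    have e3 := sz_position_le C p q₀
    have e4 : sz (rows, ch, y, aux) = sz rows + (sz ch + (sz y + (sz z + ((sz A + sz B + 1) +
      ((sz pre + sz rest + 1) + (sz (position C p q₀) + sz u + 1) + 1) + 1) + 1) + 1) + 1) + 1 := rfl
    rw [e4]
    simp only [Polynomial.eval_add, Polynomial.eval_mul, Polynomial.eval_C, Polynomial.eval_one,
      Polynomial.eval_X, Polynomial.eval_ofNat]
    generalize numRows C * (R.eval n + 1) = a at *
    generalize (C.g + m + 1) * (4 * (2 * numRows C + 1 + 1) + 1 + 1) = b at *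
    omega
  -- The public parts of all rows are drawn before the secret key. For fixed public parts, the
  -- experiment is a script whose challenge is row `q₀`.
  have hgame : ∀ y : List Bool, y.length = n →
      (ex (bits n) fun K => ex (indep fun q => encrypt₂ S n ((l q).getD K.toList)
        ((r q).getD K.toList) (Function.update x q₀ y q)) fun e => Φ fun q => (e q).1) =
      ex (indep Γ) fun rows => ex (encRow S n (L.eval n) (l q₀) (r q₀) y) fun ch =>
        S.scriptGame (numRows C) (rowTest C D) D.coins n aux rows ch := by
    intro y hy
    simp only [aux, scriptGame_rowTest, ← hΦ]
    simp only [ex_comm _ (bits n)]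
    refine ex_congr _ fun K => ?_
    have e1 : (fun q => encrypt₂ S n ((l q).getD K.toList) ((r q).getD K.toList)
        (Function.update x q₀ y q)) = Function.update (fun q => encrypt₂ S n ((l q).getD K.toList)
          ((r q).getD K.toList) (x q)) q₀ (encrypt₂ S n ((l q₀).getD K.toList)
          ((r q₀).getD K.toList) y) := by
      funext q
      by_cases hq : q = q₀
      · subst hq; simp
      · simp [hq]
    rw [e1, ex_indep_update]
    have e2 : ∀ (e : Fin (numRows C) → List Bool × (List Bool × List Bool)) a,
        (fun q => (Function.update e q₀ a q).1) = Function.update (fun q => (e q).1) q₀ a.1 := by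
      intro e a
      funext q
      by_cases hq : q = q₀
      · subst hq; simp
      · simp [hq]
    simp only [e2]
    rw [ex_indep_comp_map _ Prod.fst fun e => ex (encrypt₂ S n ((l q₀).getD K.toList)
      ((r q₀).getD K.toList) y) fun a => Φ (Function.update e q₀ a.1)]
    have e3 : (fun q => (encrypt₂ S n ((l q).getD K.toList) ((r q).getD K.toList) (x q)).map
        Prod.fst) = fun q => (Γ q).bind fun ρ => ρ.dist S n K.toList := by
      funext q
      refine pmf_ext_ex fun φ => ?_
      rw [ex_map, ex_bind, (hrow q).1 K.toList K.toList_length]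
    rw [e3, ex_indep_bind]
    refine ex_congr _ fun rows => ?_
    rw [ex_comm (encRow S n (L.eval n) (l q₀) (r q₀) y)]
    refine ex_congr _ fun e => ?_
    exact ((hLR n (l q₀) (r q₀) y (hl q₀) (hr q₀) hy).1 K.toList K.toList_length
      fun c => Φ (Function.update e q₀ c)).symm
  have hg1 := hgame (x q₀) (hx q₀)
  rw [Function.update_eq_self] at hg1
  rw [hg1, hgame x' hx']
  refine Close.ex _ fun rows hrows => ?_
  have hb := hbound rows hrows
  have hsupp := fun y hy => (hLR n (l q₀) (r q₀) y (hl q₀) (hr q₀) hy).2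
  have hε2 : ε n ≤ (2 : ℕ) * ε n := by
    push_cast
    rw [two_mul]
    exact le_self_add
  rcases hr0 : r q₀ with - | k
  -- The inner key is secret. The label itself is the challenge message, and both candidates have
  -- length `n`.
  · simp only [add_zero]
    rw [hr0] at hsupp
    refine Close.mono ?_ hε2
    rcases hl0 : l q₀ with - | k
    · rw [hl0] at hsupp
      have hs := (hsupp _ (hx q₀)).1
      simp only [encRow, ex_pmf_pure, PMF.mem_support_pure_iff, forall_eq] at hs ⊢
      exact h n aux rows ((true, true, false), x q₀, [], []) x'
        (hb _ _ hs (by rw [hx']; omega)) rfl (by rw [hx', hx])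
    · rw [hl0] at hsupp
      have hs := (hsupp _ (hx q₀)).1
      simp only [encRow, ex_map, PMF.mem_support_map_iff, forall_exists_index, and_imp,
        forall_apply_eq_imp_iff₂] at hs ⊢
      refine Close.ex _ fun ρ hρ => ?_
      exact h n aux rows ((true, false, true), x q₀, k, ρ) x'
        (hb _ _ (hs ρ hρ) (by rw [hx']; omega)) rfl (by rw [hx', hx])
  -- Only the outer key is secret, so the challenge messages are ciphertexts under the known key `k`
  -- and may differ in length. Each is replaced by zeros of its own length, at the cost of `ε` each;
  -- what is left depends on the lengths alone and costs `lenGap`.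
  · have hl0 : l q₀ = none := hlr.resolve_right (by simp [hr0])
    rw [hl0, hr0] at hsupp
    simp only [hl0, encRow, ex_map]
    have hop : ∀ y : List Bool, y.length = n → Close (ε n)
        (ex (S.encrypt n k y) fun c => S.scriptGame (numRows C) (rowTest C D) D.coins n aux rows
          ((true, false, false), c.1, [], []))
        (ex (S.encrypt n k y) fun c => S.scriptGame (numRows C) (rowTest C D) D.coins n aux rows
          ((true, false, false), List.replicate c.1.length false, [], [])) := by
      intro y hy
      refine Close.ex _ fun c hc => ?_
      obtain ⟨h1, h2⟩ := (hsupp y hy).2 k rfl c hc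
      exact h n aux rows ((true, false, false), c.1, [], []) _
        (hb _ _ (h2 _ rfl) (by rw [List.length_replicate]; omega)) rfl (by simp)
    have h3 := S.close_length n k (x q₀) x' (fun i => S.scriptGame (numRows C) (rowTest C D)
      D.coins n aux rows ((true, false, false), List.replicate i false, [], []))
      fun _ => S.scriptGame_le_one ..
    refine (((hop _ (hx q₀)).trans h3).trans (hop _ hx').symm).mono (le_of_eq ?_)
    push_cast
    ring

end OpenSpec

end PPM

/-! ### Clearing one entry of a truth table -/

namespace PPM

open Code (code)
open Decode (decode decode_code)
open scoped ENNReal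

namespace OpenSpec

variable {m s : ℕ} (S : EncScheme) (C : Circuit m s) (D : PPT (Data × Data) Bool)

/-- A garbled circuit as a permuted family of independent double encryptions. -/
theorem ex_garbleRound (n : ℕ) (t : Tables C) (lab : Src m s (C.g + m + 1) → Bool → Label n)
    (ψ : (Fin (C.g + m + 1) → Fin 4 → List Bool) → ℝ≥0∞) :
    (ex (garbleRound S C n t lab) fun G => ψ fun j => (G j).1) =
      ex (indep fun _ : Fin (C.g + m + 1) => unif (Equiv.Perm (Fin 4))) fun p =>
      ex (indep fun q : Fin (numRows C) => encrypt₂ S n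
        (lab (C.lift (C.left (finProdFinEquiv.symm q).1)) (rowBits (finProdFinEquiv.symm q).2).1).toList
        (lab (C.lift (C.right (finProdFinEquiv.symm q).1)) (rowBits (finProdFinEquiv.symm q).2).2).toList
        (lab (.gate (finProdFinEquiv.symm q).1) (t (finProdFinEquiv.symm q).1
          (rowBits (finProdFinEquiv.symm q).2).1 (rowBits (finProdFinEquiv.symm q).2).2)).toList)
        fun e => ψ fun j i => (e (finProdFinEquiv (j, p j i))).1 := by
  simp only [garbleRound, garble]
  rw [ex_indep_bind, ex_comm (indep fun _ : Fin (C.g + m + 1) => unif (Equiv.Perm (Fin 4)))]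
  rw [ex_indep_prod]
  refine ex_congr _ fun e => ?_
  rw [indep_map, ex_map]

/-- Labels for all wires, with given labels of index `false` for the state. -/
def setActive {n : ℕ} (curF : Fin m → Label n) (f : Src m s (C.g + m + 1) × Bool → Label n) :
    Src m s (C.g + m + 1) → Bool → Label n
  | .mon i, false => curF i
  | w, b => f (w, b)

theorem setActive_update {n : ℕ} (curF : Fin m → Label n)
    (f : Src m s (C.g + m + 1) × Bool → Label n) (w₀ : Src m s (C.g + m + 1)) (K : Label n)
    (w : Src m s (C.g + m + 1)) (b : Bool) :
    setActive C curF (Function.update f (w₀, true) K) w b =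
      if (w, b) = (w₀, true) then K else setActive C curF f w b := by
  cases w <;> cases b <;> simp [setActive, Function.update_apply]

/-- The parts of a message that are labels. -/
def labelMsg {n : ℕ} (τ : Bool) (lab : Src m s (C.g + m + 1) → Bool → Label n) :
    (Fin s → List Bool) × (List Bool × List Bool) :=
  (fun i => (lab (.sys i) false).toList,
    ((lab (.gate C.flagGate) τ).toList, (lab (.gate C.flagGate) (!τ)).toList))

theorem sz_labelMsg_le {n : ℕ} (τ : Bool) (lab : Src m s (C.g + m + 1) → Bool → Label n) :
    sz (labelMsg C τ lab) ≤ s * (4 * n + 2) + 8 * n + 5 := by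
  have e2 : sz (fun i => (lab (.sys i) false).toList) ≤ s * (4 * n + 1 + 1) + 1 :=
    sz_pi_le fun i => (sz_bits_le _).trans (by simp)
  have e3 : ∀ k : Label n, sz k.toList ≤ 4 * n + 1 := fun k => (sz_bits_le _).trans (by simp)
  have e4 := e3 (lab (.gate C.flagGate) τ)
  have e5 := e3 (lab (.gate C.flagGate) !τ)
  simp only [labelMsg, sz_pair, add_assoc, Nat.reduceAdd] at *
  omega

theorem exists_sz_round : ∃ M : Polynomial ℕ, ∀ n (t : Tables C) (τ : Bool)
    (lab : Src m s (C.g + m + 1) → Bool → Label n), ∀ G ∈ (garbleRound S C n t lab).support,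
      sz ((fun j => (G j).1, labelMsg C τ lab) : Msg C) ≤ M.eval n := by
  obtain ⟨Q, hQ⟩ := S.exists_support_length_le .X
  obtain ⟨Q', hQ'⟩ := S.exists_support_length_le Q
  refine ⟨Polynomial.C (C.g + m + 1) * (4 * (4 * Q' + 2) + 2) + Polynomial.C s * (4 * .X + 2) +
    8 * .X + 10, fun n t τ lab G hG => ?_⟩
  rw [garbleRound, mem_support_indep] at hG
  have e1 : sz (fun j => (G j).1) ≤ (C.g + m + 1) * (4 * (4 * Q'.eval n + 1 + 1) + 1 + 1) + 1 := by
    refine sz_pi_le fun j => sz_pi_le fun i => (sz_bits_le _).trans ?_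
    have h3 := hG j
    simp only [garble, PMF.mem_support_bind_iff, PMF.mem_support_map_iff] at h3
    obtain ⟨e, he, p, -, h4⟩ := h3
    rw [mem_support_indep] at he
    obtain ⟨c, hc, d, hd, h5⟩ := mem_support_encrypt₂ (he (p i))
    have h6 := (hQ n _ _ (by simp) (by simp) c hc).1
    have h7 := (hQ' n _ _ (by simp) h6 d hd).1
    have h8 : (G j).1 i = d.1 := by rw [← h4]; simp only [h5]
    rw [h8]
    omega
  have e2 := sz_labelMsg_le C τ lab
  rw [sz_pair]
  simp only [Polynomial.eval_add, Polynomial.eval_mul, Polynomial.eval_C, Polynomial.eval_X,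
    Polynomial.eval_ofNat]
  simp only [add_assoc, Nat.reduceAdd] at e1 e2 ⊢
  omega

/-- Earlier and later rounds enter the reductions as advice, so their messages must have polynomial
size. -/
theorem exists_sz_messages : ∃ M : Polynomial ℕ,
    (∀ n (t : Tables C) (τ : Bool) (lab : Src m s (C.g + m + 1) → Bool → Label n),
      ∀ G ∈ (garbleRound S C n t lab).support,
        sz ((fun j => (G j).1, labelMsg C τ lab) : Msg C) ≤ M.eval n) ∧
    ∀ n (cur : Fin m → Bool → Label n) (l : List (Tables C × Bool)),
      ∀ z ∈ (messages S C n cur l).support, z.length = l.length ∧ ∀ x ∈ z, sz x ≤ M.eval n := by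
  obtain ⟨M, hM⟩ := exists_sz_round S C
  refine ⟨M, hM, fun n cur l => ?_⟩
  induction l generalizing cur with
  | nil => simp [messages]
  | cons y l ih =>
    intro z hz
    simp only [messages, PMF.mem_support_bind_iff, PMF.mem_support_map_iff] at hz
    obtain ⟨sysL, -, gateL, -, G, hG, z, hz, rfl⟩ := hz
    obtain ⟨h1, h2⟩ := ih _ z hz
    refine ⟨by simp [h1], fun x hx => ?_⟩
    rcases List.mem_cons.1 hx with rfl | hx
    · exact hM n y.1 y.2 _ G hG
    · exact h2 x hx

/-- Acceptance probability, given the garbled gates and the labels of a round, if the following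
rounds use given truth tables. -/
noncomputable def roundTail (n : ℕ) (z A B : Data) (pre : List (Msg C)) (τ : Bool)
    (l : List (Tables C × Bool)) (lab : Src m s (C.g + m + 1) → Bool → Label n)
    (g : Fin (C.g + m + 1) → Fin 4 → List Bool) : ℝ≥0∞ :=
  ex (messages S C n (fun i => lab (.gate (C.stateGate i))) l) fun rest =>
    test D n z (view C A B (pre ++ ((g, labelMsg C τ lab) : Msg C) :: rest))

/-- Acceptance probability as a function of the truth tables of a round. -/
noncomputable def tableGame (n : ℕ) (z A B : Data) (pre : List (Msg C)) (τ : Bool)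
    (l : List (Tables C × Bool)) (curF : Fin m → Label n) (t : Tables C) : ℝ≥0∞ :=
  ex (unif (Src m s (C.g + m + 1) × Bool → Label n)) fun f =>
    ex (garbleRound S C n t (setActive C curF f)) fun G =>
      roundTail S C D n z A B pre τ l (setActive C curF f) fun j => (G j).1

/-- Setting one entry of the truth tables to `false`. -/
def clearEntry (t : Tables C) (j₀ : Fin (C.g + m + 1)) (α β : Bool) : Tables C := fun j a b =>
  if j = j₀ ∧ a = α ∧ b = β then false else t j a b

/-- Expected gap between the lengths of encryptions of random labels under a given key. -/
noncomputable def labelGap (n : ℕ) (k : List Bool) : ℝ≥0∞ :=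
  ex (bits n) fun W => ex (bits n) fun W' => S.lenGap n k W.toList W'.toList

theorem exists_labelGap_le (hcpa : S.CPASecure) : ∃ ε, ENegl ε ∧
    ∀ n, (ex (bits n) fun k => labelGap S n k.toList) ≤ ε n := by
  obtain ⟨ε, hε, h⟩ := S.exists_lenGap_le hcpa .X
  refine ⟨ε, hε, fun n => ?_⟩
  simp only [labelGap]
  rw [ex_comm]
  refine ex_le_of_support _ fun W _ => ?_
  rw [ex_comm]
  exact ex_le_of_support _ fun W' _ => h n _ _ (by simp) (by simp)

/-- An entry with `α` or `β` true is encrypted under an inactive label of a feed-in wire. By the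
assumption on earlier gates this label is never a plaintext, and since output gates feed nothing it
does not occur in later rounds; it is only a key, and `exists_close_entry` applies. The length gap
arises when the right key is known. It is small on average if that key is drawn in this round; the
active state labels `curF` are fixed here, so their gaps stay in the bound and are averaged later.
-/
theorem exists_close_clearEntry (hcpa : S.CPASecure) (P ℓ : Polynomial ℕ) : ∃ ε, ENegl ε ∧
    ∀ n (z A B : Data) (pre : List (Msg C)) (τ : Bool) (l : List (Tables C × Bool))
      (curF : Fin m → Label n) (t : Tables C) (j₀ : Fin (C.g + m + 1)) (α β : Bool),
      sz z + sz A + sz B + sz pre ≤ P.eval n → l.length ≤ ℓ.eval n →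
      (∀ j, j.val < j₀.val → ∀ a b, t j a b = false) → (α = true ∨ β = true) →
      Close (ε n + ∑ i, labelGap S n (curF i).toList)
        (tableGame S C D n z A B pre τ l curF t)
        (tableGame S C D n z A B pre τ l curF (clearEntry C t j₀ α β)) := by
  obtain ⟨M, -, hM⟩ := exists_sz_messages S C
  obtain ⟨ε₁, hε₁, h₁⟩ := exists_close_entry S C D hcpa
    (P + (ℓ * (M + 1) + 1) + (Polynomial.C s * (4 * .X + 2) + 8 * .X + 5))
  obtain ⟨ε₂, hε₂, h₂⟩ := exists_labelGap_le S hcpa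
  refine ⟨_, hε₁.add hε₂, ?_⟩
  intro n z A B pre τ l curF t j₀ α β hsz hl ht hαβ
  by_cases hval : t j₀ α β = false
  · have : clearEntry C t j₀ α β = t := by
      funext j a b
      unfold clearEntry
      split_ifs with h
      · obtain ⟨rfl, rfl, rfl⟩ := h
        exact hval.symm
      · rfl
    rw [this]
    exact Close.refl _
  rw [Bool.not_eq_false] at hval
  -- The wire whose inactive label plays the secret key. The right wire is preferred, since a secret
  -- inner key avoids the length gap.
  set w₀ : Src m s (C.g + m + 1) := if β then C.lift (C.right j₀) else C.lift (C.left j₀) with hw₀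
  have hw₀gate : ∀ j, w₀ = .gate j → j.val < j₀.val ∧ j.val < C.g := by
    intro j hj
    have key : ∀ w : Src m s C.g, (∀ k, w = .gate k → k.val < j₀.val) → C.lift w = .gate j →
        j.val < j₀.val ∧ j.val < C.g := by
      intro w hw hj
      cases w with
      | mon i => simp [Circuit.lift] at hj
      | sys i => simp [Circuit.lift] at hj
      | gate k =>
        have := hw k rfl
        simp only [Circuit.lift, Circuit.inner, Src.gate.injEq] at hj
        subst hj
        exact ⟨this, k.is_lt⟩
    rw [hw₀] at hj
    split_ifs at hj
    · exact key _ (C.right_lt j₀) hj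
    · exact key _ (C.left_lt j₀) hj
  let κ : (Src m s (C.g + m + 1) × Bool → Label n) → Src m s (C.g + m + 1) → Bool →
      Option (List Bool) := fun f w b =>
    if (w, b) = (w₀, true) then none else some (setActive C curF f w b).toList
  have hκ : ∀ f w b (K : Label n), (setActive C curF (Function.update f (w₀, true) K) w b).toList =
      (κ f w b).getD K.toList := by
    intro f w b K
    rw [setActive_update]
    simp only [κ]
    split_ifs <;> rfl
  have hκlen : ∀ f w b, ∀ k ∈ κ f w b, k.length = n := by
    intro f w b k hk
    simp only [κ] at hk
    split_ifs at hk
    · simp at hk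
    · simp only [Option.mem_def, Option.some.injEq] at hk
      subst hk
      simp
  -- No plaintext is the secret key: the wire `w₀` is at most the output of an earlier gate, and the
  -- table of such a gate yields only active labels.
  have hout : ∀ f K (t' : Tables C), (∀ j, j.val < j₀.val → ∀ a b, t' j a b = false) → ∀ j a b,
      setActive C curF (Function.update f (w₀, true) K) (.gate j) (t' j a b) =
        setActive C curF f (.gate j) (t' j a b) := by
    intro f K t' ht' j a b
    rw [setActive_update, if_neg]
    intro h
    simp only [Prod.mk.injEq] at h
    have := ht' j (hw₀gate j h.1.symm).1 a b
    simp [h.2] at this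
  -- The labels shown in the message and those handed to the next round do not include the secret
  -- key.
  have htail : ∀ f K g, roundTail S C D n z A B pre τ l
      (setActive C curF (Function.update f (w₀, true) K)) g =
        roundTail S C D n z A B pre τ l (setActive C curF f) g := by
    intro f K g
    have e1 : (fun i => setActive C curF (Function.update f (w₀, true) K) (.gate (C.stateGate i))) =
        fun i => setActive C curF f (.gate (C.stateGate i)) := by
      funext i b
      rw [setActive_update, if_neg]
      intro h
      simp only [Prod.mk.injEq] at h
      have := (hw₀gate _ h.1.symm).2
      simp [Circuit.stateGate] at this
    have e2 : ∀ b, setActive C curF (Function.update f (w₀, true) K) (.gate C.flagGate) b =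
        setActive C curF f (.gate C.flagGate) b := by
      intro b
      rw [setActive_update, if_neg]
      intro h
      simp only [Prod.mk.injEq] at h
      have := (hw₀gate _ h.1.symm).2
      simp [Circuit.flagGate] at this
    have e3 : ∀ i, setActive C curF (Function.update f (w₀, true) K) (.sys i) false =
        setActive C curF f (.sys i) false := by
      intro i
      rw [setActive_update, if_neg]
      simp
    simp only [roundTail, labelMsg, e1, e2, e3]
  -- The label `(w₀, true)` is resampled as `K` and drawn after everything that does not depend on
  -- it.
  have hgame : ∀ t' : Tables C, (∀ j, j.val < j₀.val → ∀ a b, t' j a b = false) →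
      tableGame S C D n z A B pre τ l curF t' =
      ex (unif (Src m s (C.g + m + 1) × Bool → Label n)) fun f =>
      ex (messages S C n (fun i => setActive C curF f (.gate (C.stateGate i))) l) fun rest =>
      ex (indep fun _ : Fin (C.g + m + 1) => unif (Equiv.Perm (Fin 4))) fun p =>
      ex (bits n) fun K => ex (indep fun q : Fin (numRows C) => encrypt₂ S n
        ((κ f (C.lift (C.left (finProdFinEquiv.symm q).1))
          (rowBits (finProdFinEquiv.symm q).2).1).getD K.toList)
        ((κ f (C.lift (C.right (finProdFinEquiv.symm q).1))
          (rowBits (finProdFinEquiv.symm q).2).2).getD K.toList)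
        (setActive C curF f (.gate (finProdFinEquiv.symm q).1) (t' (finProdFinEquiv.symm q).1
          (rowBits (finProdFinEquiv.symm q).2).1 (rowBits (finProdFinEquiv.symm q).2).2)).toList)
        fun e => (fun e' => test D n z (view C A B (pre ++ ((fun j i => e' (finProdFinEquiv (j, p j i)),
          labelMsg C τ (setActive C curF f)) : Msg C) :: rest))) fun q => (e q).1 := by
    intro t' ht'
    rw [tableGame, ex_unif_update (w₀, true)]
    refine ex_congr _ fun f => ?_
    rw [ex_comm _ (indep fun _ : Fin (C.g + m + 1) => unif (Equiv.Perm (Fin 4)))]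
    simp only [ex_comm _ (bits n)]
    refine ex_congr _ fun K => ?_
    simp only [htail]
    rw [ex_garbleRound S C n t' _ (roundTail S C D n z A B pre τ l (setActive C curF f))]
    refine ex_congr _ fun p => ?_
    rw [ex_comm (messages S C n _ l)]
    simp only [hκ, hout f K t' ht', roundTail]
  have ht' : ∀ j, j.val < j₀.val → ∀ a b, clearEntry C t j₀ α β j a b = false := by
    intro j hj a b
    unfold clearEntry
    split_ifs
    · rfl
    · exact ht j hj a b
  rw [hgame t ht, hgame _ ht']
  obtain ⟨i₀, hi₀⟩ := exists_rowBits α β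
  let q₀ : Fin (numRows C) := finProdFinEquiv (j₀, i₀)
  let gap : (Src m s (C.g + m + 1) × Bool → Label n) → ℝ≥0∞ := fun f =>
    S.lenGap n (setActive C curF f (C.lift (C.right j₀)) false).toList
      (setActive C curF f (.gate j₀) true).toList (setActive C curF f (.gate j₀) false).toList
  -- The known right key is an active label. On a state wire it is prescribed by `curF`; on any
  -- other wire it is uniform and independent of the two plaintext labels of gate `j₀`.
  have hgap : ex (unif (Src m s (C.g + m + 1) × Bool → Label n)) gap ≤
      ε₂ n + ∑ i, labelGap S n (curF i).toList := by
    have hne : C.lift (C.right j₀) ≠ .gate j₀ := C.lift_ne_gate (C.right_lt j₀)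
    rw [ex_unif_update (.gate j₀, true), ex_unif_update (.gate j₀, false)]
    have e0 : ((.gate j₀, false) : Src m s (C.g + m + 1) × Bool) ≠ (.gate j₀, true) := by simp
    rcases hw : C.lift (C.right j₀) with i | i | k
    · refine le_trans (ex_le_of_support _ fun f _ => ?_)
        ((Finset.single_le_sum (fun _ _ => zero_le) (Finset.mem_univ i)).trans le_add_self)
      rw [labelGap, ex_comm]
      refine ex_mono _ fun W => ex_mono _ fun W' => ?_
      simp only [gap, hw, setActive, Function.update_self, Function.update_of_ne e0]
      exact le_rfl
    · refine le_trans ?_ ((h₂ n).trans le_self_add)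
      rw [ex_unif_update (.sys i, false)]
      refine ex_le_of_support _ fun f _ => ex_mono _ fun k => ?_
      rw [labelGap, ex_comm]
      refine ex_mono _ fun W => ex_mono _ fun W' => ?_
      have e1 : ((.sys i, false) : Src m s (C.g + m + 1) × Bool) ≠ (.gate j₀, true) := by simp
      have e2 : ((.sys i, false) : Src m s (C.g + m + 1) × Bool) ≠ (.gate j₀, false) := by simp
      simp only [gap, hw, setActive, Function.update_self, Function.update_of_ne e0,
        Function.update_of_ne e1, Function.update_of_ne e2]
      exact le_rfl
    · refine le_trans ?_ ((h₂ n).trans le_self_add)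
      have hk : k ≠ j₀ := fun h => hne (by rw [hw, h])
      rw [ex_unif_update (.gate k, false)]
      refine ex_le_of_support _ fun f _ => ex_mono _ fun K => ?_
      rw [labelGap, ex_comm]
      refine ex_mono _ fun W => ex_mono _ fun W' => ?_
      have e1 : ((.gate k, false) : Src m s (C.g + m + 1) × Bool) ≠ (.gate j₀, true) := by simp
      have e2 : ((.gate k, false) : Src m s (C.g + m + 1) × Bool) ≠ (.gate j₀, false) := by simp [hk]
      simp only [gap, hw, setActive, Function.update_self, Function.update_of_ne e0,
        Function.update_of_ne e1, Function.update_of_ne e2]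
      exact le_rfl
  have hfinal := Close.ex_fun (unif (Src m s (C.g + m + 1) × Bool → Label n))
    (e := fun f => ε₁ n + gap f) (fun f _ => Close.ex (messages S C n
      (fun i => setActive C curF f (.gate (C.stateGate i))) l) fun rest hrest =>
      Close.ex (indep fun _ : Fin (C.g + m + 1) => unif (Equiv.Perm (Fin 4))) fun p _ => by
        have hc := h₁ n z A B pre rest p (labelMsg C τ (setActive C curF f)) q₀
          (fun q => κ f (C.lift (C.left (finProdFinEquiv.symm q).1))
            (rowBits (finProdFinEquiv.symm q).2).1)
          (fun q => κ f (C.lift (C.right (finProdFinEquiv.symm q).1))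
            (rowBits (finProdFinEquiv.symm q).2).2)
          (fun q => (setActive C curF f (.gate (finProdFinEquiv.symm q).1)
            (t (finProdFinEquiv.symm q).1 (rowBits (finProdFinEquiv.symm q).2).1
              (rowBits (finProdFinEquiv.symm q).2).2)).toList)
          (setActive C curF f (.gate j₀) false).toList
          (fun q => hκlen f _ _) (fun q => hκlen f _ _) (fun q => by simp) (by simp)
          (by
            simp only [q₀, Equiv.symm_apply_apply, hi₀, κ]
            cases β
            · left
              obtain rfl : α = true := by simpa using hαβ
              simp [hw₀]
            · right
              simp [hw₀])
          (by
            obtain ⟨hlen, hsz'⟩ := hM n _ l rest hrest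
            have e1 := sz_list_le hsz'
            have e2 := sz_labelMsg_le C τ (setActive C curF f)
            have e3 : rest.length * (M.eval n + 1) ≤ ℓ.eval n * (M.eval n + 1) :=
              Nat.mul_le_mul_right _ (hlen.trans_le hl)
            simp only [Polynomial.eval_add, Polynomial.eval_mul, Polynomial.eval_C,
              Polynomial.eval_one, Polynomial.eval_X, Polynomial.eval_ofNat]
            omega)
          _ (fun e => rfl)
        have hx : (Function.update (fun q => (setActive C curF f (.gate (finProdFinEquiv.symm q).1)
            (t (finProdFinEquiv.symm q).1 (rowBits (finProdFinEquiv.symm q).2).1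
              (rowBits (finProdFinEquiv.symm q).2).2)).toList) q₀
            (setActive C curF f (.gate j₀) false).toList) =
          fun q : Fin (numRows C) => (setActive C curF f (.gate (finProdFinEquiv.symm q).1)
            (clearEntry C t j₀ α β (finProdFinEquiv.symm q).1
              (rowBits (finProdFinEquiv.symm q).2).1
              (rowBits (finProdFinEquiv.symm q).2).2)).toList := by
          funext q
          obtain ⟨⟨j, i⟩, rfl⟩ := finProdFinEquiv.surjective q
          by_cases hq : (j, i) = (j₀, i₀)
          · obtain ⟨rfl, rfl⟩ := Prod.mk.inj hq
            simp [q₀, clearEntry, hi₀]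
          · have hq' : finProdFinEquiv (j, i) ≠ q₀ := fun h => hq (finProdFinEquiv.injective h)
            rw [Function.update_of_ne hq']
            simp only [Equiv.symm_apply_apply, clearEntry]
            rw [if_neg]
            rintro ⟨rfl, h1, h2⟩
            refine hq (Prod.ext rfl (rowBits_injective ?_))
            rw [hi₀, ← h1, ← h2]
        rw [hx] at hc
        refine hc.mono ?_
        gcongr
        simp only [q₀, Equiv.symm_apply_apply, hi₀, hval]
        -- If the inner key is the secret one there is no gap. Otherwise `β = false`, and the inner
        -- key is the active label of the right wire.
        by_cases hr : ((C.lift (C.right j₀), β) : Src m s (C.g + m + 1) × Bool) = (w₀, true)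
        · simp only [κ, if_pos hr]
          exact zero_le
        · have hβ : β = false := by
            by_contra h
            rw [Bool.not_eq_false] at h
            exact hr (by simp [hw₀, h])
          simp only [κ, if_neg hr, gap]
          rw [hβ])
  refine hfinal.mono ?_
  rw [ex_add, ex_const]
  exact (add_le_add le_rfl hgap).trans (le_of_eq (add_assoc _ _ _).symm)

end OpenSpec

end PPM

/-! ### Hybrids over gates and rounds -/

namespace PPM

open Code (code)
open Decode (decode decode_code)
open scoped ENNReal

namespace OpenSpec

variable {m s : ℕ} (S : EncScheme) (C : Circuit m s) (D : PPT (Data × Data) Bool)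

/-- Clearing the truth tables of the first gates. -/
def clearBelow (N : ℕ) (t : Tables C) : Tables C := fun j a b => if j.val < N then false else t j a b

/-- Truth tables that are constantly `false`. -/
def zeroTables : Tables C := fun _ _ _ => false

/-- Each gate needs three steps, because its entry `(false, false)` is already `false`. Proceeding
in topological order ensures that all earlier tables are constant whenever `exists_close_clearEntry`
is applied. -/
theorem exists_close_zeroTables (hcpa : S.CPASecure) (P ℓ : Polynomial ℕ) : ∃ ε, ENegl ε ∧
    ∀ n (z A B : Data) (pre : List (Msg C)) (τ : Bool) (l : List (Tables C × Bool))
      (curF : Fin m → Label n) (t : Tables C),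
      sz z + sz A + sz B + sz pre ≤ P.eval n → l.length ≤ ℓ.eval n →
      (∀ j, t j false false = false) →
      Close ((3 * (C.g + m + 1) : ℕ) * (ε n + ∑ i, labelGap S n (curF i).toList))
        (tableGame S C D n z A B pre τ l curF t)
        (tableGame S C D n z A B pre τ l curF (zeroTables C)) := by
  obtain ⟨ε, hε, h⟩ := exists_close_clearEntry S C D hcpa P ℓ
  refine ⟨ε, hε, fun n z A B pre τ l curF t hsz hl ht => ?_⟩
  set E := ε n + ∑ i, labelGap S n (curF i).toList
  have key : ∀ N, N ≤ C.g + m + 1 → Close ((3 * N : ℕ) * E)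
      (tableGame S C D n z A B pre τ l curF t)
      (tableGame S C D n z A B pre τ l curF (clearBelow C N t)) := by
    intro N
    induction N with
    | zero =>
      intro _
      have : clearBelow C 0 t = t := by
        funext j a b
        simp [clearBelow]
      rw [this]
      exact Close.refl _
    | succ N ih =>
      intro hN
      let j₀ : Fin (C.g + m + 1) := ⟨N, hN⟩
      have h0 : ∀ j : Fin (C.g + m + 1), j.val < j₀.val → ∀ a b, clearBelow C N t j a b = false := by
        intro j hj a b
        exact if_pos hj
      have hstep : ∀ (t' : Tables C) (α β : Bool),
          (∀ j : Fin (C.g + m + 1), j.val < j₀.val → ∀ a b, t' j a b = false) →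
          ∀ j : Fin (C.g + m + 1), j.val < j₀.val → ∀ a b, clearEntry C t' j₀ α β j a b = false := by
        intro t' α β ht' j hj a b
        unfold clearEntry
        split_ifs
        · rfl
        · exact ht' j hj a b
      let t₁ := clearEntry C (clearBelow C N t) j₀ false true
      let t₂ := clearEntry C t₁ j₀ true false
      have h1 := hstep _ false true h0
      have h2 := hstep t₁ true false h1
      have c1 := h n z A B pre τ l curF _ j₀ false true hsz hl h0 (by simp)
      have c2 := h n z A B pre τ l curF t₁ j₀ true false hsz hl h1 (by simp)
      have c3 := h n z A B pre τ l curF t₂ j₀ true true hsz hl h2 (by simp)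
      have e : clearEntry C t₂ j₀ true true = clearBelow C (N + 1) t := by
        funext j a b
        by_cases hj : j = j₀
        · subst hj
          have h1 : ¬ j₀.val < N := lt_irrefl N
          have h2 : j₀.val < N + 1 := Nat.lt_succ_self N
          cases a <;> cases b <;> simp [t₂, t₁, clearEntry, clearBelow, h1, h2, ht]
        · have h1 : j.val < N + 1 ↔ j.val < N := by
            have : j.val ≠ N := fun h' => hj (Fin.ext h')
            omega
          simp [t₂, t₁, clearEntry, clearBelow, hj, h1]
      rw [e] at c3
      refine ((((ih (by omega)).trans c1).trans c2).trans c3).mono (le_of_eq ?_)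
      push_cast
      ring
  have hfin := key _ le_rfl
  have e : clearBelow C (C.g + m + 1) t = zeroTables C := by
    funext j a b
    exact if_pos j.is_lt
  rwa [e] at hfin

/-- Labels with given values of index `false` and `true`. -/
def merge {n : ℕ} {ι : Type} (f t : ι → Label n) : ι → Bool → Label n := fun i b =>
  if b then t i else f i

theorem ex_unif_apply_true {ι X : Type} [Fintype ι] [DecidableEq ι] [Fintype X] [Nonempty X]
    (φ : (ι → X) → ℝ≥0∞) :
    (ex (unif (ι → Bool → X)) fun f => φ fun i => f i true) = ex (unif (ι → X)) φ := by
  rw [ex_unif_curry]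
  exact ex_unif_comp_injective (fun i => (i, true)) (fun i j h => by simpa using h) φ

/-- Only the inactive state labels are averaged. The active ones stay fixed, as the simulated
transfer views and the preceding messages depend on them. -/
theorem ex_messages_cons (n : ℕ) (z A B : Data) (pre : List (Msg C)) (y : Tables C × Bool)
    (l : List (Tables C × Bool)) (curF : Fin m → Label n) :
    (ex (unif (Fin m → Label n)) fun curT => ex (messages S C n (merge curF curT) (y :: l)) fun x =>
      test D n z (view C A B (pre ++ x))) = tableGame S C D n z A B pre y.2 l curF y.1 := by
  have h := ex_unif_curry (ι := Src m s (C.g + m + 1)) (X := Label n) fun f =>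
    ex (garbleRound S C n y.1 (setActive C curF fun w => f w.1 w.2)) fun G =>
      roundTail S C D n z A B pre y.2 l (setActive C curF fun w => f w.1 w.2) fun j => (G j).1
  refine Eq.trans ?_ h
  rw [ex_unif_wires, ← ex_unif_apply_true]
  refine ex_congr _ fun cur => ?_
  simp only [messages, ex_bind, ex_map]
  refine ex_congr _ fun sysL => ex_congr _ fun gateL => ?_
  have e : (setActive C curF fun w => Src.val cur sysL gateL w.1 w.2) =
      Src.val (merge curF fun i => cur i true) sysL gateL := by
    funext w b
    cases w <;> cases b <;> rfl
  rw [e]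
  rfl

/-- The values of a uniform function on the range of an injection can be drawn afresh. It serves to
redraw the inactive labels of the state outputs. -/
theorem ex_unif_extend {ι κ X : Type} [Fintype ι] [DecidableEq ι] [Fintype κ]
    [DecidableEq κ] [Fintype X] [Nonempty X] (f : κ → ι) (hf : Function.Injective f)
    (φ : (ι → X) → ℝ≥0∞) :
    ex (unif (ι → X)) φ =
      ex (unif (ι → X)) fun g => ex (unif (κ → X)) fun h => φ (Function.extend f h g) := by
  classical
  let e := (Equiv.piEquivPiSubtypeProd (fun i => i ∈ Set.range f) fun _ => X).symm
  have he : ∀ a b i, e (a, b) i = if h : i ∈ Set.range f then a ⟨i, h⟩ else b ⟨i, h⟩ :=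
    fun a b i => rfl
  rw [ex_unif_equiv e, ex_unif_equiv e, ex_unif_prod, ex_unif_prod, ex_comm,
    ex_comm (unif ({i // i ∈ Set.range f} → X))]
  refine ex_congr _ fun b => ?_
  let A := Equiv.arrowCongr (Equiv.ofInjective f hf) (Equiv.refl X)
  have key : ∀ a h, Function.extend f h (e (a, b)) = e (A h, b) := by
    intro a h
    funext i
    by_cases hi : i ∈ Set.range f
    · obtain ⟨k, rfl⟩ := hi
      rw [hf.extend_apply, he, dif_pos (Set.mem_range_self k)]
      change h k = h ((Equiv.ofInjective f hf).symm ⟨f k, _⟩)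
      rw [Equiv.ofInjective_symm_apply]
    · rw [Function.extend_apply' _ _ _ hi, he, he, dif_neg hi, dif_neg hi]
  rw [ex_unif_equiv A]
  simp only [key, ex_const]

/-- With constant tables an inactive output label is never encrypted, so it matters only where it
serves as a key. -/
theorem garbleRound_congr {n : ℕ} {lab lab' : Src m s (C.g + m + 1) → Bool → Label n}
    (hl : ∀ j, lab (C.lift (C.left j)) = lab' (C.lift (C.left j)))
    (hr : ∀ j, lab (C.lift (C.right j)) = lab' (C.lift (C.right j)))
    (ho : ∀ j, lab (.gate j) false = lab' (.gate j) false) :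
    garbleRound S C n (zeroTables C) lab = garbleRound S C n (zeroTables C) lab' := by
  refine indep_congr fun j => ?_
  simp only [garble, zeroTables, hl, hr, ho]

/-- Rounds with the actual truth tables are indistinguishable from rounds with constant tables. -/
theorem exists_close_messages (hcpa : S.CPASecure) (P ℓ : Polynomial ℕ) : ∃ ε ε', ENegl ε ∧ ENegl ε' ∧
    (∀ n, (ex (bits n) fun k => labelGap S n k.toList) ≤ ε' n) ∧
    ∃ M : Polynomial ℕ, ∀ n (z A B : Data) (l : List (Tables C × Bool)) (pre : List (Msg C))
      (curF : Fin m → Label n),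
      sz z + sz A + sz B ≤ P.eval n → pre.length + l.length ≤ ℓ.eval n →
      (∀ x ∈ pre, sz x ≤ M.eval n) → (∀ y ∈ l, ∀ j, y.1 j false false = false) →
      Close (l.length * ε n + (3 * (C.g + m + 1) : ℕ) * ∑ i, labelGap S n (curF i).toList)
        (ex (unif (Fin m → Label n)) fun curT => ex (messages S C n (merge curF curT) l) fun x =>
          test D n z (view C A B (pre ++ x)))
        (ex (unif (Fin m → Label n)) fun curT => ex (messages S C n (merge curF curT)
          (l.map fun y => (zeroTables C, y.2))) fun x => test D n z (view C A B (pre ++ x))) := by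
  obtain ⟨M, hM, -⟩ := exists_sz_messages S C
  obtain ⟨ε₁, hε₁, h₁⟩ := exists_close_zeroTables S C D hcpa (P + (ℓ * (M + 1) + 1)) ℓ
  obtain ⟨ε₂, hε₂, h₂⟩ := exists_labelGap_le S hcpa
  -- Cost of one round: its hybrids contribute `ε₁`, and the averaged length gaps of the `m` active
  -- state labels passed to the next round contribute `m * ε₂`. The gaps of the given labels `curF`
  -- are listed separately in the bound.
  refine ⟨fun n => (3 * (C.g + m + 1) : ℕ) * (ε₁ n + m * ε₂ n), ε₂,
    (hε₁.add (hε₂.const_mul m)).const_mul _, hε₂, h₂, M, ?_⟩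
  intro n z A B l
  set c : ℝ≥0∞ := ((3 * (C.g + m + 1) : ℕ) : ℝ≥0∞)
  induction l with
  | nil => intro pre curF _ _ _ _; exact Close.refl _
  | cons y l ih =>
    intro pre curF hsz hlen hpre hl
    have hsz' : sz z + sz A + sz B + sz pre ≤ (P + (ℓ * (M + 1) + 1)).eval n := by
      have e1 := sz_list_le hpre
      have e2 : pre.length * (M.eval n + 1) ≤ ℓ.eval n * (M.eval n + 1) :=
        Nat.mul_le_mul_right _ (by omega)
      simp only [Polynomial.eval_add, Polynomial.eval_mul, Polynomial.eval_one]
      omega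
    have hl' : l.length ≤ ℓ.eval n := by
      simp only [List.length_cons] at hlen
      omega
    rw [List.map_cons, ex_messages_cons, ex_messages_cons]
    have step1 := h₁ n z A B pre y.2 l curF y.1 hsz' hl' (hl y (by simp))
    let lab' : (Src m s (C.g + m + 1) × Bool → Label n) → Fin m → Label n := fun f i =>
      f (.gate (C.stateGate i), false)
    -- Once the tables are constant, the inactive state output labels occur in later rounds only.
    -- Redrawn as `T`, they give the averaged form that the induction hypothesis requires, with the
    -- current message appended to `pre`.
    have expand : ∀ l, tableGame S C D n z A B pre y.2 l curF (zeroTables C) =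
        ex (unif (Src m s (C.g + m + 1) × Bool → Label n)) fun f =>
        ex (garbleRound S C n (zeroTables C) (setActive C curF f)) fun G =>
        ex (unif (Fin m → Label n)) fun T => ex (messages S C n (merge (lab' f) T) l) fun rest =>
          test D n z (view C A B ((pre ++ [((fun j => (G j).1,
            labelMsg C y.2 (setActive C curF f)) : Msg C)]) ++ rest)) := by
      intro l
      have hinj : Function.Injective fun i : Fin m =>
          ((.gate (C.stateGate i), true) : Src m s (C.g + m + 1) × Bool) := by
        intro i j h
        exact C.stateGate_injective (by simpa using h)
      rw [tableGame, ex_unif_extend _ hinj]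
      refine ex_congr _ fun f => ?_
      rw [ex_comm (garbleRound S C n (zeroTables C) (setActive C curF f))]
      refine ex_congr _ fun T => ?_
      have hext : ∀ w b, (∀ i, (w, b) ≠ (.gate (C.stateGate i), true)) →
          setActive C curF (Function.extend (fun i : Fin m =>
            ((.gate (C.stateGate i), true) : Src m s (C.g + m + 1) × Bool)) T f) w b =
          setActive C curF f w b := by
        intro w b hw
        have : ∀ w b, (∀ i, (w, b) ≠ (.gate (C.stateGate i), true)) → Function.extend (fun i : Fin m =>
            ((.gate (C.stateGate i), true) : Src m s (C.g + m + 1) × Bool)) T f (w, b) = f (w, b) := by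
          intro w b hw
          exact Function.extend_apply' _ _ _ fun ⟨i, hi⟩ => hw i hi.symm
        cases w <;> cases b <;> simp only [setActive] <;> exact this _ _ hw
      have hlift : ∀ w : Src m s C.g, setActive C curF (Function.extend (fun i : Fin m =>
            ((.gate (C.stateGate i), true) : Src m s (C.g + m + 1) × Bool)) T f) (C.lift w) =
          setActive C curF f (C.lift w) := by
        intro w
        funext b
        refine hext _ _ fun i h => ?_
        exact C.lift_ne_gate_of_le (j := C.stateGate i) w (by simp [Circuit.stateGate])
          (Prod.mk.inj h).1
      rw [garbleRound_congr S C (fun j => hlift _) (fun j => hlift _) fun j => hext _ _ (by simp)]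
      refine ex_congr _ fun G => ?_
      have hmsg : labelMsg C y.2 (setActive C curF (Function.extend (fun i : Fin m =>
            ((.gate (C.stateGate i), true) : Src m s (C.g + m + 1) × Bool)) T f)) =
          labelMsg C y.2 (setActive C curF f) := by
        have hflag : ∀ b, setActive C curF (Function.extend (fun i : Fin m =>
            ((.gate (C.stateGate i), true) : Src m s (C.g + m + 1) × Bool)) T f) (.gate C.flagGate) b =
          setActive C curF f (.gate C.flagGate) b := by
          intro b
          refine hext _ _ fun i h => ?_
          have := (Prod.mk.inj h).1
          simp only [Circuit.stateGate, Circuit.flagGate, Src.gate.injEq, Fin.ext_iff,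
            Fin.val_last] at this
          have := i.is_lt
          omega
        simp only [labelMsg, hflag]
        refine Prod.ext (funext fun i => ?_) rfl
        exact congrArg List.Vector.toList (hext (.sys i) false (by simp))
      rw [roundTail, hmsg]
      have hst : (fun i => setActive C curF (Function.extend (fun i : Fin m =>
            ((.gate (C.stateGate i), true) : Src m s (C.g + m + 1) × Bool)) T f)
              (.gate (C.stateGate i))) = merge (lab' f) T := by
        funext i b
        cases b
        · rw [hext _ _ (by simp)]
          rfl
        · exact hinj.extend_apply _ _ i
      rw [hst]
      simp only [List.append_assoc, List.singleton_append]
    have step2 : Close (l.length * (c * (ε₁ n + m * ε₂ n)) + c * (m * ε₂ n))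
        (tableGame S C D n z A B pre y.2 l curF (zeroTables C))
        (tableGame S C D n z A B pre y.2 (l.map fun y => (zeroTables C, y.2)) curF (zeroTables C)) := by
      rw [expand, expand]
      have := Close.ex_fun (unif (Src m s (C.g + m + 1) × Bool → Label n)) (e := fun f =>
        l.length * (c * (ε₁ n + m * ε₂ n)) + c * ∑ i, labelGap S n (lab' f i).toList)
        fun f _ => Close.ex (garbleRound S C n (zeroTables C) (setActive C curF f)) fun G hG =>
          ih (pre ++ [((fun j => (G j).1, labelMsg C y.2 (setActive C curF f)) : Msg C)]) (lab' f) hsz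
            (by simp only [List.length_append, List.length_cons, List.length_nil] at hlen ⊢; omega)
            (by
              intro x hx
              rcases List.mem_append.1 hx with hx | hx
              · exact hpre x hx
              · rw [List.mem_singleton.1 hx]
                exact hM n _ _ _ G hG)
            (fun y' hy' => hl y' (by simp [hy']))
      refine this.mono ?_
      rw [ex_add, ex_const, ex_mul_left, ex_finset_sum]
      gcongr
      refine (Finset.sum_le_card_nsmul _ _ (ε₂ n) fun i _ => ?_).trans (by simp)
      -- The active state labels of the next round are uniform labels of this round, so their length
      -- gaps are small on average.
      rw [ex_unif_update (.gate (C.stateGate i), false)]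
      refine ex_le_of_support _ fun f _ => ?_
      simp only [lab', Function.update_self]
      exact h₂ n
    refine (step1.trans step2).mono (le_of_eq ?_)
    simp only [List.length_cons, Nat.cast_add, Nat.cast_one]
    ring

end OpenSpec

end PPM

/-! ### Replacing several independent views -/

namespace PPM

open Code (code)
open Decode (decode decode_code)
open scoped ENNReal

/-- A hybrid argument for independent samples. -/
theorem close_indep {α : Type} {k : ℕ} (p q : Fin k → PMF α) (ε : ℝ≥0∞) (φ : (Fin k → α) → ℝ≥0∞)
    (h : ∀ i (f : Fin k → α), (∀ j, f j ∈ (p j).support ∨ f j ∈ (q j).support) →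
      Close ε (ex (p i) fun a => φ (Function.update f i a)) (ex (q i) fun a => φ (Function.update f i a))) :
    Close (k * ε) (ex (indep p) φ) (ex (indep q) φ) := by
  let r : ℕ → Fin k → PMF α := fun c j => if j.val < c then q j else p j
  have key : ∀ c, c ≤ k → Close (c * ε) (ex (indep p) φ) (ex (indep (r c)) φ) := by
    intro c
    induction c with
    | zero => intro _; exact Close.of_eq (by simp [r])
    | succ c ih =>
      intro hc
      let i : Fin k := ⟨c, hc⟩
      have e1 : r c = Function.update (r c) i (p i) := by
        have : p i = r c i := by simp [r, i]
        rw [this, Function.update_eq_self]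
      have e2 : r (c + 1) = Function.update (r c) i (q i) := by
        funext j
        by_cases hj : j = i
        · subst hj; simp [r, i]
        · have h1 : j.val < c + 1 ↔ j.val < c := by
            have : j.val ≠ c := fun h' => hj (Fin.ext h')
            omega
          simp [r, hj, h1]
      have h3 : Close ε (ex (indep (r c)) φ) (ex (indep (r (c + 1))) φ) := by
        rw [e2, ex_indep_update]
        rw [e1, ex_indep_update, ← e1]
        refine Close.ex _ fun f hf => h i f fun j => ?_
        have := (mem_support_indep _ f).1 hf j
        simp only [r] at this
        split_ifs at this
        · exact Or.inr this
        · exact Or.inl this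
      refine ((ih (by omega)).trans h3).mono (le_of_eq ?_)
      push_cast
      ring
  have e : r k = q := by
    funext j
    exact if_pos j.is_lt
  rw [← e]
  exact key k le_rfl

theorem prTrue_bind_dist (D : PPT (Data × Data) Bool) (p : PMF Data) (n : ℕ) (z : Data) :
    prTrue (p.bind fun v => D.dist n (z, v)) = (ex p fun v => OpenSpec.test D n z v).toReal := by
  rw [prTrue, bind_true]
  simp only [OpenSpec.test_eq]

theorem ex_test_le_one (D : PPT (Data × Data) Bool) (p : PMF Data) (n : ℕ) (z : Data) :
    (ex p fun v => OpenSpec.test D n z v) ≤ 1 := ex_le_one _ fun _ => OpenSpec.test_le_one ..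

/-- Indistinguishability with a bound that is uniform in the advice. -/
theorem Indist.exists_close {ι : ℕ → Type} {X Y : (n : ℕ) → ι n → PMF Data} (h : Indist X Y)
    (D : PPT (Data × Data) Bool) (B : Polynomial ℕ) : ∃ ε, ENegl ε ∧ ∀ n i w, sz w ≤ B.eval n →
      Close (ε n) (ex (X n i) fun v => OpenSpec.test D n w v)
        (ex (Y n i) fun v => OpenSpec.test D n w v) := by
  have : Inhabited Data := ⟨.leaf⟩
  let a : ℕ → Data → (n : ℕ) → ι n → ℝ := fun _ w n i =>
    |(ex (X n i) fun v => OpenSpec.test D n w v).toReal -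
      (ex (Y n i) fun v => OpenSpec.test D n w v).toReal|
  have ha : ∀ n w i, a n w n i ≤ 1 := by
    intro n w i
    have e : ∀ p : PMF Data, 0 ≤ (ex p fun v => OpenSpec.test D n w v).toReal ∧
        (ex p fun v => OpenSpec.test D n w v).toReal ≤ 1 := fun p =>
      ⟨ENNReal.toReal_nonneg, ENNReal.toReal_le_of_le_ofReal zero_le_one (by
        simpa using ex_test_le_one D p n w)⟩
    have h1 := e (X n i)
    have h2 := e (Y n i)
    simp only [a]
    rw [abs_le]
    constructor <;> linarith
  have hbdd : ∀ n w, BddAbove (Set.range fun i => a n w n i) := fun n w =>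
    ⟨1, by rintro _ ⟨i, rfl⟩; exact ha n w i⟩
  -- The bound given by `Indist` is already uniform in the input. The supremum over inputs is taken
  -- first, so that only the advice has to be made uniform.
  obtain ⟨ε, hε, hε0, h1⟩ := exists_uniform_negligible B (fun n w => ⨆ i, a n w n i)
    (fun n w => Real.iSup_le (ha n w) zero_le_one) (by
      intro w hw
      obtain ⟨ε, hε, h1⟩ := h D ⟨w, hw⟩
      refine hε.max_zero.mono (fun n => abs_nonneg _) fun n => ?_
      rw [abs_of_nonneg (Real.iSup_nonneg fun i => abs_nonneg _)]
      refine Real.iSup_le (fun i => ?_) (abs_nonneg _)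
      have := h1 n i
      simp only [prTrue_bind_dist] at this
      exact this.trans (le_abs_self _))
  refine ⟨fun n => ENNReal.ofReal (ε n), ENegl.ofReal hε, fun n i w hw => ?_⟩
  exact Close.of_abs (ex_test_le_one ..) (ex_test_le_one ..)
    ((le_ciSup (hbdd n w) i).trans (h1 n w hw))

theorem code_pi_code {α : Type} [Code α] {k : ℕ} (f : Fin k → α) :
    code (fun i => code (f i)) = code f := by
  change code (List.ofFn fun i => code (f i)) = code (List.ofFn f)
  have : (List.ofFn fun i => code (f i)) = (List.ofFn f).map code := by
    rw [List.map_ofFn]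
    rfl
  rw [this, code_map_code]

theorem sz_code {α : Type} [Code α] (a : α) : sz (code a) = sz a := rfl

/-- A distinguisher for one out of several views, the other ones being given. -/
noncomputable def viewDistinguisher {m : ℕ} (D : PPT (Data × Data) Bool) (F : Data → Data → Data)
    (hF : PolyTime fun x : Data × Data => F x.1 x.2) (i : Fin m) : PPT (Data × Data) Bool where
  run x := let w : Data × Data × (Fin m → Data) := decode x.2.1.1
    D.run (x.1, (w.1, F w.2.1 (code fun j => if j = i then x.2.1.2 else w.2.2 j)), x.2.2)
  polyTime := by
    refine D.polyTime.comp (.prodMk (by fun_prop) (.prodMk (.prodMk (by fun_prop)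
      (hF.comp (f := fun x => _) (.prodMk (by fun_prop) (.coded (.pi fun j => ?_))))) (by fun_prop)))
    by_cases h : j = i
    · simp only [h, if_true]
      fun_prop
    · simp only [h, if_false]
      fun_prop
  coins := D.coins

/-- Replacing several independent views that are indistinguishable. -/
theorem Indist.exists_close_indep {ι : ℕ → Type} {X Y : (n : ℕ) → ι n → PMF Data} (h : Indist X Y)
    (m : ℕ) (D : PPT (Data × Data) Bool) {F : Data → Data → Data}
    (hF : PolyTime fun x : Data × Data => F x.1 x.2) (B : Polynomial ℕ) : ∃ ε, ENegl ε ∧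
    ∀ n (z w : Data) (idx : Fin m → ι n), sz z + sz w ≤ B.eval n →
      (∀ j v, v ∈ (X n (idx j)).support ∨ v ∈ (Y n (idx j)).support → sz v ≤ B.eval n) →
      Close (ε n) (ex (indep fun j => X n (idx j)) fun v => OpenSpec.test D n z (F w (code v)))
        (ex (indep fun j => Y n (idx j)) fun v => OpenSpec.test D n z (F w (code v))) := by
  -- One reduction for each position. The other views are part of its advice, some real and some
  -- simulated.
  choose ε hε h1 using fun i : Fin m =>
    h.exists_close (viewDistinguisher D F hF i) (B + Polynomial.C m * (B + 1) + 3)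
  refine ⟨_, (ENegl.sum Finset.univ fun i _ => hε i).const_mul m, fun n z w idx hzw hv => ?_⟩
  refine close_indep _ _ _ _ fun i f hf => ?_
  have h2 := h1 i n (idx i) (code (z, w, f)) (by
    have e1 : sz f ≤ m * (B.eval n + 1) + 1 := sz_pi_le fun j => hv j _ (hf j)
    rw [sz_code, sz_pair, sz_pair]
    simp only [Polynomial.eval_add, Polynomial.eval_mul, Polynomial.eval_C, Polynomial.eval_one,
      Polynomial.eval_ofNat]
    omega)
  have e : ∀ v, OpenSpec.test (viewDistinguisher D F hF i) n (code (z, w, f)) v =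
      OpenSpec.test D n z (F w (code (Function.update f i v))) := by
    intro v
    have : (fun j => if j = i then v else f j) = Function.update f i v := by
      funext j
      rw [Function.update_apply]
    simp only [OpenSpec.test, viewDistinguisher, decode_code, this]
  simp only [e] at h2
  exact h2.mono (Finset.single_le_sum (f := fun i => ε i n) (fun _ _ => zero_le) (Finset.mem_univ i))

end PPM

/-! ### Closeness of real and ideal views -/

namespace PPM

open Code (code)
open Decode (decode decode_code)
open scoped ENNReal

theorem PPT.exists_sz_le {α β : Type} [Code α] [Code β] (A : PPT α β) (B : Polynomial ℕ) :
    ∃ Q : Polynomial ℕ, ∀ n a, sz a ≤ B.eval n → ∀ v ∈ (A.dist n a).support, sz v ≤ Q.eval n := by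
  obtain ⟨P, hP⟩ := A.polyTime.sz_le
  refine ⟨P.comp (2 * .X + B + 4 * A.coins + 10), fun n a ha v hv => ?_⟩
  rw [PPT.dist, PMF.mem_support_map_iff] at hv
  obtain ⟨r, -, rfl⟩ := hv
  refine (hP (n, a, r.toList)).trans ?_
  rw [Polynomial.eval_comp]
  refine eval_mono _ ?_
  have := sz_bits_le r.toList
  simp only [sz_pair, sz_nat, Polynomial.eval_add, Polynomial.eval_mul, Polynomial.eval_X,
    Polynomial.eval_ofNat, List.Vector.toList_length] at *
  omega

theorem sz_bool_le (b : Bool) : sz b ≤ 3 := by cases b <;> simp [sz, Data.size]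

namespace OTProtocol

variable (OT : OTProtocol)

theorem messages_bound (n : ℕ) (x : List Bool × List Bool) (β : Bool) (rS rR : List Bool) (i : ℕ) :
    ((OT.messages n x β rS rR i).1.length = i ∧ (OT.messages n x β rS rR i).2.length = i) ∧
    (∀ a ∈ (OT.messages n x β rS rR i).1, a.length ≤ OT.msgLen.eval n) ∧
    ∀ a ∈ (OT.messages n x β rS rR i).2, a.length ≤ OT.msgLen.eval n := by
  induction i with
  | zero => simp [messages]
  | succ i ih =>
    obtain ⟨⟨h1, h2⟩, h3, h4⟩ := ih
    refine ⟨by simp [messages, h1, h2], fun a ha => ?_, fun a ha => ?_⟩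
    · simp only [messages, List.mem_append, List.mem_singleton] at ha
      rcases ha with ha | rfl
      · exact h3 a ha
      · simp
    · simp only [messages, List.mem_append, List.mem_singleton] at ha
      rcases ha with ha | rfl
      · exact h4 a ha
      · simp

theorem exists_sz_view_le : ∃ Q : Polynomial ℕ, ∀ n (x₀ x₁ : List.Vector Bool n) β,
    ∀ e ∈ (OT.exec n (x₀.toList, x₁.toList) β).support,
      sz e.sndView ≤ Q.eval n ∧ sz e.rcvView ≤ Q.eval n := by
  refine ⟨8 * .X + 4 * OT.sndCoins + 4 * OT.rcvCoins + OT.rounds * (4 * OT.msgLen + 2) + 20,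
    fun n x₀ x₁ β e he => ?_⟩
  simp only [exec, monad_bind_eq, monad_pure_eq, PMF.mem_support_bind_iff,
    PMF.mem_support_pure_iff] at he
  obtain ⟨rS, -, rR, -, rfl⟩ := he
  obtain ⟨⟨h1, h2⟩, h3, h4⟩ := OT.messages_bound n (x₀.toList, x₁.toList) β rS.toList rR.toList
    (OT.rounds.eval n)
  have e1 := sz_list_le (B := 4 * OT.msgLen.eval n + 1) fun a ha =>
    (sz_bits_le a).trans (by have := h3 a ha; omega)
  have e2 := sz_list_le (B := 4 * OT.msgLen.eval n + 1) fun a ha =>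
    (sz_bits_le a).trans (by have := h4 a ha; omega)
  rw [h1] at e1
  rw [h2] at e2
  have e3 := sz_bits_le rS.toList
  have e4 := sz_bits_le rR.toList
  have e5 := sz_bits_le x₀.toList
  have e6 := sz_bits_le x₁.toList
  have e7 := sz_bool_le β
  simp only [sz_pair, Polynomial.eval_add, Polynomial.eval_mul, Polynomial.eval_X,
    Polynomial.eval_ofNat, List.Vector.toList_length, add_assoc, Nat.reduceAdd] at *
  constructor <;> omega

end OTProtocol

theorem ex_unif_bool {X : Type} [Fintype X] [Nonempty X] (φ : (Bool → X) → ℝ≥0∞) :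
    ex (unif (Bool → X)) φ = ex (unif X) fun a => ex (unif X) fun b => φ fun c => if c then b else a := by
  rw [ex_unif_equiv (Equiv.boolArrowEquivProd X).symm, ex_unif_prod]
  refine ex_congr _ fun a => ex_congr _ fun b => congrArg φ ?_
  funext c
  cases c <;> rfl

namespace OpenSpec

variable {m s : ℕ} (S : EncScheme) (C : Circuit m s) (OT : OTProtocol)

theorem ex_unif_merge {n : ℕ} {ι : Type} [Fintype ι] [DecidableEq ι]
    (φ : (ι → Bool → Label n) → ℝ≥0∞) :
    ex (unif (ι → Bool → Label n)) φ = ex (unif (ι → Label n)) fun f => ex (unif (ι → Label n)) fun t =>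
      φ (merge f t) := by
  let e : ((ι → Label n) × (ι → Label n)) ≃ (ι → Bool → Label n) :=
    { toFun := fun x => merge x.1 x.2
      invFun := fun f => (fun i => f i false, fun i => f i true)
      left_inv := fun x => rfl
      right_inv := fun f => by
        funext i b
        cases b <;> rfl }
  rw [ex_unif_equiv e, ex_unif_prod]
  rfl

/-- The ideal view of the monitor. -/
noncomputable def monIdeal (simR : PPT (Bool × List Bool) Data) (n : ℕ)
    (a : (Fin m → Bool) × List Bool) : PMF Data :=
  (unif (Fin m → Bool → Label n)).bind fun cur =>
  (indep fun i => simR.dist n (a.1 i, (cur i false).toList)).bind fun v =>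
  (messages S C n cur (a.2.map fun τ => (zeroTables C, τ))).map fun x => view C (code a.1) (code v) x

/-- The transfer views have to be replaced first: a real receiver view may depend on both labels,
whereas the simulated one uses only the active label. After that the inactive state labels are free
to be secret keys, and the truth tables can be made constant. -/
theorem exists_close_monView (hcpa : S.CPASecure) {simR : PPT (Bool × List Bool) Data}
    (hR : Indist (ι := fun n => List.Vector Bool n × List.Vector Bool n × Bool)
      (fun n i => simR.dist n (i.2.2, if i.2.2 then i.2.1.toList else i.1.toList))
      (fun n i => (OT.exec n (i.1.toList, i.2.1.toList) i.2.2).map fun e => code e.rcvView))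
    (D : PPT (Data × Data) Bool) (P ℓ : Polynomial ℕ) : ∃ ε, ENegl ε ∧
    ∀ n (z : Data) (μ : Fin m → Bool) (σ : List (Fin s → Bool)), sz z ≤ P.eval n →
      σ.length = ℓ.eval n →
      Close (ε n) (ex (monIdeal S C simR n (μ, C.flags μ σ)) fun v => test D n z v)
        (ex (protocol S OT C n μ σ) fun e => test D n z e.monView) := by
  obtain ⟨Q, hQ⟩ := OT.exists_sz_view_le
  obtain ⟨Q', hQ'⟩ := simR.exists_sz_le (4 * .X + 10)
  obtain ⟨M, -, hM⟩ := exists_sz_messages S C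
  obtain ⟨ε₁, hε₁, h₁⟩ := hR.exists_close_indep m D
    (F := fun w v => .node w.fst (.node v w.snd)) (by fun_prop)
    (P + Polynomial.C (m * 4) + ℓ * (M + 1) + 10 + Q + Q')
  obtain ⟨ε₂, ε₃, hε₂, hε₃, h₃, M', h₂⟩ := exists_close_messages S C D hcpa
    (P + Polynomial.C (m * 4) + Polynomial.C m * (Q' + 1) + 10) ℓ
  refine ⟨_, (hε₁.add (hε₂.poly_mul ℓ)).add ((hε₃.const_mul m).const_mul (3 * (C.g + m + 1))), ?_⟩
  intro n z μ σ hz hσ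
  have hμ : sz μ ≤ m * 4 + 1 := sz_pi_le fun i => sz_bool_le _
  have hsim : ∀ (b : Bool) (k : Label n), ∀ v ∈ (simR.dist n (b, k.toList)).support,
      sz v ≤ Q'.eval n := by
    intro b k
    refine hQ' n _ ?_
    have e1 := sz_bits_le k.toList
    have e2 := sz_bool_le b
    simp only [sz_pair, Polynomial.eval_add, Polynomial.eval_mul, Polynomial.eval_X,
      Polynomial.eval_ofNat, List.Vector.toList_length] at *
    omega
  -- The messages of the rounds do not depend on the outputs of the transfers. The transfer views
  -- can hence be drawn last, for fixed labels and messages.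
  have hreal : (ex (protocol S OT C n μ σ) fun e => test D n z e.monView) =
      ex (unif (Fin m → Bool → Label n)) fun cur =>
      ex (messages S C n cur (allTables C μ σ)) fun x =>
      ex (indep fun i => (OT.exec n ((flip μ cur i false).toList, (flip μ cur i true).toList) (μ i)).map
        fun e => code e.rcvView) fun v => test D n z (view C (code μ) (code v) x) := by
    simp only [protocol, ex_bind', ex_pure]
    rw [ex_unif_flip μ]
    refine ex_congr _ fun cur => ?_
    rw [ex_comm, ← ex_comm]
    have h4 : ∀ t : Fin m → OTExecution, (ex (rounds S C n (flip μ cur)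
        (fun i => some (t i).output) σ) fun x => test D n z (code (μ, (fun i => (t i).rcvView), x.1))) =
        ex (messages S C n cur (allTables C μ σ)) fun x =>
          test D n z (view C (code μ) (code fun i => code (t i).rcvView) x) := by
      intro t
      rw [rounds_eq_messages S C n μ σ (flip μ cur) (fun i => some (t i).output) fun x =>
        test D n z (code (μ, (fun i => (t i).rcvView), x)), flip_flip μ cur]
      refine ex_congr _ fun x => ?_
      rw [code_pi_code]
      rfl
    simp only [h4]
    rw [ex_comm]
    refine ex_congr _ fun x => ?_
    rw [indep_map, ex_map]
  have hmid : Close (ε₁ n) (ex (unif (Fin m → Bool → Label n)) fun cur =>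
      ex (messages S C n cur (allTables C μ σ)) fun x =>
      ex (indep fun i => simR.dist n (μ i, (cur i false).toList)) fun v =>
        test D n z (view C (code μ) (code v) x))
      (ex (protocol S OT C n μ σ) fun e => test D n z e.monView) := by
    rw [hreal]
    refine Close.ex _ fun cur _ => Close.ex _ fun x hx => ?_
    have h4 := h₁ n z (.node (code μ) (code x))
      (fun i => (flip μ cur i false, flip μ cur i true, μ i)) (by
        obtain ⟨e1, e2⟩ := hM n cur _ x hx
        rw [length_allTables, hσ] at e1
        have e3 := sz_list_le e2
        rw [e1] at e3
        have e4 : sz (Data.node (code μ) (code x)) = sz μ + sz x + 1 := rfl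
        rw [e4]
        simp only [Polynomial.eval_add, Polynomial.eval_mul, Polynomial.eval_C, Polynomial.eval_one,
          Polynomial.eval_ofNat]
        omega) (by
        rintro j v (hv | hv)
        · have h5 : sz v ≤ Q'.eval n := by
            dsimp only at hv
            split_ifs at hv <;> exact hsim _ _ v hv
          simp only [Polynomial.eval_add]
          omega
        · rw [PMF.mem_support_map_iff] at hv
          obtain ⟨e, he, rfl⟩ := hv
          have h5 := (hQ n _ _ _ e he).2
          rw [sz_code]
          simp only [Polynomial.eval_add]
          omega)
    have e1 : ∀ i, (if μ i then (flip μ cur i true).toList else (flip μ cur i false).toList) =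
        (cur i false).toList := by
      intro i
      cases h : μ i <;> simp [flip, h]
    simp only [e1] at h4
    exact h4
  -- The active state labels and the simulated views that use them are drawn outside; the inactive
  -- labels are averaged inside, as `exists_close_messages` demands.
  have hsplit : ∀ l : List (Tables C × Bool), (ex (unif (Fin m → Bool → Label n)) fun cur =>
      ex (messages S C n cur l) fun x =>
      ex (indep fun i => simR.dist n (μ i, (cur i false).toList)) fun v =>
        test D n z (view C (code μ) (code v) x)) =
      ex (unif (Fin m → Label n)) fun f => ex (indep fun i => simR.dist n (μ i, (f i).toList)) fun v =>
      ex (unif (Fin m → Label n)) fun t => ex (messages S C n (merge f t) l) fun x =>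
        test D n z (view C (code μ) (code v) ([] ++ x)) := by
    intro l
    rw [ex_unif_merge]
    refine ex_congr _ fun f => ?_
    rw [ex_comm (indep fun i => simR.dist n (μ i, (f i).toList))]
    refine ex_congr _ fun t => ?_
    rw [ex_comm]
    rfl
  -- With constant tables, the list of tables and flags retains nothing but the flags.
  have hideal : (ex (monIdeal S C simR n (μ, C.flags μ σ)) fun v => test D n z v) =
      ex (unif (Fin m → Bool → Label n)) fun cur =>
      ex (messages S C n cur ((allTables C μ σ).map fun y => (zeroTables C, y.2))) fun x =>
      ex (indep fun i => simR.dist n (μ i, (cur i false).toList)) fun v =>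
        test D n z (view C (code μ) (code v) x) := by
    simp only [monIdeal, ex_bind, ex_map]
    refine ex_congr _ fun cur => ?_
    rw [ex_comm, ← map_snd_allTables, List.map_map]
    rfl
  have hlast : Close (ℓ.eval n * ε₂ n + (3 * (C.g + m + 1) : ℕ) * (m * ε₃ n))
      (ex (unif (Fin m → Bool → Label n)) fun cur =>
      ex (messages S C n cur (allTables C μ σ)) fun x =>
      ex (indep fun i => simR.dist n (μ i, (cur i false).toList)) fun v =>
        test D n z (view C (code μ) (code v) x))
      (ex (monIdeal S C simR n (μ, C.flags μ σ)) fun v => test D n z v) := by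
    rw [hideal, hsplit, hsplit]
    have h4 := Close.ex_fun (unif (Fin m → Label n)) (e := fun f => ℓ.eval n * ε₂ n +
      (3 * (C.g + m + 1) : ℕ) * ∑ i, labelGap S n (f i).toList) fun f _ =>
      Close.ex (indep fun i => simR.dist n (μ i, (f i).toList)) fun v hv => by
        have h5 := h₂ n z (code μ) (code v) (allTables C μ σ) [] f (by
          have e1 : sz v ≤ m * (Q'.eval n + 1) + 1 :=
            sz_pi_le fun i => hsim _ _ _ ((mem_support_indep _ v).1 hv i)
          rw [sz_code, sz_code]
          simp only [Polynomial.eval_add, Polynomial.eval_mul, Polynomial.eval_C,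
            Polynomial.eval_one, Polynomial.eval_ofNat]
          omega) (by simp [length_allTables, hσ]) (by simp) (allTables_false C μ σ)
        rw [length_allTables, hσ] at h5
        exact h5
    refine h4.mono ?_
    rw [ex_add, ex_const, ex_mul_left, ex_finset_sum]
    gcongr
    refine (Finset.sum_le_card_nsmul _ _ (ε₃ n) fun i _ => ?_).trans (by simp)
    rw [ex_unif_update i]
    refine ex_le_of_support _ fun f _ => ?_
    simp only [Function.update_self]
    exact h₃ n
  refine (hlast.symm.trans hmid).mono (le_of_eq ?_)
  ring

/-- The random choices of the system. -/
noncomputable def sysRandom (n : ℕ) : (Fin m → Bool → Label n) → List (Fin s → Bool) → PMF (List Data)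
  | _, [] => PMF.pure []
  | cur, x :: σ => (sysRound S C n cur x).bind fun a => (sysRandom n a.1 σ).map fun d => a.2.2 :: d

theorem rounds_eq_sysRandom (n : ℕ) (σ : List (Fin s → Bool)) (cur : Fin m → Bool → Label n)
    (st : Fin m → Option (List Bool)) (φ : List Data → ℝ≥0∞) :
    (ex (rounds S C n cur st σ) fun z => φ z.2.1) = ex (sysRandom S C n cur σ) φ := by
  induction σ generalizing cur st φ with
  | nil => simp [rounds, sysRandom]
  | cons x σ ih =>
    rw [rounds_cons]
    simp only [sysRandom, ex_bind, ex_map]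
    exact ex_congr _ fun a => ih _ _ fun d => φ (a.2.2 :: d)

theorem code_pi_congr {α β : Type} [Code α] [Code β] {k : ℕ} {f : Fin k → α} {g : Fin k → β}
    (h : ∀ i, code (f i) = code (g i)) : code f = code g := by
  rw [← code_pi_code f, ← code_pi_code g]
  simp only [h]

theorem sz_labels_le {n k : ℕ} (f : Fin k → Bool → Label n) : sz f ≤ k * (8 * n + 4) + 1 := by
  refine sz_pi_le (B := 8 * n + 3) fun i => ?_
  have e : sz (f i) = sz (f i false).toList + sz (f i true).toList + 1 := rfl
  have e1 := sz_bits_le (f i false).toList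
  have e2 := sz_bits_le (f i true).toList
  simp only [List.Vector.toList_length] at e1 e2
  omega

theorem exists_sz_sysRandom : ∃ M : Polynomial ℕ, ∀ n (cur : Fin m → Bool → Label n)
    (σ : List (Fin s → Bool)), ∀ d ∈ (sysRandom S C n cur σ).support,
      d.length = σ.length ∧ ∀ x ∈ d, sz x ≤ M.eval n := by
  obtain ⟨Q, hQ⟩ := S.exists_support_length_le .X
  obtain ⟨Q', hQ'⟩ := S.exists_support_length_le Q
  refine ⟨Polynomial.C s * (8 * .X + 4) + Polynomial.C (C.g + m + 1) * (8 * .X + 4) +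
    Polynomial.C (C.g + m + 1) * (4 * (4 * Q + 4 * Q' + 4) + 100) + 10, fun n cur σ => ?_⟩
  induction σ generalizing cur with
  | nil => simp [sysRandom]
  | cons y σ ih =>
    intro d hd
    simp only [sysRandom, PMF.mem_support_bind_iff, PMF.mem_support_map_iff] at hd
    obtain ⟨a, ha, d, hd, rfl⟩ := hd
    obtain ⟨h1, h2⟩ := ih _ d hd
    refine ⟨by simp [h1], fun x hx => ?_⟩
    rcases List.mem_cons.1 hx with rfl | hx
    swap
    · exact h2 x hx
    simp only [sysRound, monad_bind_eq, monad_pure_eq, PMF.mem_support_bind_iff,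
      PMF.mem_support_pure_iff, garbleGate_eq] at ha
    obtain ⟨sysL, -, gateL, -, G, hG, rfl⟩ := ha
    rw [mem_support_indep] at hG
    have e1 : sz (fun j => (G j).2) ≤ (C.g + m + 1) *
        ((4 * (4 * Q.eval n + 4 * Q'.eval n + 3 + 1) + 1 + 50) + 1) + 1 := by
      refine sz_pi_le fun j => ?_
      have h3 := hG j
      simp only [garble, PMF.mem_support_bind_iff, PMF.mem_support_map_iff] at h3
      obtain ⟨e, he, p, -, h4⟩ := h3
      rw [mem_support_indep] at he
      rw [← h4, sz_code, sz_pair]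
      have e2 : sz (fun i => (e i).2) ≤ 4 * (4 * Q.eval n + 4 * Q'.eval n + 3 + 1) + 1 := by
        refine sz_pi_le fun i => ?_
        obtain ⟨c, hc, d, hd, h5⟩ := mem_support_encrypt₂ (he i)
        have h6 := hQ n _ _ (by simp) (by simp) c hc
        have h7 := hQ' n _ _ (by simp) h6.1 d hd
        rw [h5]
        have e3 := sz_bits_le c.2
        have e4 := sz_bits_le d.2
        rw [sz_pair]
        omega
      have e3 : sz (fun i => p i) ≤ 4 * (9 + 1) + 1 := by
        refine sz_pi_le fun i => ?_
        have : sz (p i) = sz (p i).val := rfl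
        rw [this, sz_nat]
        omega
      omega
    have e2 := sz_labels_le sysL
    have e3 := sz_labels_le gateL
    rw [sz_code, sz_pair, sz_pair]
    simp only [Polynomial.eval_add, Polynomial.eval_mul, Polynomial.eval_C, Polynomial.eval_X,
      Polynomial.eval_ofNat]
    have e4 : (C.g + m + 1) * ((4 * (4 * Q.eval n + 4 * Q'.eval n + 3 + 1) + 1 + 50) + 1) ≤
        (C.g + m + 1) * (4 * (4 * Q.eval n + 4 * Q'.eval n + 4) + 100) :=
      Nat.mul_le_mul_left _ (by omega)
    omega

/-- The ideal view of the system. -/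
noncomputable def sysIdeal (simS : PPT (List Bool × List Bool) Data) (n : ℕ)
    (σ : List (Fin s → Bool)) : PMF Data :=
  (unif (Fin m → Bool → Label n)).bind fun init =>
  (indep fun i => simS.dist n ((init i false).toList, (init i true).toList)).bind fun v =>
  (sysRandom S C n init σ).map fun d => code (σ, init, v, d)

/-- Apart from the transfers the System receives nothing, and its random choices in the rounds do
not depend on the Monitor. For fixed choices only the sender views have to be simulated. -/
theorem exists_close_sysView {simS : PPT (List Bool × List Bool) Data}
    (hS : Indist (ι := fun n => List.Vector Bool n × List.Vector Bool n × Bool)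
      (fun n i => simS.dist n (i.1.toList, i.2.1.toList))
      (fun n i => (OT.exec n (i.1.toList, i.2.1.toList) i.2.2).map fun e => code e.sndView))
    (D : PPT (Data × Data) Bool) (P ℓ : Polynomial ℕ) : ∃ ε, ENegl ε ∧
    ∀ n (z : Data) (μ : Fin m → Bool) (σ : List (Fin s → Bool)), sz z ≤ P.eval n →
      σ.length = ℓ.eval n →
      Close (ε n) (ex (sysIdeal S C simS n σ) fun v => test D n z v)
        (ex (protocol S OT C n μ σ) fun e => test D n z e.sysView) := by
  obtain ⟨Q, hQ⟩ := OT.exists_sz_view_le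
  obtain ⟨Q', hQ'⟩ := simS.exists_sz_le (8 * .X + 10)
  obtain ⟨M, hM⟩ := exists_sz_sysRandom S C
  obtain ⟨ε₁, hε₁, h₁⟩ := hS.exists_close_indep m D
    (F := fun w v => .node w.fst (.node w.snd.fst (.node v w.snd.snd))) (by fun_prop)
    (P + ℓ * Polynomial.C (s * 4 + 2) + Polynomial.C m * (8 * .X + 4) + ℓ * (M + 1) + 10 + Q + Q')
  refine ⟨_, hε₁, ?_⟩
  intro n z μ σ hz hσ
  simp only [sysIdeal, protocol, ex_bind', ex_pure, ex_bind, ex_map]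
  refine Close.ex _ fun init _ => ?_
  have h4 : ∀ t : Fin m → OTExecution, (ex (rounds S C n init
      (fun i => some (t i).output) σ) fun x =>
        test D n z (code (σ, init, (fun i => (t i).sndView), x.2.1))) =
      ex (sysRandom S C n init σ) fun d =>
        test D n z (.node (code σ) (.node (code init) (.node (code fun i => code (t i).sndView) (code d)))) := by
    intro t
    rw [rounds_eq_sysRandom S C n σ init (fun i => some (t i).output) fun d =>
      test D n z (code (σ, init, (fun i => (t i).sndView), d))]
    refine ex_congr _ fun x => ?_
    rw [code_pi_code]
    rfl
  simp only [h4]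
  rw [ex_comm, ex_comm (indep fun i => OT.exec n ((init i false).toList, (init i true).toList) (μ i))]
  refine Close.ex _ fun d hd => ?_
  have h5 := h₁ n z (.node (code σ) (.node (code init) (code d)))
    (fun i => (init i false, init i true, μ i)) (by
      obtain ⟨e1, e2⟩ := hM n init σ d hd
      rw [hσ] at e1
      have e3 := sz_list_le e2
      rw [e1] at e3
      have e4 : sz (Data.node (code σ) (.node (code init) (code d))) =
        sz σ + (sz init + sz d + 1) + 1 := rfl
      have e5 := sz_labels_le init
      have e6 : sz σ ≤ σ.length * (s * (3 + 1) + 1 + 1) + 1 :=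
        sz_list_le fun x _ => sz_pi_le fun i => sz_bool_le _
      rw [hσ] at e6
      rw [e4]
      simp only [Polynomial.eval_add, Polynomial.eval_mul, Polynomial.eval_C, Polynomial.eval_one,
        Polynomial.eval_ofNat, Polynomial.eval_X]
      simp only [add_assoc, Nat.reduceAdd] at e6 e5 e3 ⊢
      omega) (by
      rintro j v (hv | hv)
      · have h5 : sz v ≤ Q'.eval n := by
          refine hQ' n _ ?_ v hv
          have e1 := sz_bits_le (init j false).toList
          have e2 := sz_bits_le (init j true).toList
          simp only [sz_pair, Polynomial.eval_add, Polynomial.eval_mul, Polynomial.eval_X,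
            Polynomial.eval_ofNat, List.Vector.toList_length] at *
          omega
        simp only [Polynomial.eval_add]
        omega
      · rw [PMF.mem_support_map_iff] at hv
        obtain ⟨e, he, rfl⟩ := hv
        have h5 := (hQ n _ _ _ e he).1
        rw [sz_code]
        simp only [Polynomial.eval_add]
        omega)
  simp only [indep_map, ex_map] at h5
  exact h5

end OpenSpec

end PPM

/-! ### Efficient sampling of the ideal views -/

namespace PPM

open Code (code)
open Decode (decode decode_code)
open scoped ENNReal

namespace OpenSpec

variable {m s : ℕ} (S : EncScheme) (C : Circuit m s)

/-- Labels as lists. -/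
def listLabels {n : ℕ} {ι : Type} (f : ι → Bool → Label n) : ι → Bool → List Bool :=
  fun i b => (f i b).toList

/-- Uniformly random labels for `k` wires, as lists. -/
noncomputable def randomLabels (k n : ℕ) : PMF (Fin k → Bool → List Bool) :=
  (unif (Fin k → Bool → Label n)).map listLabels

theorem length_randomLabels {k n : ℕ} {f : Fin k → Bool → List Bool}
    (hf : f ∈ (randomLabels k n).support) (i : Fin k) (b : Bool) : (f i b).length = n := by
  rw [randomLabels, PMF.mem_support_map_iff] at hf
  obtain ⟨g, -, rfl⟩ := hf
  simp [listLabels]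

theorem samp_randomLabels {α : Type} [Code α] {G : ℕ → α → Prop} (k : ℕ) :
    Samp G fun n _ => randomLabels k n := by
  have h1 : Samp G fun n _ => lbits ((.X : Polynomial ℕ).eval n) := Samp.lbits _
  have h2 : Samp (fun _ _ => True) fun n (_ : α × List Bool) => lbits ((.X : Polynomial ℕ).eval n) :=
    Samp.lbits _
  have h3 := h1.bind (h2.map (f := fun x (b : Bool) => if b then x.2.2 else x.2.1.2)
    (.boolPi fun b => by cases b <;> simp <;> fun_prop)) fun _ _ _ _ _ => trivial
  refine (Samp.indep (k := k) fun _ => h3).congr fun n a _ φ => ?_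
  rw [randomLabels, ex_map, unif_pi]
  refine (ex_indep_comp_map _ (fun (g : Bool → Label n) b => (g b).toList) φ).trans ?_
  refine congrArg (fun p => ex (indep p) φ) (funext fun _ => pmf_ext_ex fun ψ => ?_)
  simp only [ex_map, ex_unif_bool, ex_bind, ex_lbits, Polynomial.eval_X, bits]
  refine ex_congr _ fun x => ex_congr _ fun y => congrArg ψ (funext fun b => ?_)
  cases b <;> rfl

/-- A garbled gate for labels that are given as lists. -/
noncomputable def garbleList (n : ℕ) (t : Bool → Bool → Bool) (x : (Bool → List Bool) ×
    (Bool → List Bool) × (Bool → List Bool)) : PMF ((Fin 4 → List Bool) × Data) :=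
  (indep fun i => encrypt₂ S n (x.1 (rowBits i).1) (x.2.1 (rowBits i).2)
    (x.2.2 (t (rowBits i).1 (rowBits i).2))).bind fun e =>
  (unif (Equiv.Perm (Fin 4))).map fun p =>
    (fun i => (e (p i)).1, code ((fun i => (e i).2), (fun i => p i)))

theorem samp_encrypt₂ : Samp
    (fun n (x : List Bool × List Bool × List Bool) => x.2.1.length ≤ n ∧ x.2.2.length ≤ n)
    fun n x => encrypt₂ S n x.1 x.2.1 x.2.2 := by
  obtain ⟨Q, hQ⟩ := S.exists_support_length_le .X
  have h1 : Samp (fun n (x : List Bool × List Bool × List Bool) => x.2.1.length ≤ n ∧ x.2.2.length ≤ n)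
      fun n x => S.encrypt n x.2.1 x.2.2 :=
    (S.samp_encrypt .X).comp (g := fun z : ℕ × List Bool × List Bool × List Bool =>
      (z.2.2.1, z.2.2.2)) (by fun_prop) fun n x h => by simpa using h.2
  have h2 : Samp (fun n (y : (List Bool × List Bool × List Bool) × List Bool × List Bool) =>
      y.2.1.length ≤ Q.eval n) fun n y => S.encrypt n y.1.1 y.2.1 :=
    (S.samp_encrypt Q).comp (g := fun z : ℕ × (List Bool × List Bool × List Bool) ×
      List Bool × List Bool => (z.2.1.1, z.2.2.1)) (by fun_prop) fun n x h => h
  refine (h1.bind (h2.map (f := fun z => (z.2.2.1, (z.2.1.2.2, z.2.2.2))) (by fun_prop))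
    fun n x h c hc => (hQ n _ _ h.1 (by simpa using h.2) c hc).1).congr fun n x _ φ => ?_
  simp [ex_encrypt₂, ex_bind]

theorem samp_garbleList (t : Bool → Bool → Bool) : Samp
    (fun n (x : (Bool → List Bool) × (Bool → List Bool) × (Bool → List Bool)) =>
      (∀ b, (x.2.1 b).length ≤ n) ∧ ∀ b, (x.2.2 b).length ≤ n)
    fun n x => garbleList S n t x := by
  have h1 : ∀ i : Fin 4, Samp
      (fun n (x : (Bool → List Bool) × (Bool → List Bool) × (Bool → List Bool)) =>
        (∀ b, (x.2.1 b).length ≤ n) ∧ ∀ b, (x.2.2 b).length ≤ n)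
      fun n x => encrypt₂ S n (x.1 (rowBits i).1) (x.2.1 (rowBits i).2)
        (x.2.2 (t (rowBits i).1 (rowBits i).2)) := fun i =>
    (samp_encrypt₂ S).comp (g := fun z : ℕ × (Bool → List Bool) × (Bool → List Bool) ×
      (Bool → List Bool) => (z.2.1 (rowBits i).1, z.2.2.1 (rowBits i).2,
        z.2.2.2 (t (rowBits i).1 (rowBits i).2)))
      (.prodMk (.boolApply (by fun_prop) _) (.prodMk (.boolApply (by fun_prop) _)
        (.boolApply (by fun_prop) _))) fun n x h => ⟨h.1 _, h.2 _⟩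
  -- A permutation is sampled as the tuple of its values, which has the same code. As `4!` is not a
  -- power of two, the sampler is only statistically close to uniform.
  have h2 : Samp (fun _ _ => True) fun _ (_ : ((Bool → List Bool) × (Bool → List Bool) ×
      (Bool → List Bool)) × (Fin 4 → List Bool × List Bool × List Bool)) =>
      (unif (Equiv.Perm (Fin 4))).map fun p i => (p i).val := Samp.unif_finite _ _
  refine ((Samp.indep h1).bind (h2.map (f := fun z => ((fun i : Fin 4 =>
    ((List.ofFn z.2.1.2).getD (z.2.2 i) ([], [], [])).1), code ((fun i => (z.2.1.2 i).2), z.2.2)))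
    (by fun_prop)) fun _ _ _ _ _ => trivial).congr fun n x _ φ => ?_
  simp only [garbleList, ex_bind, ex_map]
  refine ex_congr _ fun e => ex_congr _ fun p => congrArg φ ?_
  refine Prod.ext (funext fun i => ?_) ?_
  · simp only
    rw [getD_ofFn _ (p i).is_lt]
  · simp only [code_pair]
    rw [code_pi_congr (f := fun i => p i) (g := fun i => (p i).val) fun i => rfl]

/-- The labels of a feed-in wire. -/
theorem _root_.PPM.PolyTime.srcVal {α X : Type} [Code α] [Code X] {k : ℕ} {a : α → Fin m → X}
    {b : α → Fin s → X} {c : α → Fin k → X} (ha : PolyTime a) (hb : PolyTime b) (hc : PolyTime c)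
    (w : Src m s k) : PolyTime fun x => w.val (a x) (b x) (c x) := by
  cases w with
  | mon i => exact ha.apply i
  | sys i => exact hb.apply i
  | gate i => exact hc.apply i

/-- The labels of the gates, the labels of the observation wires and the garbled gates of a round. -/
abbrev RoundData (C : Circuit m s) : Type :=
  (Fin (C.g + m + 1) → Bool → List Bool) × (Fin s → Bool → List Bool) ×
    (Fin (C.g + m + 1) → (Fin 4 → List Bool) × Data)

/-- A round in which the gates are garbled according to given truth tables. -/
noncomputable def roundData (t : Tables C) (n : ℕ) (cur : Fin m → Bool → List Bool) :
    PMF (RoundData C) :=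
  (randomLabels s n).bind fun a => (randomLabels (C.g + m + 1) n).bind fun b =>
  (indep fun j => garbleList S n (t j) (Src.val cur a b (C.lift (C.left j)),
    Src.val cur a b (C.lift (C.right j)), b j)).map fun G => (b, a, G)

theorem samp_roundData (t : Tables C) : Samp
    (fun n (cur : Fin m → Bool → List Bool) => ∀ i b, (cur i b).length ≤ n)
    (roundData S C t) := by
  have h1 : Samp (fun n (cur : Fin m → Bool → List Bool) => ∀ i b, (cur i b).length ≤ n)
    fun n _ => randomLabels s n := samp_randomLabels _
  have h2 : Samp (fun n (y : (Fin m → Bool → List Bool) × (Fin s → Bool → List Bool)) =>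
      (∀ i b, (y.1 i b).length ≤ n) ∧ ∀ i b, (y.2 i b).length ≤ n)
    fun n _ => randomLabels (C.g + m + 1) n := samp_randomLabels _
  have h3 : ∀ j, Samp (fun n (y : ((Fin m → Bool → List Bool) × (Fin s → Bool → List Bool)) ×
        (Fin (C.g + m + 1) → Bool → List Bool)) =>
      ((∀ i b, (y.1.1 i b).length ≤ n) ∧ ∀ i b, (y.1.2 i b).length ≤ n) ∧
        ∀ i b, (y.2 i b).length ≤ n)
      fun n y => garbleList S n (t j) (Src.val y.1.1 y.1.2 y.2 (C.lift (C.left j)),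
        Src.val y.1.1 y.1.2 y.2 (C.lift (C.right j)), y.2 j) := fun j =>
    (samp_garbleList S (t j)).comp (g := fun z : ℕ × ((Fin m → Bool → List Bool) ×
        (Fin s → Bool → List Bool)) × (Fin (C.g + m + 1) → Bool → List Bool) =>
      (Src.val z.2.1.1 z.2.1.2 z.2.2 (C.lift (C.left j)),
        Src.val z.2.1.1 z.2.1.2 z.2.2 (C.lift (C.right j)), z.2.2 j))
      (.prodMk (.srcVal (by fun_prop) (by fun_prop) (by fun_prop) _)
        (.prodMk (.srcVal (by fun_prop) (by fun_prop) (by fun_prop) _) (by fun_prop)))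
      (by
        rintro n y ⟨⟨e1, e2⟩, e3⟩
        refine ⟨fun b => ?_, fun b => e3 j b⟩
        dsimp only
        cases C.lift (C.right j)
        · exact e1 _ b
        · exact e2 _ b
        · exact e3 _ b)
  refine (h1.bind (h2.bind ((Samp.indep h3).map (f := fun z => (z.2.1.2, z.2.1.1.2, z.2.2))
    (by fun_prop)) fun n y h b hb => ⟨h, fun i c => (length_randomLabels hb i c).le⟩)
    fun n y h a ha => ⟨h, fun i c => (length_randomLabels ha i c).le⟩).congr fun n y _ φ => ?_
  simp only [roundData, ex_bind, ex_map]

/-- The labels of the state input wires of the next round. -/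
def nextLabels (x : ℕ × RoundData C) : Fin m → Bool → List Bool :=
  fun i b => (x.2.1 (C.stateGate i) b).take x.1

/-- A sequence of rounds, each with an output that depends on an entry of a list. -/
noncomputable def chain {δ β : Type} (t : Tables C) (out : δ × RoundData C → β) (n : ℕ) :
    (Fin m → Bool → List Bool) → List δ → PMF (List β)
  | _, [] => PMF.pure []
  | cur, x :: l => (roundData S C t n cur).bind fun o =>
      (chain t out n (nextLabels C (n, o)) l).map fun z => out (x, o) :: z

/-- `Samp.loop` computes the next state from the output of a step. Each step therefore also outputs
its round data, which are dropped at the end. -/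
theorem samp_chain {δ β : Type} [Code δ] [Code β] (t : Tables C) {out : δ × RoundData C → β}
    (hout : PolyTime out) (L : Polynomial ℕ) : Samp
    (fun n (y : (Fin m → Bool → List Bool) × List δ) =>
      (∀ i b, (y.1 i b).length ≤ n) ∧ y.2.length ≤ L.eval n)
    fun n y => chain S C t out n y.1 y.2 := by
  have h1 : Samp (fun n (y : Unit × (Fin m → Bool → List Bool) × δ) =>
      ∀ i b, (y.2.1 i b).length ≤ n) fun n y => (roundData S C t n y.2.1).map fun o =>
        (o, out (y.2.2, o)) :=
    ((samp_roundData S C t).comp (g := fun z : ℕ × Unit × (Fin m → Bool → List Bool) × δ => z.2.2.1)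
      (by fun_prop) fun n y h => h).map (f := fun z : ℕ × (Unit × (Fin m → Bool → List Bool) × δ) ×
        RoundData C => (z.2.2, out (z.2.1.2.2, z.2.2))) (by fun_prop)
  have h2 := h1.loop (g := fun x => nextLabels C (x.1, x.2.1))
    (by unfold nextLabels; fun_prop) (Polynomial.C m * (8 * .X + 4) + 1) L
    (by
      intro n o
      have h : ∀ i, sz (nextLabels C (n, o.1) i) ≤ 8 * n + 3 := by
        intro i
        have e : sz (nextLabels C (n, o.1) i) = sz (nextLabels C (n, o.1) i false) +
          sz (nextLabels C (n, o.1) i true) + 1 := rfl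
        have e1 := sz_bits_le (nextLabels C (n, o.1) i false)
        have e2 := sz_bits_le (nextLabels C (n, o.1) i true)
        have e3 : (nextLabels C (n, o.1) i false).length ≤ n := by simp [nextLabels]
        have e4 : (nextLabels C (n, o.1) i true).length ≤ n := by simp [nextLabels]
        omega
      simpa [add_assoc] using sz_pi_le h)
    (by
      intro n e st x _ o _ x' _ i b
      simp [nextLabels])
  have h3 := (h2.comp (g := fun z : ℕ × (Fin m → Bool → List Bool) × List δ => ((), z.2.1, z.2.2))
    (G' := fun n y => (∀ i b, (y.1 i b).length ≤ n) ∧ y.2.length ≤ L.eval n)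
    (by fun_prop) fun n y h => ⟨fun x _ => h.1, h.2⟩).map
    (f := fun z => z.2.2.map Prod.snd) (by fun_prop)
  refine h3.congr fun n y hy φ => ?_
  clear hy h1 h2 h3
  obtain ⟨cur, l⟩ := y
  rw [ex_map]
  dsimp only
  induction l generalizing cur φ with
  | nil => simp [chain, loopDist]
  | cons x l ih =>
    simp only [chain, loopDist, ex_bind, ex_map, List.map_cons]
    exact ex_congr _ fun o => ih (fun z => φ (out (x, o) :: z)) _

theorem ex_roundData {n : ℕ} (t : Tables C) (cur : Fin m → Bool → Label n)
    (φ : RoundData C → ℝ≥0∞) :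
    ex (roundData S C t n (listLabels cur)) φ =
      ex (unif (Fin s → Bool → Label n)) fun a =>
      ex (unif (Fin (C.g + m + 1) → Bool → Label n)) fun b =>
      ex (garbleRound S C n t (Src.val cur a b)) fun G => φ (listLabels b, listLabels a, G) := by
  simp only [roundData, randomLabels, ex_bind, ex_map]
  refine ex_congr _ fun a => ex_congr _ fun b => ?_
  have e : ∀ w, Src.val (listLabels cur) (listLabels a) (listLabels b) w =
      fun c => (Src.val cur a b w c).toList := by
    intro w
    cases w <;> rfl
  simp only [e]
  rfl

/-- The truncation in `nextLabels` bounds the state of the loop for arbitrary round data; on genuine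
labels it does nothing. -/
theorem nextLabels_eq {n : ℕ} (b : Fin (C.g + m + 1) → Bool → Label n)
    (y : (Fin s → Bool → List Bool) × (Fin (C.g + m + 1) → (Fin 4 → List Bool) × Data)) :
    nextLabels C (n, listLabels b, y) = listLabels fun i => b (C.stateGate i) := by
  funext i c
  exact List.take_of_length_le (by simp [listLabels])

/-- The message of a round that shows the flag `x.1`. -/
def roundMsg (x : Bool × RoundData C) : Msg C :=
  ((fun j => (x.2.2.2 j).1), (fun i => x.2.2.1 i false),
    if x.1 then (x.2.1 C.flagGate true, x.2.1 C.flagGate false)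
    else (x.2.1 C.flagGate false, x.2.1 C.flagGate true))

/-- The messages in the ideal view of the Monitor and the random choices of the System are both runs
of `chain`, with different tables and outputs. One sampling lemma thus serves both simulators. -/
theorem ex_messages_eq_chain {n : ℕ} (t : Tables C) (cur : Fin m → Bool → Label n) (l : List Bool)
    (φ : List (Msg C) → ℝ≥0∞) :
    ex (messages S C n cur (l.map fun τ => (t, τ))) φ =
      ex (chain S C t (roundMsg C) n (listLabels cur) l) φ := by
  induction l generalizing cur φ with
  | nil => simp [messages, chain]
  | cons τ l ih =>
    simp only [List.map_cons, messages, chain, ex_bind, ex_roundData, ex_map, ih, nextLabels_eq]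
    refine ex_congr _ fun a => ex_congr _ fun b => ex_congr _ fun G => ex_congr _ fun z => ?_
    cases τ <;> rfl

/-- The random choices of a round. -/
noncomputable def roundRandom {δ : Type} (x : δ × RoundData C) : Data :=
  code (x.2.2.1, x.2.1, fun j => (x.2.2.2 j).2)

theorem code_listLabels {n k : ℕ} (f : Fin k → Bool → Label n) : code (listLabels f) = code f :=
  code_pi_congr fun _ => rfl

theorem ex_sysRandom_eq_chain {n : ℕ} (cur : Fin m → Bool → Label n) (l : List (Fin s → Bool))
    (φ : List Data → ℝ≥0∞) :
    ex (sysRandom S C n cur l) φ =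
      ex (chain S C (fun _ => nand) (roundRandom C) n (listLabels cur) l) φ := by
  induction l generalizing cur φ with
  | nil => simp [sysRandom, chain]
  | cons x l ih =>
    simp only [sysRandom, chain, ex_bind, ex_sysRound, ex_roundData, ex_map, ih, nextLabels_eq,
      roundRandom, code_pair, code_listLabels]

end OpenSpec

end PPM

/-! ### The simulators and the conclusion -/

namespace PPM

open Code (code)
open Decode (decode decode_code)
open scoped ENNReal

/-- A machine that samples a family of distributions, up to a negligible error. -/
theorem Samp.exists_ppt {α β : Type} [Code α] [Code β] {G : ℕ → α → Prop} {X : ℕ → α → PMF β}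
    (h : Samp G X) : ∃ (A : PPT α β) (ε : ℕ → ℝ≥0∞), ENegl ε ∧
      ∀ n a, G n a → SDist (ε n) (A.dist n a) (X n a) := by
  obtain ⟨f, c, ε, hf, hε, h⟩ := h
  refine ⟨⟨f, hf, c⟩, ε, hε, fun n a ha => ?_⟩
  have e : (PPT.mk f hf c).dist n a = (PPM.lbits (c.eval n)).map fun r => f (n, a, r) :=
    pmf_ext_ex fun φ => by simp [PPT.dist, ex_lbits]
  rw [e]
  exact h n a ha

/-- Indistinguishability follows from closeness of the acceptance probabilities. -/
theorem Indist.of_close {ι : ℕ → Type} {X Y : (n : ℕ) → ι n → PMF Data}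
    (h : ∀ (D : PPT (Data × Data) Bool) (P : Polynomial ℕ), ∃ ε, ENegl ε ∧ ∀ n (z : Data) i,
      sz z ≤ P.eval n → Close (ε n) (ex (X n i) (OpenSpec.test D n z))
        (ex (Y n i) (OpenSpec.test D n z))) : Indist X Y := by
  rintro D ⟨z, P, hz⟩
  obtain ⟨ε, ⟨δ, hδ, h0, hle⟩, h⟩ := h D P
  refine ⟨δ, hδ, fun n i => ?_⟩
  simp only [prTrue_bind_dist]
  exact ((h n (z n) i (hz n)).mono (hle n)).abs_toReal (h0 n) (ex_test_le_one ..)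
    (ex_test_le_one ..)

namespace OpenSpec

variable {m s : ℕ} (S : EncScheme) (C : Circuit m s)

theorem samp_monIdeal (simR : PPT (Bool × List Bool) Data) (ℓ : Polynomial ℕ) :
    Samp (fun n (a : (Fin m → Bool) × List Bool) => a.2.length ≤ ℓ.eval n)
      (monIdeal S C simR) := by
  have h1 : Samp (fun n (a : (Fin m → Bool) × List Bool) => a.2.length ≤ ℓ.eval n)
    fun n _ => randomLabels m n := samp_randomLabels _
  have h2 : ∀ i, Samp (fun n (y : ((Fin m → Bool) × List Bool) × (Fin m → Bool → List Bool)) =>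
      (∀ i b, (y.2 i b).length ≤ n) ∧ y.1.2.length ≤ ℓ.eval n)
      fun n y => simR.dist n (y.1.1 i, y.2 i false) := fun i =>
    (Samp.dist (G := fun _ _ => True) simR).comp
      (g := fun z : ℕ × ((Fin m → Bool) × List Bool) × (Fin m → Bool → List Bool) =>
        (z.2.1.1 i, z.2.2 i false)) (by fun_prop) fun _ _ _ => trivial
  have h3 : Samp (fun n (y : (((Fin m → Bool) × List Bool) × (Fin m → Bool → List Bool)) ×
        (Fin m → Data)) => (∀ i b, (y.1.2 i b).length ≤ n) ∧ y.1.1.2.length ≤ ℓ.eval n)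
      fun n y => chain S C (zeroTables C) (roundMsg C) n y.1.2 y.1.1.2 :=
    (samp_chain S C (zeroTables C) (out := roundMsg C) (by unfold roundMsg; fun_prop) ℓ).comp
      (g := fun z : ℕ × (((Fin m → Bool) × List Bool) × (Fin m → Bool → List Bool)) ×
        (Fin m → Data) => (z.2.1.2, z.2.1.1.2)) (by fun_prop) fun _ _ h => h
  refine (h1.bind ((Samp.indep h2).bind (h3.map (f := fun z => view C (code z.2.1.1.1.1)
    (code z.2.1.2) z.2.2) (by unfold view; fun_prop)) fun _ _ h _ _ => h)
    fun n a h cur hcur => ⟨fun i b => (length_randomLabels hcur i b).le, h⟩).congr fun n a _ φ => ?_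
  simp only [monIdeal, randomLabels, ex_bind, ex_map, ex_messages_eq_chain]
  rfl

theorem samp_sysIdeal (simS : PPT (List Bool × List Bool) Data) (ℓ : Polynomial ℕ) :
    Samp (fun n (σ : List (Fin s → Bool)) => σ.length ≤ ℓ.eval n) (sysIdeal S C simS) := by
  have h1 : Samp (fun n (σ : List (Fin s → Bool)) => σ.length ≤ ℓ.eval n)
    fun n _ => randomLabels m n := samp_randomLabels _
  have h2 : ∀ i, Samp (fun n (y : List (Fin s → Bool) × (Fin m → Bool → List Bool)) =>
      (∀ i b, (y.2 i b).length ≤ n) ∧ y.1.length ≤ ℓ.eval n)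
      fun n y => simS.dist n (y.2 i false, y.2 i true) := fun i =>
    (Samp.dist (G := fun _ _ => True) simS).comp
      (g := fun z : ℕ × List (Fin s → Bool) × (Fin m → Bool → List Bool) =>
        (z.2.2 i false, z.2.2 i true)) (by fun_prop) fun _ _ _ => trivial
  have h3 : Samp (fun n (y : (List (Fin s → Bool) × (Fin m → Bool → List Bool)) ×
        (Fin m → Data)) => (∀ i b, (y.1.2 i b).length ≤ n) ∧ y.1.1.length ≤ ℓ.eval n)
      fun n y => chain S C (fun _ => nand) (roundRandom C) n y.1.2 y.1.1 :=
    (samp_chain S C (fun _ => nand) (out := roundRandom C) (by unfold roundRandom; fun_prop) ℓ).comp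
      (g := fun z : ℕ × (List (Fin s → Bool) × (Fin m → Bool → List Bool)) ×
        (Fin m → Data) => (z.2.1.2, z.2.1.1)) (by fun_prop) fun _ _ h => h
  refine (h1.bind ((Samp.indep h2).bind (h3.map (f := fun z =>
    code (z.2.1.1.1, z.2.1.1.2, z.2.1.2, z.2.2)) (by fun_prop)) fun _ _ h _ _ => h)
    fun n a h cur hcur => ⟨fun i b => (length_randomLabels hcur i b).le, h⟩).congr fun n a _ φ => ?_
  simp only [sysIdeal, randomLabels, ex_bind, ex_map, ex_sysRandom_eq_chain, code_pair,
    code_listLabels]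
  rfl

theorem _root_.PPM.Circuit.length_flags (μ : Fin m → Bool) (σ : List (Fin s → Bool)) :
    (C.flags μ σ).length = σ.length := by
  induction σ generalizing μ with
  | nil => rfl
  | cons x σ ih => simp [Circuit.flags, ih]

/-- The simulators are the sampling machines of the ideal views. The statistical error of sampling
is added to the distance between ideal and real view. -/
theorem protocol_secure (hcpa : S.CPASecure) {OT : OTProtocol} (hOT : OT.Secure)
    (ℓ : Polynomial ℕ) : (protocol S OT C).Secure C ℓ := by
  obtain ⟨-, ⟨simS, hS⟩, ⟨simR, hR⟩⟩ := hOT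
  obtain ⟨A, ε, hε, hA⟩ := (samp_monIdeal S C simR ℓ).exists_ppt
  obtain ⟨B, ε', hε', hB⟩ := (samp_sysIdeal S C simS ℓ).exists_ppt
  refine ⟨A, B, .of_close fun D P => ?_, .of_close fun D P => ?_⟩
  · obtain ⟨δ, hδ, h⟩ := exists_close_monView S C OT hcpa hR D P ℓ
    refine ⟨_, hε.add hδ, fun n z i hz => ?_⟩
    rw [ex_map]
    exact (hA n _ (by simp [Circuit.length_flags]) _ fun v => test_le_one ..).trans
      (h n z i.1 i.2.toList hz i.2.toList_length)
  · obtain ⟨δ, hδ, h⟩ := exists_close_sysView S C OT hS D P ℓ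
    refine ⟨_, hε'.add hδ, fun n z i hz => ?_⟩
    rw [ex_map]
    exact (hB n _ (by simp) _ fun v => test_le_one ..).trans
      (h n z i.1 i.2.toList hz i.2.toList_length)

end OpenSpec

end PPM

theorem theorem1 (S : PPM.EncScheme) (hcpa : S.CPASecure) (hel : S.ElusiveRange)
    (OT : PPM.OTProtocol) (hOT : OT.Secure) (ℓ : Polynomial ℕ)
    (m s : ℕ) (C : PPM.Circuit m s) :
    (PPM.OpenSpec.protocol S OT C).Correct C ℓ ∧ (PPM.OpenSpec.protocol S OT C).Secure C ℓ :=
  ⟨PPM.OpenSpec.protocol_correct S C hcpa hel hOT ℓ, PPM.OpenSpec.protocol_secure S C hcpa hOT ℓ⟩
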